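/- Let $(X,\omega)$ be a flat bi-polarized symplectic manifold of dimension $2n$: $X$ carries two (possibly complex) distributions $J,K\subset TX\otimes\mathbb C$ such that about every point there are smooth (possibly complex-valued) coordinates $p_1,\dots,p_n,q^1,\dots,q^n$ with $\omega=\sum_j dp_j\wedge dq^j$, with $J$ spanned by the $\partial_{p_j}$ and $K$ spanned by the $\partial_{q^j}$ (so $J$, $K$ are transverse polarizations). Call such coordinates an adapted Darboux chart. Let $\hbar>0$ and let $(Y,\alpha)\to X$ be a prequantum circle bundle: a principal $U(1)$-bundle with connection form $\alpha$, equal to $1$ on the generator of the circle action, and $d\alpha=\omega/\hbar$. Write $V^\#$ for the horizontal lift of $V$ to $Y$. An observable is a function $H\in C^\infty(X,\mathbb C)$; a prequantum wave function is a smooth $\Psi:Y\to\mathbb C$ with $\Psi(u\cdot y)=u\,\Psi(y)$ for $u\in U(1)$; it is $J$-polarized if $\zeta^\#[\Psi]=0$ for all $\zeta\in J$. Let $\mathcal H_J$ be the space of $J$-polarized wave functions. In an adapted Darboux chart put $$\nu=\sum_k\partial_{p_k}\otimes\partial_{q^k},\qquad \nu^\#(f\otimes g)=\sum_k\partial_{p_k}^\#f\otimes\partial_{q^k}^\#g,\qquad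 m(f\otimes g)=fg,$$ $$C_k(f,g)=\tfrac1{k!}\,m\big((\nu^\#)^k(f\otimes g)\big),\qquad c_k(F,G)=\tfrac1{k!}\,m\big(\nu^k(F\otimes G)\big)$$ for smooth functions $f,g$ on $Y$, resp. $F,G$ on $X$, and $$H\bullet_\nu\Psi=m\circ\exp\!\Big(\frac{\hbar}{\mathrm i}\nu^\#\Big)(H\otimes\Psi)=\sum_{k\ge0}\Big(\frac{\hbar}{\mathrm i}\Big)^kC_k(H,\Psi),$$ where functions on $X$ are pulled back to $Y$. Say that the exponential series of $(H,\Psi)$ converges if about every point of the diagonal of $Y\times Y$ there is a neighbourhood on which, in some adapted Darboux chart, the partial sums of $\exp(\frac{\hbar}{\mathrm i}\nu^\#)(H\otimes\Psi)$, where $f\otimes g$ is regarded as the function $(y,y')\mapsto f(y)g(y')$, converge in the $C^\infty$ topology. Then: 1. For smooth $f,g$ on $Y$ the functions $C_k(f,g)$ do not depend on the adapted Darboux chart, hence are globally defined on $Y$. If $H$ is an observable and $\Psi$ a prequantum wave function, then every $C_k(H,\Psi)$ is a prequantum wave function. For all observables $F,G$, all $h\in C^\infty(Y,\mathbb C)$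 and all $N$, $\sum_{a+b=N}C_a(c_b(F,G),h)=\sum_{a+b=N}C_a(F,C_b(G,h))$; that is, $(F\star_\lambda G)\bullet_\lambda h=F\bullet_\lambda(G\bullet_\lambda h)$ as formal power series in $\lambda$, where $F\star_\lambda G=\sum_k\lambda^kc_k(F,G)$ and $f\bullet_\lambda g=\sum_k\lambda^kC_k(f,g)$. 2. If $H$ is an observable, $\Psi\in\mathcal H_J$, and the exponential series of $(H,\Psi)$ converges, then $H\bullet_\nu\Psi$ (the sum of the series at each point, computed in any adapted Darboux chart) is again a $J$-polarized wave function. 3. Hence every observable $H$ defines a linear quantum operator $\Psi\mapsto H\bullet_\nu\Psi$ with values in $\mathcal H_J$ on the linear subspace of those $\Psi\in\mathcal H_J$ for which the series of $(H,\Psi)$ converges. It depends linearly on $H$: if the series of $(H_1,\Psi)$ and $(H_2,\Psi)$ converge and $a\in\mathbb C$, then so does that of $(aH_1+H_2,\Psi)$, and $(aH_1+H_2)\bullet_\nu\Psi=a\,(H_1\bullet_\nu\Psi)+H_2\bullet_\nu\Psi$. If $H$ is polynomial in the momenta (about every point, for some adapted Darboux chart and some $d$, all derivatives of order $d$ of $H$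 in the $p_j$ vanish), the series converges for every $\Psi\in\mathcal H_J$, so that the operator is defined on all of $\mathcal H_J$. -/

import Mathlib

open scoped Manifold ContDiff TensorProduct Topology

noncomputable section

namespace NormalProduct

/-! ### Differential forms on manifolds -/

section Forms

variable {E : Type*} [NormedAddCommGroup E] [NormedSpace ℝ E]
  {M : Type*} [TopologicalSpace M] [ChartedSpace E M]

variable (E M) in
/-- A real differential `k`-form on `M` (no regularity imposed). -/
abbrev DForm (k : ℕ) : Type _ := ∀ x : M, TangentSpace 𝓘(ℝ, E) x [⋀^Fin k]→L[ℝ] ℝ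

/-- The expression of a form in the chart around `x₀`, i.e. its pull-back by the inverse chart. -/
def DForm.inChart {k : ℕ} (β : DForm E M k) (x₀ : M) (z : E) : E [⋀^Fin k]→L[ℝ] ℝ :=
  (β ((extChartAt 𝓘(ℝ, E) x₀).symm z)).compContinuousLinearMap
    (mfderiv 𝓘(ℝ, E) 𝓘(ℝ, E) (extChartAt 𝓘(ℝ, E) x₀).symm z)

/-- Smoothness of a form: its expression in each chart is smooth. -/
def DForm.IsSmooth {k : ℕ} (β : DForm E M k) : Prop :=
  ∀ x₀ : M, ContDiffOn ℝ ∞ (β.inChart x₀) (extChartAt 𝓘(ℝ, E) x₀).target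

/-- The exterior derivative, computed at `x` in the chart around `x`.
The normalisation is `dβ (v, w) = v (β w) - w (β v) - β [v, w]` for 1-forms. -/
def DForm.d {k : ℕ} (β : DForm E M k) : DForm E M (k + 1) := fun x =>
  (extDeriv (β.inChart x) (extChartAt 𝓘(ℝ, E) x x)).compContinuousLinearMap
    (mfderiv 𝓘(ℝ, E) 𝓘(ℝ, E) (extChartAt 𝓘(ℝ, E) x) x)

/-- A symplectic form: a smooth closed non-degenerate 2-form. -/
structure IsSymplectic (Ω : DForm E M 2) : Prop where
  smooth : Ω.IsSmooth
  closed : Ω.d = fun _ => 0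
  nondegenerate : ∀ (x : M) (v : TangentSpace 𝓘(ℝ, E) x), (∀ w, Ω x ![v, w] = 0) → v = 0

/-- The complexified tangent space at `x`. -/
abbrev CTangent (x : M) : Type _ := ℂ ⊗[ℝ] TangentSpace 𝓘(ℝ, E) x

/-- The real-linear differential of a complex-valued function. -/
def dR (f : M → ℂ) (x : M) : TangentSpace 𝓘(ℝ, E) x →L[ℝ] ℂ :=
  mfderiv 𝓘(ℝ, E) 𝓘(ℝ, ℂ) f x

/-- The differential of a complex-valued function, extended complex-linearly to complexified
tangent vectors: `dC f x (a ⊗ v) = a * df (v)`. -/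
def dC (f : M → ℂ) (x : M) : CTangent (E := E) x →ₗ[ℂ] ℂ :=
  LinearMap.liftBaseChange ℂ (dR (E := E) f x : TangentSpace 𝓘(ℝ, E) x →ₗ[ℝ] ℂ)

theorem dC_tmul (f : M → ℂ) (x : M) (a : ℂ) (v : TangentSpace 𝓘(ℝ, E) x) :
    dC f x (a ⊗ₜ[ℝ] v) = a * dR f x v := by
  simp [dC]

theorem dC_add (f g : M → ℂ) (x : M) (hf : MDifferentiableAt 𝓘(ℝ, E) 𝓘(ℝ, ℂ) f x)
    (hg : MDifferentiableAt 𝓘(ℝ, E) 𝓘(ℝ, ℂ) g x) :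
    dC (E := E) (f + g) x = dC f x + dC g x := by
  have h : dR (E := E) (f + g) x = dR f x + dR g x := mfderiv_add hf hg
  ext v
  simp [dC, h]

theorem dC_const_smul (a : ℂ) (f : M → ℂ) (x : M)
    (hf : MDifferentiableAt 𝓘(ℝ, E) 𝓘(ℝ, ℂ) f x) :
    dC (E := E) (a • f) x = a • dC f x := by
  have h : dR (E := E) (a • f) x = a • dR f x := by
    have h1 : HasMFDerivAt 𝓘(ℝ, E) 𝓘(ℝ, ℂ) f x (dR (E := E) f x) := hf.hasMFDerivAt
    refine HasMFDerivAt.mfderiv ⟨h1.1.const_smul a, ?_⟩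
    exact HasFDerivWithinAt.const_smul h1.2 a
  ext v
  simp [dC, h]

/-- The derivative `V[f]` of a complex-valued function along a complex vector field `V`. -/
def lieD (V : ∀ x : M, CTangent (E := E) x) (f : M → ℂ) : M → ℂ := fun x => dC f x (V x)

end Forms

/-! ### Flat bi-polarized symplectic manifolds -/

section Phase

variable {E : Type*} [NormedAddCommGroup E] [NormedSpace ℝ E]
  {X : Type*} [TopologicalSpace X] [ChartedSpace E X]

/-- A Darboux system `(p_j, q^j)` on the open set `U`, adapted to the complex distributions
`J` and `K`: one has `Ω = ∑ dp_j ∧ dq^j`, the coordinate fields `∂_{p_j}` span `J`, and the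
coordinate fields `∂_{q^j}` span `K`.  The fields `P j = ∂_{p_j}` and `Q j = ∂_{q^j}` are
determined on `U` as the frame dual to `(dp_j, dq^j)`.  The coordinates are allowed to be complex
valued, as is needed when `J` and `K` are complex; for real polarizations real coordinates are a
particular case. -/
structure DarbouxChart (n : ℕ) (Ω : DForm E X 2) (J K : ∀ x : X, Submodule ℂ (CTangent (E := E) x))
    where
  U : Set X
  isOpen : IsOpen U
  p : Fin n → X → ℂ
  q : Fin n → X → ℂ
  smooth_p : ∀ j, ContMDiffOn 𝓘(ℝ, E) 𝓘(ℝ, ℂ) ∞ (p j) U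
  smooth_q : ∀ j, ContMDiffOn 𝓘(ℝ, E) 𝓘(ℝ, ℂ) ∞ (q j) U
  P : Fin n → ∀ x : X, CTangent (E := E) x
  Q : Fin n → ∀ x : X, CTangent (E := E) x
  dp_P : ∀ x ∈ U, ∀ i j, dC (p i) x (P j x) = if i = j then 1 else 0
  dp_Q : ∀ x ∈ U, ∀ i j, dC (p i) x (Q j x) = 0
  dq_P : ∀ x ∈ U, ∀ i j, dC (q i) x (P j x) = 0
  dq_Q : ∀ x ∈ U, ∀ i j, dC (q i) x (Q j x) = if i = j then 1 else 0
  darboux : ∀ x ∈ U, ∀ v w : TangentSpace 𝓘(ℝ, E) x,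
    ((Ω x ![v, w] : ℝ) : ℂ) =
      ∑ j, (dR (p j) x v * dR (q j) x w - dR (p j) x w * dR (q j) x v)
  span_P : ∀ x ∈ U, J x = Submodule.span ℂ (Set.range fun j => P j x)
  span_Q : ∀ x ∈ U, K x = Submodule.span ℂ (Set.range fun j => Q j x)

variable (E X) in
/-- A flat bi-polarized symplectic manifold of dimension `2n`: a symplectic manifold with two
complex distributions `J`, `K` for which there is an adapted Darboux chart about every point.
(That `J` and `K` are smooth, Lagrangian, involutive and transverse is part of the existence of
these charts.) -/
structure FlatBiPolarized (n : ℕ) where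
  Ω : DForm E X 2
  symplectic : IsSymplectic Ω
  J : ∀ x : X, Submodule ℂ (CTangent (E := E) x)
  K : ∀ x : X, Submodule ℂ (CTangent (E := E) x)
  flat : ∀ x : X, ∃ c : DarbouxChart n Ω J K, x ∈ c.U

end Phase

/-! ### Prequantum circle bundles -/

section Bundle

variable {E : Type*} [NormedAddCommGroup E] [NormedSpace ℝ E]
  {X : Type*} [TopologicalSpace X] [ChartedSpace E X]
  {F : Type*} [NormedAddCommGroup F] [NormedSpace ℝ F]
  {Y : Type*} [TopologicalSpace Y] [ChartedSpace F Y] [MulAction Circle Y]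

variable (F Y) in
/-- The generator `η` of the circle action, `η y = d/dt (e^{it} • y)` at `t = 0`. -/
def generator (y : Y) : TangentSpace 𝓘(ℝ, F) y :=
  (mfderiv 𝓘(ℝ, ℝ) 𝓘(ℝ, F) (fun t : ℝ => Circle.exp t • y) 0 (1 : ℝ) : F)

variable (E F X Y) in
/-- `proj : Y → X` is a smooth principal circle bundle: a smooth circle action with smooth
equivariant local trivialisations `y ↦ (proj y, τ y) ∈ U × U(1)`, whose inverses are
`(x, u) ↦ u • s x` for a smooth local section `s`. -/
structure IsCircleBundle (proj : Y → X) : Prop where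
  smooth_smul : ContMDiff ((𝓡 1).prod 𝓘(ℝ, F)) 𝓘(ℝ, F) ∞ fun a : Circle × Y => a.1 • a.2
  smooth_proj : ContMDiff 𝓘(ℝ, F) 𝓘(ℝ, E) ∞ proj
  proj_smul : ∀ (u : Circle) (y : Y), proj (u • y) = proj y
  locally_trivial : ∀ x₀ : X, ∃ (U : Set X) (s : X → Y) (τ : Y → Circle),
    IsOpen U ∧ x₀ ∈ U ∧
    ContMDiffOn 𝓘(ℝ, E) 𝓘(ℝ, F) ∞ s U ∧ ContMDiffOn 𝓘(ℝ, F) (𝓡 1) ∞ τ (proj ⁻¹' U) ∧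
    (∀ x ∈ U, proj (s x) = x) ∧
    (∀ y, proj y ∈ U → τ y • s (proj y) = y) ∧
    ∀ (u : Circle) (y : Y), proj y ∈ U → τ (u • y) = u * τ y

variable (F Y) in
/-- A prequantum circle bundle over `(X, Ω)`: a principal circle bundle with a connection 1-form
`α` (smooth, invariant, equal to `1` on the generator) such that `dα = Ω / ħ`. -/
structure PrequantumBundle (ħ : ℝ) (Ω : DForm E X 2) where
  proj : Y → X
  isBundle : IsCircleBundle E X F Y proj
  α : ∀ y : Y, TangentSpace 𝓘(ℝ, F) y →L[ℝ] ℝ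
  smooth_α : DForm.IsSmooth (E := F) (M := Y) fun y => .ofSubsingleton ℝ _ ℝ (0 : Fin 1) (α y)
  α_generator : ∀ y, α y (generator F Y y) = 1
  α_invariant : ∀ (u : Circle) (y : Y) (v : TangentSpace 𝓘(ℝ, F) y),
    α (u • y) (mfderiv 𝓘(ℝ, F) 𝓘(ℝ, F) (fun z : Y => u • z) y v) = α y v
  curvature : ∀ y, DForm.d (E := F) (M := Y)
      (fun y => .ofSubsingleton ℝ _ ℝ (0 : Fin 1) (α y)) y =
    ħ⁻¹ • (Ω (proj y)).compContinuousLinearMap (mfderiv 𝓘(ℝ, F) 𝓘(ℝ, E) proj y)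

namespace PrequantumBundle

variable {ħ : ℝ} {Ω : DForm E X 2} (B : PrequantumBundle F Y ħ Ω)

/-- The horizontal lift at `y`: the inverse of `(dproj, α) : T_y Y → T_x X × ℝ` on vectors
`(v, 0)`, so that `dproj (hlift v) = v` and `α (hlift v) = 0`. -/
def hlift (y : Y) : TangentSpace 𝓘(ℝ, E) (B.proj y) →L[ℝ] TangentSpace 𝓘(ℝ, F) y :=
  (ContinuousLinearMap.inverse
    ((mfderiv 𝓘(ℝ, F) 𝓘(ℝ, E) B.proj y).prod (B.α y))).comp (ContinuousLinearMap.inl ℝ _ ℝ)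

/-- The horizontal lift of complexified tangent vectors. -/
def hliftC (y : Y) : CTangent (E := E) (B.proj y) →ₗ[ℂ] CTangent (E := F) y :=
  LinearMap.baseChange ℂ
    (B.hlift y : TangentSpace 𝓘(ℝ, E) (B.proj y) →ₗ[ℝ] TangentSpace 𝓘(ℝ, F) y)

/-- The horizontal lift `V^#` of a complex vector field on `X`. -/
def lift (V : ∀ x : X, CTangent (E := E) x) (y : Y) : CTangent (E := F) y :=
  B.hliftC y (V (B.proj y))

end PrequantumBundle

variable (F Y) in
/-- Prequantum wave functions: smooth `U(1)`-equivariant functions on `Y`. -/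
def waveFunctions : Submodule ℂ (Y → ℂ) where
  carrier := {Ψ | ContMDiff 𝓘(ℝ, F) 𝓘(ℝ, ℂ) ∞ Ψ ∧ ∀ (u : Circle) (y : Y), Ψ (u • y) = u * Ψ y}
  zero_mem' := ⟨contMDiff_const, fun u y => by simp⟩
  add_mem' := fun {f g} hf hg => ⟨hf.1.add hg.1, fun u y => by
    simp only [Pi.add_apply, hf.2, hg.2, mul_add]⟩
  smul_mem' := fun a f hf => ⟨(contDiff_const_smul (𝕜 := ℝ) (n := ∞) (F := ℂ) a).comp_contMDiff hf.1, fun u y => by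
    simp only [Pi.smul_apply, hf.2, smul_eq_mul]; ring⟩

/-- `J`-polarized wave functions: prequantum wave functions `Ψ` with `ζ^#[Ψ] = 0` for all
`ζ ∈ J`. -/
def polarized {ħ : ℝ} {Ω : DForm E X 2} (B : PrequantumBundle F Y ħ Ω)
    (J : ∀ x : X, Submodule ℂ (CTangent (E := E) x)) : Submodule ℂ (Y → ℂ) where
  carrier := {Ψ | Ψ ∈ waveFunctions F Y ∧
    ∀ y : Y, ∀ ζ ∈ J (B.proj y), dC Ψ y (B.hliftC y ζ) = 0}
  zero_mem' := ⟨Submodule.zero_mem _, fun y ζ _ => by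
    have h := dC_const_smul (E := F) (0 : ℂ) (0 : Y → ℂ) y mdifferentiableAt_const
    rw [zero_smul, zero_smul] at h
    rw [h, LinearMap.zero_apply]⟩
  add_mem' := fun {f g} hf hg => ⟨Submodule.add_mem _ hf.1 hg.1, fun y ζ hζ => by
    rw [dC_add _ _ _ (hf.1.1.mdifferentiable (by simp) y) (hg.1.1.mdifferentiable (by simp) y),
      LinearMap.add_apply, hf.2 y ζ hζ, hg.2 y ζ hζ, add_zero]⟩
  smul_mem' := fun a f hf => ⟨Submodule.smul_mem _ a hf.1, fun y ζ hζ => by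
    rw [dC_const_smul _ _ _ (hf.1.1.mdifferentiable (by simp) y), LinearMap.smul_apply,
      hf.2 y ζ hζ, smul_zero]⟩

end Bundle

/-! ### Exponential products -/

section Product

/-- For operators `A j`, `B j` on functions, the `k`-th power of the bidifferential operator
`Λ = ∑_j A j ⊗ B j`, where `Λ (f ⊗ g) = ∑_j A j f ⊗ B j g`, applied to `f ⊗ g`.  The tensor
`f ⊗ g` is regarded as the function `(y, y') ↦ f y * g y'`. -/
def tensorPow {n : ℕ} {Z : Type*} (A B : Fin n → (Z → ℂ) → Z → ℂ) :
    ℕ → (Z → ℂ) → (Z → ℂ) → Z × Z → ℂ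
  | 0, f, g => fun z => f z.1 * g z.2
  | k + 1, f, g => fun z => ∑ j, tensorPow A B k (A j f) (B j g) z

/-- Convergence in `C^∞(W, ℂ)`: the limit is smooth on `W`, and in charts all derivatives converge
locally uniformly. -/
def SmoothTendstoOn {E H M : Type*} [NormedAddCommGroup E] [NormedSpace ℝ E] [TopologicalSpace H]
    (I : ModelWithCorners ℝ E H) [TopologicalSpace M] [ChartedSpace H M]
    (f : ℕ → M → ℂ) (g : M → ℂ) (W : Set M) : Prop :=
  ContMDiffOn I 𝓘(ℝ, ℂ) ∞ g W ∧
  ∀ (m : ℕ) (z₀ : M), TendstoLocallyUniformlyOn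
    (fun N => iteratedFDeriv ℝ m (f N ∘ (extChartAt I z₀).symm))
    (iteratedFDeriv ℝ m (g ∘ (extChartAt I z₀).symm)) Filter.atTop
    ((extChartAt I z₀).target ∩ (extChartAt I z₀).symm ⁻¹' W)

variable {E : Type*} [NormedAddCommGroup E] [NormedSpace ℝ E]
  {X : Type*} [TopologicalSpace X] [ChartedSpace E X]
  {F : Type*} [NormedAddCommGroup F] [NormedSpace ℝ F]
  {Y : Type*} [TopologicalSpace Y] [ChartedSpace F Y] [MulAction Circle Y]
  {n : ℕ} {ħ : ℝ}

/-- The function `ν^k (f ⊗ g)` for the normal tensor `ν = ∑ ∂_{p_j} ⊗ ∂_{q^j}` in a chart. -/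
def nuPow {Ω : DForm E X 2} {J K : ∀ x : X, Submodule ℂ (CTangent (E := E) x)}
    (c : DarbouxChart n Ω J K) (k : ℕ) (f g : X → ℂ) : X × X → ℂ :=
  tensorPow (fun j => lieD (c.P j)) (fun j => lieD (c.Q j)) k f g

/-- The function `(ν^#)^k (f ⊗ g)` for the lift `ν^# = ∑ ∂_{p_j}^# ⊗ ∂_{q^j}^#` in a chart. -/
def nuLiftPow {Ω : DForm E X 2} {J K : ∀ x : X, Submodule ℂ (CTangent (E := E) x)}
    (B : PrequantumBundle F Y ħ Ω) (c : DarbouxChart n Ω J K) (k : ℕ) (f g : Y → ℂ) :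
    Y × Y → ℂ :=
  tensorPow (fun j => lieD (B.lift (c.P j))) (fun j => lieD (B.lift (c.Q j))) k f g

/-- The partial sums `∑_{k < N} (ħ/i)^k / k! (ν^#)^k (f ⊗ g)` of `exp ((ħ/i) ν^#) (f ⊗ g)`. -/
def expSum {Ω : DForm E X 2} {J K : ∀ x : X, Submodule ℂ (CTangent (E := E) x)}
    (B : PrequantumBundle F Y ħ Ω) (c : DarbouxChart n Ω J K) (f g : Y → ℂ) (N : ℕ) :
    Y × Y → ℂ :=
  fun z => ∑ k ∈ Finset.range N, ((ħ : ℂ) / Complex.I) ^ k / (k.factorial : ℂ) *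
    nuLiftPow B c k f g z

variable (S : FlatBiPolarized E X n)

/-- A choice of an adapted Darboux chart about each point. -/
def chart (x : X) : DarbouxChart n S.Ω S.J S.K := (S.flat x).choose

/-- The coefficient `(1/k!) m (ν^k (f ⊗ g))` of `λ^k` in the star product `f ⋆_λ g` on `X`. -/
def starCoeff (k : ℕ) (f g : X → ℂ) : X → ℂ :=
  fun x => (k.factorial : ℂ)⁻¹ * nuPow (chart S x) k f g (x, x)

/-- The coefficient `(1/k!) m ((ν^#)^k (f ⊗ g))` of `λ^k` in the lifted product `f •_λ g`
on `Y`. -/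
def liftCoeff (B : PrequantumBundle F Y ħ S.Ω) (k : ℕ) (f g : Y → ℂ) : Y → ℂ :=
  fun y => (k.factorial : ℂ)⁻¹ * nuLiftPow B (chart S (B.proj y)) k f g (y, y)

/-- The normal product `H •_ν Ψ = m (exp ((ħ/i) ν^#) (H ⊗ Ψ))` of a function `H` on `X` (pulled
back to `Y`) and a function `Ψ` on `Y`. -/
def normalProduct (B : PrequantumBundle F Y ħ S.Ω) (H : X → ℂ) (Ψ : Y → ℂ) : Y → ℂ :=
  fun y => Filter.limUnder Filter.atTop fun N =>
    expSum B (chart S (B.proj y)) (H ∘ B.proj) Ψ N (y, y)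

/-- The exponential series `exp ((ħ/i) ν^#) (H ⊗ Ψ)` converges: about every point of the diagonal
of `Y × Y` there is a neighbourhood on which, in some adapted Darboux chart, the series converges
in the `C^∞` topology. -/
def ExpConverges (B : PrequantumBundle F Y ħ S.Ω) (H : X → ℂ) (Ψ : Y → ℂ) : Prop :=
  ∀ y : Y, ∃ (c : DarbouxChart n S.Ω S.J S.K) (W : Set (Y × Y)) (G : Y × Y → ℂ),
    IsOpen W ∧ (y, y) ∈ W ∧ (∀ z ∈ W, B.proj z.1 ∈ c.U ∧ B.proj z.2 ∈ c.U) ∧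
    SmoothTendstoOn (𝓘(ℝ, F).prod 𝓘(ℝ, F)) (expSum B c (H ∘ B.proj) Ψ) G W

/-- `H` is polynomial in the momenta: about every point there is an adapted Darboux chart on which
all derivatives `∂_{p_{j_1}} ⋯ ∂_{p_{j_d}} H` of some order `d` vanish. -/
def IsMomentumPolynomial (H : X → ℂ) : Prop :=
  ∀ x : X, ∃ (c : DarbouxChart n S.Ω S.J S.K) (d : ℕ), x ∈ c.U ∧
    ∀ j : List (Fin n), j.length = d →
      ∀ x' ∈ c.U, j.foldr (fun i f => lieD (c.P i) f) H x' = 0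

end Product

end NormalProduct

end

noncomputable section

namespace NormalProduct


/-! ### Exponentials of bidifferential operators: algebra -/

section Algebra

variable {n : ℕ} {A M Z Z' : Type*} [AddCommGroup A] [Module ℂ A] [AddCommGroup M] [Module ℂ M]
  [AddCommGroup Z] [Module ℂ Z] [AddCommGroup Z'] [Module ℂ Z']

/-! Write η for the generator of the circle action. Over an adapted Darboux chart, (α, dp_j, dq^j)
is a coframe on Y with dual frame (η, ∂_{p_j}^#, ∂_{q^j}^#) (`isCoframe`). The forms dp_j, dq^j are
closed and dα = (1/ħ) ∑ dp_j ∧ dq^j, so the structure coefficients are constant and the frame fields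
commute up to the single relation [∂_{p_i}^#, ∂_{q^j}^#] = -(δ_ij/ħ) η (`IsCoframe.commutator`,
`op_P_op_Q`). Given this, the theorem is mostly algebra of linear operators P_j, Q_j and of the
bilinear maps β ∘ (∑ P_j ⊗ Q_j)^k; `tensorPow_eq_biPow` translates between this algebra and the
pointwise definitions.

Chart independence. Two charts adapted to the same J and K have frames related by P = a P' and Q = b
Q' with a bᵀ = 1, because the symplectic form pairs J with K. The matrices a and b are locally
constant (`eventually_transition`), so they pass through iterated derivatives, and the powers of ν^#
agree on a neighbourhood of each diagonal point, also off the diagonal (`exists_nuLiftPow_eq`).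

Wave functions. Equivariance is the equation η Ψ = iΨ. The field η commutes with the frame and
annihilates functions pulled back from X, whence η C_k(H, Ψ) = i C_k(H, Ψ).

Associativity. Multiplying the degree N + 1 part by N + 1 and using that the P_j and Q_j act as
derivations, both sides satisfy the same recursion (`biCoeff_assoc`). Only the Q_j act on functions
on Y, so the curvature does not interfere.

Polarization. Let P_i Ψ = 0. On the diagonal, the Leibniz rule for P_i on (ν^#)^k (H ⊗ Ψ) produces
an extra term from [P_i, Q_i] = -η/ħ and ηΨ = iΨ. With the parameter ħ/i this term cancels the
contribution of P_i H from the neighbouring order, and P_i of a partial sum collapses to the last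
term of the partial sum for (P_i H, Ψ) (`expBi_telescope`). That last term is a difference of
consecutive partial sums of the series differentiated in the first variable alone. This is where C^∞
convergence on a neighbourhood of the diagonal in Y × Y enters: it makes the difference tend to
zero, and it allows the limit to be differentiated (`lieD_expSum_diag`,
`normalProduct_mem_polarized`). -/

/-- The bilinear map `β ∘ (∑ P j ⊗ Q j) ^ k`. -/
def biPow (P : Fin n → A →ₗ[ℂ] A) (Q : Fin n → M →ₗ[ℂ] M) (β : A →ₗ[ℂ] M →ₗ[ℂ] Z) :
    ℕ → A →ₗ[ℂ] M →ₗ[ℂ] Z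
  | 0 => β
  | k + 1 => ∑ j, (biPow P Q β k).compl₁₂ (P j) (Q j)

/-- The bilinear map `(1 / k!) β ∘ (∑ P j ⊗ Q j) ^ k`. -/
def biCoeff (P : Fin n → A →ₗ[ℂ] A) (Q : Fin n → M →ₗ[ℂ] M) (β : A →ₗ[ℂ] M →ₗ[ℂ] Z) (k : ℕ) :
    A →ₗ[ℂ] M →ₗ[ℂ] Z :=
  (k.factorial : ℂ)⁻¹ • biPow P Q β k

variable (P : Fin n → A →ₗ[ℂ] A) (Q : Fin n → M →ₗ[ℂ] M) (β : A →ₗ[ℂ] M →ₗ[ℂ] Z)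

@[simp] theorem biPow_zero : biPow P Q β 0 = β := rfl

theorem biPow_succ (k : ℕ) (f : A) (g : M) :
    biPow P Q β (k + 1) f g = ∑ j, biPow P Q β k (P j f) (Q j g) := by
  simp [biPow, LinearMap.sum_apply]

theorem biCoeff_apply (k : ℕ) (f : A) (g : M) :
    biCoeff P Q β k f g = (k.factorial : ℂ)⁻¹ • biPow P Q β k f g := by
  simp [biCoeff]

@[simp] theorem biCoeff_zero : biCoeff P Q β 0 = β := by
  simp [biCoeff]

theorem biCoeff_succ (k : ℕ) (f : A) (g : M) :
    ((k : ℂ) + 1) • biCoeff P Q β (k + 1) f g = ∑ j, biCoeff P Q β k (P j f) (Q j g) := by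
  simp only [biCoeff_apply, biPow_succ, ← Finset.smul_sum, smul_smul]
  congr 1
  have h1 : ((k : ℂ) + 1) ≠ 0 := by exact_mod_cast k.succ_ne_zero
  rw [Nat.factorial_succ]
  push_cast
  field_simp

theorem map_biPow (L : Z →ₗ[ℂ] Z') (k : ℕ) (f : A) (g : M) :
    L (biPow P Q β k f g) = biPow P Q (β.compr₂ L) k f g := by
  induction k generalizing f g with
  | zero => rfl
  | succ k ih => simp only [biPow_succ, map_sum, ih]

/-- A derivation of a product `β` is a derivation of `β ∘ (∑ P j ⊗ Q j) ^ k` up to a term which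
accounts for its commutators with the `Q j`. -/
theorem biPow_leibniz {R : Z →ₗ[ℂ] Z} {RA : A →ₗ[ℂ] A} {RM S : M →ₗ[ℂ] M} (κ : ℂ) (i : Fin n)
    (hβ : ∀ f g, R (β f g) = β (RA f) g + β f (RM g))
    (hA : ∀ j f, RA (P j f) = P j (RA f))
    (hM : ∀ j g, RM (Q j g) = Q j (RM g) + (if i = j then κ else 0) • S g)
    (hP : ∀ j f, P i (P j f) = P j (P i f))
    (hS : ∀ j g, S (Q j g) = Q j (S g)) (k : ℕ) (f : A) (g : M) :
    R (biPow P Q β k f g) = biPow P Q β k (RA f) g + biPow P Q β k f (RM g) +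
      (k * κ) • biPow P Q β (k - 1) (P i f) (S g) := by
  induction k generalizing f g with
  | zero => simp [hβ]
  | succ k ih =>
    -- For k = 0 the truncated exponent k - 1 is harmless, since the factor k vanishes.
    have h1 : ∑ j, (k * κ) • biPow P Q β (k - 1) (P i (P j f)) (S (Q j g)) =
        (k * κ) • biPow P Q β k (P i f) (S g) := by
      cases k with
      | zero => simp
      | succ k => rw [biPow_succ _ _ _ k, ← Finset.smul_sum]; simp [hS, hP]
    have h2 : ∑ j, biPow P Q β k (P j f) ((if i = j then κ else 0) • S g) =
        κ • biPow P Q β k (P i f) (S g) := by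
      rw [Finset.sum_eq_single i] <;> simp +contextual [eq_comm]
    simp only [biPow_succ _ _ _ k, map_sum, ih, Finset.sum_add_distrib, hA, hM, map_add, h1, h2,
      Nat.add_sub_cancel]
    push_cast
    module

/-- The case without commutator terms: an operator commuting with the P_j on one factor and with the
Q_j on the other passes through every power of ∑ P_j ⊗ Q_j. It serves both the recursion for
associativity and the invariance under η. -/
theorem biCoeff_derivation {R : Z →ₗ[ℂ] Z} {RA : A →ₗ[ℂ] A} {RM : M →ₗ[ℂ] M}
    (hβ : ∀ f g, R (β f g) = β (RA f) g + β f (RM g))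
    (hA : ∀ j f, RA (P j f) = P j (RA f))
    (hM : ∀ j g, RM (Q j g) = Q j (RM g)) (k : ℕ) (f : A) (g : M) :
    R (biCoeff P Q β k f g) = biCoeff P Q β k (RA f) g + biCoeff P Q β k f (RM g) := by
  have key : R (biPow P Q β k f g) = biPow P Q β k (RA f) g + biPow P Q β k f (RM g) := by
    induction k generalizing f g with
    | zero => simp [hβ]
    | succ k ih => simp only [biPow_succ, map_sum, ih, Finset.sum_add_distrib, hA, hM]
  simp only [biCoeff_apply, map_smul, key, smul_add]

/-- The change of frame formula. -/
theorem biPow_congr_frame {P' : Fin n → A →ₗ[ℂ] A} {Q' : Fin n → M →ₗ[ℂ] M}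
    (a b : Matrix (Fin n) (Fin n) ℂ)
    (hP : ∀ j f, P j f = ∑ i, a j i • P' i f) (hQ : ∀ j f, Q j f = ∑ i, b j i • Q' i f)
    (hab : a.transpose * b = 1) (k : ℕ) (f : A) (g : M) :
    biPow P Q β k f g = biPow P' Q' β k f g := by
  induction k generalizing f g with
  | zero => rfl
  | succ k ih =>
    -- The entries are constants, so they come out of all operators, and ∑_j P_j ⊗ Q_j = ∑_{i,l} (aᵀ
    -- b)_{il} P'_i ⊗ Q'_l.
    have hab' : ∀ i l, ∑ j, a j i * b j l = if i = l then 1 else 0 := fun i l => by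
      simpa [Matrix.mul_apply, Matrix.one_apply] using congrFun (congrFun hab i) l
    simp only [biPow_succ, ih, hP, hQ, map_sum, map_smul, LinearMap.sum_apply,
      LinearMap.smul_apply, smul_smul, Finset.smul_sum]
    rw [Finset.sum_comm]
    refine (Finset.sum_congr rfl fun i _ => Finset.sum_comm).trans ?_
    rw [Finset.sum_comm]
    simp only [← Finset.sum_smul]
    have : ∀ i l, ∑ j, b j i * a j l = if i = l then 1 else 0 := fun i l => by
      simp only [mul_comm (b _ _), hab', eq_comm]
    simp [this]

end Algebra

/-! ### Associativity for modules over an algebra with commuting derivations. -/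

section Associativity

variable {n : ℕ} {A M : Type*} [AddCommGroup A] [Module ℂ A] [AddCommGroup M] [Module ℂ M]
  (P Q : Fin n → A →ₗ[ℂ] A) (QM : Fin n → M →ₗ[ℂ] M) (μ : A →ₗ[ℂ] A →ₗ[ℂ] A)
  (μM : A →ₗ[ℂ] M →ₗ[ℂ] M)

/-- On the antidiagonal of N + 1 the weight N + 1 equals a + b. The terms with a = 0, respectively b
= 0, drop out of the two weighted sums, which leaves sums over the antidiagonal of N. This is the
derivative of a product of generating series, read off coefficientwise. -/
theorem sum_antidiagonal_smul_add {N : ℕ} (u : ℕ → ℕ → M) :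
    ((N : ℂ) + 1) • ∑ ab ∈ Finset.HasAntidiagonal.antidiagonal (N + 1), u ab.1 ab.2 =
      ∑ ab ∈ Finset.HasAntidiagonal.antidiagonal N, (((ab.1 : ℂ) + 1) • u (ab.1 + 1) ab.2 +
        ((ab.2 : ℂ) + 1) • u ab.1 (ab.2 + 1)) := by
  have h : ((N : ℂ) + 1) • ∑ ab ∈ Finset.HasAntidiagonal.antidiagonal (N + 1), u ab.1 ab.2 =
      ∑ ab ∈ Finset.HasAntidiagonal.antidiagonal (N + 1), (ab.1 : ℂ) • u ab.1 ab.2 +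
        ∑ ab ∈ Finset.HasAntidiagonal.antidiagonal (N + 1), (ab.2 : ℂ) • u ab.1 ab.2 := by
    rw [← Finset.sum_add_distrib, Finset.smul_sum]
    refine Finset.sum_congr rfl fun ab hab => ?_
    rw [← add_smul]
    congr 1
    exact_mod_cast (Finset.HasAntidiagonal.mem_antidiagonal.mp hab).symm
  rw [h, Finset.Nat.sum_antidiagonal_succ, Finset.Nat.sum_antidiagonal_succ',
    Finset.sum_add_distrib]
  simp

/-- The product `∑ λ ^ k C_k` on a module over an algebra with commuting derivations is a module
structure over the product `∑ λ ^ k c_k` on the algebra. -/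
theorem biCoeff_assoc
    (hμ : ∀ f g h, μM (μ f g) h = μM f (μM g h))
    (hPμ : ∀ j f g, P j (μ f g) = μ (P j f) g + μ f (P j g))
    (hQμ : ∀ j f g, QM j (μM f g) = μM (Q j f) g + μM f (QM j g))
    (hPP : ∀ i j f, P i (P j f) = P j (P i f)) (hPQ : ∀ i j f, P i (Q j f) = Q j (P i f))
    (hQQ : ∀ i j f, QM i (QM j f) = QM j (QM i f)) (N : ℕ) (f g : A) (h : M) :
    ∑ ab ∈ Finset.HasAntidiagonal.antidiagonal N, biCoeff P QM μM ab.1 (biCoeff P Q μ ab.2 f g) h =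
      ∑ ab ∈ Finset.HasAntidiagonal.antidiagonal N, biCoeff P QM μM ab.1 f (biCoeff P QM μM ab.2 g h) := by
  induction N generalizing f g h with
  | zero => simp [hμ]
  | succ N ih =>
    have hN : ((N : ℂ) + 1) ≠ 0 := by exact_mod_cast N.succ_ne_zero
    apply smul_right_injective M hN
    have hL : ∀ k j f g, P j (biCoeff P Q μ k f g) =
        biCoeff P Q μ k (P j f) g + biCoeff P Q μ k f (P j g) := fun k j f g =>
      biCoeff_derivation P Q μ (hPμ j) (hPP j) (hPQ j) k f g
    have hR : ∀ k j f g, QM j (biCoeff P QM μM k f g) =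
        biCoeff P QM μM k (Q j f) g + biCoeff P QM μM k f (QM j g) := fun k j f g =>
      biCoeff_derivation P QM μM (hQμ j) (fun i f => (hPQ i j f).symm) (hQQ j) k f g
    -- After multiplication by N + 1, both sides become the sum over j of the degree N expressions
    -- at (P_j f, Q_j g, h), (P_j f, g, Q_j h) and (f, P_j g, Q_j h). On the left, P_j is
    -- distributed over the inner product by `hL`; on the right, Q_j by `hR`.
    have h1 := sum_antidiagonal_smul_add (N := N)
      fun a b => biCoeff P QM μM a (biCoeff P Q μ b f g) h
    have h2 := sum_antidiagonal_smul_add (N := N)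
      fun a b => biCoeff P QM μM a f (biCoeff P QM μM b g h)
    simp only at h1 h2 ⊢
    rw [h1, h2]
    have h3 : ∀ a b : ℕ, ((b : ℂ) + 1) • biCoeff P QM μM a (biCoeff P Q μ (b + 1) f g) h =
        ∑ j, biCoeff P QM μM a (biCoeff P Q μ b (P j f) (Q j g)) h := fun a b => by
      rw [← LinearMap.smul_apply, ← map_smul, biCoeff_succ, map_sum, LinearMap.sum_apply]
    have h4 : ∀ a b : ℕ, ((b : ℂ) + 1) • biCoeff P QM μM a f (biCoeff P QM μM (b + 1) g h) =
        ∑ j, biCoeff P QM μM a f (biCoeff P QM μM b (P j g) (QM j h)) := fun a b => by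
      rw [← map_smul, biCoeff_succ, map_sum]
    simp only [biCoeff_succ, h3, h4, hL, hR, map_add, LinearMap.add_apply,
      ← Finset.sum_add_distrib]
    rw [Finset.sum_comm, Finset.sum_comm (s := Finset.HasAntidiagonal.antidiagonal N)]
    refine Finset.sum_congr rfl fun j _ => ?_
    simp only [Finset.sum_add_distrib, ih]
    abel

end Associativity


/-! ### The connection of a prequantum bundle -/

section Connection

variable {E : Type*} [NormedAddCommGroup E] [NormedSpace ℝ E]
  {X : Type*} [TopologicalSpace X] [ChartedSpace E X]
  {F : Type*} [NormedAddCommGroup F] [NormedSpace ℝ F]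
  {Y : Type*} [TopologicalSpace Y] [ChartedSpace F Y] [MulAction Circle Y]

theorem contMDiff_circle_coe : ContMDiff (𝓡 1) 𝓘(ℝ, ℂ) ∞ (fun u : Circle => (u : ℂ)) :=
  haveI : Fact (Module.finrank ℝ ℂ = 1 + 1) := finrank_real_complex_fact'
  contMDiff_coe_sphere (E := ℂ) (n := 1)

namespace IsCircleBundle

variable {proj : Y → X} (hB : IsCircleBundle E X F Y proj)
include hB

theorem contMDiff_exp_smul :
    ContMDiff (𝓘(ℝ, ℝ).prod 𝓘(ℝ, F)) 𝓘(ℝ, F) ∞ fun p : ℝ × Y => Circle.exp p.1 • p.2 :=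
  hB.smooth_smul.comp
    (ContMDiff.prodMk (contMDiff_circleExp.comp contMDiff_fst) contMDiff_snd)

theorem contMDiff_orbit (y : Y) :
    ContMDiff 𝓘(ℝ, ℝ) 𝓘(ℝ, F) ∞ fun t : ℝ => Circle.exp t • y :=
  hB.contMDiff_exp_smul.comp (contMDiff_id.prodMk contMDiff_const)

theorem hasMFDerivAt_orbit (y : Y) :
    HasMFDerivAt 𝓘(ℝ, ℝ) 𝓘(ℝ, F) (fun t : ℝ => Circle.exp t • y) 0
      (mfderiv 𝓘(ℝ, ℝ) 𝓘(ℝ, F) (fun t : ℝ => Circle.exp t • y) 0) :=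
  ((hB.contMDiff_orbit y).mdifferentiable (by simp) 0).hasMFDerivAt

/-- The derivative of a map along the generator of the action. -/
theorem mfderiv_generator {G : Type*} [NormedAddCommGroup G] [NormedSpace ℝ G] {N : Type*}
    [TopologicalSpace N] [ChartedSpace G N] {f : Y → N} (y : Y)
    (hf : MDifferentiableAt 𝓘(ℝ, F) 𝓘(ℝ, G) f y) :
    (mfderiv 𝓘(ℝ, F) 𝓘(ℝ, G) f y (generator F Y y) : G) =
      (mfderiv 𝓘(ℝ, ℝ) 𝓘(ℝ, G) (fun t : ℝ => f (Circle.exp t • y)) 0 (1 : ℝ) : G) := by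
  have h0 : Circle.exp 0 • y = y := by simp
  have hf' : MDifferentiableAt 𝓘(ℝ, F) 𝓘(ℝ, G) f (Circle.exp 0 • y) := by rwa [h0]
  have h := HasMFDerivAt.comp (0 : ℝ) hf'.hasMFDerivAt (hB.hasMFDerivAt_orbit y)
  have h1 := h.mfderiv
  have h2 : (mfderiv 𝓘(ℝ, ℝ) 𝓘(ℝ, G) (fun t : ℝ => f (Circle.exp t • y)) 0 (1 : ℝ) : G) =
    (mfderiv 𝓘(ℝ, F) 𝓘(ℝ, G) f (Circle.exp 0 • y) (generator F Y y : F) : G) := by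
    have := congrArg (fun L : ℝ →L[ℝ] G => L 1) h1
    exact this
  rw [h2]
  -- The base point exp 0 • y equals y only propositionally, and the tangent spaces depend on it;
  -- generalizing the point allows substitution.
  have h3 : ∀ y', y' = y → (mfderiv 𝓘(ℝ, F) 𝓘(ℝ, G) f y' (generator F Y y : F) : G) =
      (mfderiv 𝓘(ℝ, F) 𝓘(ℝ, G) f y (generator F Y y) : G) := by
    rintro _ rfl; rfl
  exact (h3 _ h0).symm

theorem mfderiv_proj_generator (y : Y) :
    mfderiv 𝓘(ℝ, F) 𝓘(ℝ, E) proj y (generator F Y y) = 0 := by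
  have h := hB.mfderiv_generator y (hB.smooth_proj.mdifferentiable (by simp) y)
  have h1 : (fun t : ℝ => proj (Circle.exp t • y)) = fun _ => proj y :=
    funext fun t => hB.proj_smul _ y
  rw [h1, mfderiv_const] at h
  exact h

/-- The curve t ↦ (t, y) turns the partial derivative into that of the orbit map. The base point is
a variable with an equation because it is later met in a form that is not syntactically (0, y). -/
theorem mfderiv_exp_smul_left (y : Y) (a : ℝ) (p : ℝ × Y) (hp : p = (0, y)) :
    (mfderiv (𝓘(ℝ, ℝ).prod 𝓘(ℝ, F)) 𝓘(ℝ, F) (fun p : ℝ × Y => Circle.exp p.1 • p.2) p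
      ((a, 0) : ℝ × F) : F) = a • (generator F Y y : F) := by
  subst hp
  have h1 : HasMFDerivAt 𝓘(ℝ, ℝ) (𝓘(ℝ, ℝ).prod 𝓘(ℝ, F)) (fun t : ℝ => (t, y)) 0
      ((ContinuousLinearMap.id ℝ ℝ).prod (0 : ℝ →L[ℝ] F)) :=
    (hasMFDerivAt_id 0).prodMk (hasMFDerivAt_const y 0)
  have h2 := HasMFDerivAt.comp (0 : ℝ) (hB.contMDiff_exp_smul.mdifferentiable (by simp)
    ((0 : ℝ), y)).hasMFDerivAt h1
  have h3 := congrArg (fun L : ℝ →L[ℝ] F => L a) h2.mfderiv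
  have h4 : (mfderiv 𝓘(ℝ, ℝ) 𝓘(ℝ, F) (fun t : ℝ => Circle.exp t • y) 0 : ℝ →L[ℝ] F) a =
      a • (generator F Y y : F) := by
    have : ∀ L : ℝ →L[ℝ] F, L a = a • L 1 := fun L => by rw [← map_smul]; simp
    exact this _
  rw [← h4]
  exact h3.symm

/-- Vertical vectors are multiples of the generator. -/
theorem exists_eq_smul_generator (y : Y) (v : TangentSpace 𝓘(ℝ, F) y)
    (hv : mfderiv 𝓘(ℝ, F) 𝓘(ℝ, E) proj y v = 0) : ∃ a : ℝ, v = a • generator F Y y := by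
  obtain ⟨U, s, τ, hU, hxU, hs, hτ, -, hsτ, -⟩ := hB.locally_trivial (proj y)
  have hUY : proj ⁻¹' U ∈ 𝓝 y := (hU.preimage hB.smooth_proj.continuous).mem_nhds hxU
  -- Dividing by τ y puts the argument at 1 for y' = y, inside the slit plane, so that arg is smooth
  -- there; rescaling the section accordingly makes `s'` pass through y.
  let θ : Y → ℝ := fun y' => Complex.arg ((τ y' * (τ y)⁻¹ : Circle) : ℂ)
  let s' : X → Y := fun x => τ y • s x
  have hid : (fun y' => Circle.exp (θ y') • s' (proj y')) =ᶠ[𝓝 y] id := by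
    filter_upwards [hUY] with y' hy'
    simp only [θ, s', Circle.exp_arg, smul_smul, inv_mul_cancel_right, id]
    exact hsτ y' hy'
  have hθy : θ y = 0 := by simp [θ]
  have hs'y : s' (proj y) = y := hsτ y hxU
  have hcoe := contMDiff_circle_coe
  have hθ : MDifferentiableAt 𝓘(ℝ, F) 𝓘(ℝ, ℝ) θ y := by
    have h1 : ContMDiffAt 𝓘(ℝ, F) 𝓘(ℝ, ℂ) ∞ (fun y' => ((τ y' * (τ y)⁻¹ : Circle) : ℂ)) y :=
      hcoe.contMDiffAt.comp y ((hτ.contMDiffAt hUY).mul contMDiffAt_const)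
    have h2 : ContDiffAt ℝ ∞ Complex.arg ((τ y * (τ y)⁻¹ : Circle) : ℂ) := by
      have h3 : ContDiffAt ℝ ∞ Complex.log ((τ y * (τ y)⁻¹ : Circle) : ℂ) :=
        (Complex.contDiffAt_log (by simp)).restrict_scalars ℝ
      have h4 : Complex.arg = fun z => Complex.imCLM (Complex.log z) := by
        ext z; simp [Complex.log_im]
      rw [h4]
      exact Complex.imCLM.contDiff.contDiffAt.comp _ h3
    exact (h2.contMDiffAt.comp y h1).mdifferentiableAt (by simp)
  have hs' : MDifferentiableAt 𝓘(ℝ, E) 𝓘(ℝ, F) s' (proj y) := by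
    have h1 : ContMDiffAt 𝓘(ℝ, E) 𝓘(ℝ, F) ∞ s (proj y) := hs.contMDiffAt (hU.mem_nhds hxU)
    have h2 : ContMDiffAt 𝓘(ℝ, E) 𝓘(ℝ, F) ∞ s' (proj y) :=
      hB.smooth_smul.contMDiffAt.comp (proj y) (contMDiffAt_const.prodMk h1)
    exact h2.mdifferentiableAt (by simp)
  have hs'p : HasMFDerivAt 𝓘(ℝ, F) 𝓘(ℝ, F) (fun y' => s' (proj y')) y _ :=
    HasMFDerivAt.comp (g := s') y hs'.hasMFDerivAt
      (hB.smooth_proj.mdifferentiable (by simp) y).hasMFDerivAt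
  have hpair := hθ.hasMFDerivAt.prodMk hs'p
  have hcomp := HasMFDerivAt.comp y (hB.contMDiff_exp_smul.mdifferentiable (by simp)
    (θ y, s' (proj y))).hasMFDerivAt hpair
  have h1 := (hcomp.congr_of_eventuallyEq hid.symm).mfderiv
  rw [mfderiv_id] at h1
  have h2 := congrArg (fun L : F →L[ℝ] F => L v) h1
  -- Differentiate y' = exp (θ y') • s' (proj y') along the vertical vector v: the component through
  -- proj vanishes and the remaining one is dθ(v) times the generator.
  let a : ℝ := mfderiv 𝓘(ℝ, F) 𝓘(ℝ, ℝ) θ y v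
  refine ⟨a, ?_⟩
  have h3 := hB.mfderiv_exp_smul_left y a (θ y, s' (proj y)) (by rw [hθy, hs'y])
  refine Eq.trans ?_ h3
  refine Eq.trans h2 ?_
  have h4 : (mfderiv 𝓘(ℝ, E) 𝓘(ℝ, F) s' (proj y)) (mfderiv 𝓘(ℝ, F) 𝓘(ℝ, E) proj y v) =
    (0 : F) := by rw [hv]; exact map_zero _
  have h5 : ((a, (mfderiv 𝓘(ℝ, E) 𝓘(ℝ, F) s' (proj y)) (mfderiv 𝓘(ℝ, F) 𝓘(ℝ, E) proj y v)) :
    ℝ × F) = (a, 0) := by rw [h4]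
  exact congrArg (fun w : ℝ × F => (mfderiv (𝓘(ℝ, ℝ).prod 𝓘(ℝ, F)) 𝓘(ℝ, F)
    (fun p : ℝ × Y => Circle.exp p.1 • p.2) (θ y, s' (proj y)) w : F)) h5

/-- The rescaled local section τ y • s passes through y and is a right inverse of proj near proj y;
its derivative supplies the preimage. -/
theorem mfderiv_proj_surjective (y : Y) :
    Function.Surjective (mfderiv 𝓘(ℝ, F) 𝓘(ℝ, E) proj y) := by
  intro w
  obtain ⟨U, s, τ, hU, hxU, hs, hτ, hps, hsτ, -⟩ := hB.locally_trivial (proj y)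
  let s' : X → Y := fun x => τ y • s x
  have hs'y : s' (proj y) = y := hsτ y hxU
  have hs' : MDifferentiableAt 𝓘(ℝ, E) 𝓘(ℝ, F) s' (proj y) := by
    have h1 : ContMDiffAt 𝓘(ℝ, E) 𝓘(ℝ, F) ∞ s (proj y) := hs.contMDiffAt (hU.mem_nhds hxU)
    have h2 : ContMDiffAt 𝓘(ℝ, E) 𝓘(ℝ, F) ∞ s' (proj y) :=
      hB.smooth_smul.contMDiffAt.comp (proj y) (contMDiffAt_const.prodMk h1)
    exact h2.mdifferentiableAt (by simp)
  have hid : (fun x => proj (s' x)) =ᶠ[𝓝 (proj y)] id := by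
    filter_upwards [hU.mem_nhds hxU] with x hx
    simp only [s', hB.proj_smul, hps x hx, id]
  have hcomp := HasMFDerivAt.comp (proj y)
    (hB.smooth_proj.mdifferentiable (by simp) (s' (proj y))).hasMFDerivAt hs'.hasMFDerivAt
  have h1 := (hcomp.congr_of_eventuallyEq hid.symm).mfderiv
  rw [mfderiv_id] at h1
  have h2 := congrArg (fun L : E →L[ℝ] E => L w) h1
  have h3 : ∀ y', y' = y → ∀ u : F, ∃ v : F,
      (mfderiv 𝓘(ℝ, F) 𝓘(ℝ, E) proj y v : E) = (mfderiv 𝓘(ℝ, F) 𝓘(ℝ, E) proj y' u : E) := by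
    rintro _ rfl u; exact ⟨u, rfl⟩
  obtain ⟨v, hv⟩ := h3 _ hs'y (mfderiv 𝓘(ℝ, E) 𝓘(ℝ, F) s' (proj y) w)
  exact ⟨v, hv.trans h2.symm⟩

end IsCircleBundle

namespace PrequantumBundle

variable {ħ : ℝ} {Ω : DForm E X 2} (B : PrequantumBundle F Y ħ Ω)

/-- The kernel of dproj is spanned by the generator, on which α equals 1, which gives injectivity.
For surjectivity, any lift of w is corrected by a multiple of the generator to obtain the prescribed
value of α. -/
theorem prod_bijective (y : Y) : Function.Bijective
    ((mfderiv 𝓘(ℝ, F) 𝓘(ℝ, E) B.proj y).prod (B.α y)) := by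
  constructor
  · rw [injective_iff_map_eq_zero]
    intro v hv
    obtain ⟨h1, h2⟩ := Prod.ext_iff.mp hv
    obtain ⟨a, rfl⟩ := B.isBundle.exists_eq_smul_generator y v h1
    have h3 : a * 1 = 0 := by
      rw [← B.α_generator y]
      simpa using h2
    rw [mul_one] at h3
    rw [h3, zero_smul]
  · rintro ⟨w, a⟩
    obtain ⟨v, hv⟩ := B.isBundle.mfderiv_proj_surjective y w
    refine ⟨v + (a - B.α y v) • generator F Y y, Prod.ext ?_ ?_⟩
    · have := B.isBundle.mfderiv_proj_generator y
      simp [hv, this]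
    · have := B.α_generator y
      simp [this]

variable [FiniteDimensional ℝ F]

/-- The isomorphism `(dproj, α) : T_y Y → T_x X × ℝ`. -/
theorem prod_inverse (y : Y) (v : TangentSpace 𝓘(ℝ, F) y) :
    ContinuousLinearMap.inverse ((mfderiv 𝓘(ℝ, F) 𝓘(ℝ, E) B.proj y).prod (B.α y))
      (mfderiv 𝓘(ℝ, F) 𝓘(ℝ, E) B.proj y v, B.α y v) = v := by
  let L : F →L[ℝ] E × ℝ := (mfderiv 𝓘(ℝ, F) 𝓘(ℝ, E) B.proj y).prod (B.α y)
  let e' : F ≃ₗ[ℝ] E × ℝ := LinearEquiv.ofBijective (L : F →ₗ[ℝ] E × ℝ) (B.prod_bijective y)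
  -- `ContinuousLinearMap.inverse` takes the default value 0 on maps that are not continuous linear
  -- equivalences; finite dimension promotes the linear bijection to one.
  have : FiniteDimensional ℝ (E × ℝ) := Module.Finite.equiv e'
  let e : F ≃L[ℝ] E × ℝ := e'.toContinuousLinearEquiv
  have he : L = (e : F →L[ℝ] E × ℝ) := by ext v <;> rfl
  have h1 : L.inverse (e v) = v := by
    rw [he, ContinuousLinearMap.inverse_equiv]; exact e.symm_apply_apply v
  exact h1

theorem eq_hlift_add (y : Y) (v : TangentSpace 𝓘(ℝ, F) y) :
    v = B.hlift y (mfderiv 𝓘(ℝ, F) 𝓘(ℝ, E) B.proj y v) + B.α y v • generator F Y y := by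
  have h1 := B.prod_inverse y (v - B.α y v • generator F Y y)
  have h2 : mfderiv 𝓘(ℝ, F) 𝓘(ℝ, E) B.proj y (v - B.α y v • generator F Y y) =
      mfderiv 𝓘(ℝ, F) 𝓘(ℝ, E) B.proj y v := by
    rw [map_sub, map_smul, B.isBundle.mfderiv_proj_generator y]; simp
  have h3 : B.α y (v - B.α y v • generator F Y y) = 0 := by
    simp [B.α_generator y]
  rw [h2, h3] at h1
  have h4 : B.hlift y (mfderiv 𝓘(ℝ, F) 𝓘(ℝ, E) B.proj y v) = v - B.α y v • generator F Y y := h1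
  rw [h4]; abel

theorem exists_hlift (y : Y) (w : TangentSpace 𝓘(ℝ, E) (B.proj y)) :
    mfderiv 𝓘(ℝ, F) 𝓘(ℝ, E) B.proj y (B.hlift y w) = w ∧ B.α y (B.hlift y w) = 0 := by
  obtain ⟨v, hv⟩ := (B.prod_bijective y).2 (w, 0)
  obtain ⟨h1, h2⟩ := Prod.ext_iff.mp hv
  have h1' : mfderiv 𝓘(ℝ, F) 𝓘(ℝ, E) B.proj y v = w := h1
  have h2' : B.α y v = 0 := h2
  have h3 : B.hlift y w = v := by
    have := B.prod_inverse y v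
    rw [h1', h2'] at this
    exact this
  rw [h3]
  exact ⟨h1', h2'⟩

theorem mfderiv_proj_hlift (y : Y) (w : TangentSpace 𝓘(ℝ, E) (B.proj y)) :
    mfderiv 𝓘(ℝ, F) 𝓘(ℝ, E) B.proj y (B.hlift y w) = w :=
  (B.exists_hlift y w).1

theorem α_hlift (y : Y) (w : TangentSpace 𝓘(ℝ, E) (B.proj y)) : B.α y (B.hlift y w) = 0 :=
  (B.exists_hlift y w).2

end PrequantumBundle

end Connection


/-! ### Coframes and their dual frames -/

section Chart

variable {G : Type*} [NormedAddCommGroup G] [NormedSpace ℝ G]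
  {M : Type*} [TopologicalSpace M] [ChartedSpace G M] [IsManifold 𝓘(ℝ, G) ∞ M]
  {G' : Type*} [NormedAddCommGroup G'] [NormedSpace ℝ G']

theorem contMDiffAt_chart_symm {y₀ : M} {z : G} (hz : z ∈ (extChartAt 𝓘(ℝ, G) y₀).target) :
    ContMDiffAt 𝓘(ℝ, G) 𝓘(ℝ, G) ∞ (extChartAt 𝓘(ℝ, G) y₀).symm z :=
  (contMDiffOn_extChartAt_symm y₀).contMDiffAt ((isOpen_extChartAt_target y₀).mem_nhds hz)

theorem contDiffAt_comp_chart_symm {f : M → G'} {y₀ : M} {z : G}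
    (hz : z ∈ (extChartAt 𝓘(ℝ, G) y₀).target)
    (hf : ContMDiffAt 𝓘(ℝ, G) 𝓘(ℝ, G') ∞ f ((extChartAt 𝓘(ℝ, G) y₀).symm z)) :
    ContDiffAt ℝ ∞ (f ∘ (extChartAt 𝓘(ℝ, G) y₀).symm) z :=
  (hf.comp z (contMDiffAt_chart_symm hz)).contDiffAt

omit [IsManifold 𝓘(ℝ, G) ∞ M] in
theorem contMDiffAt_of_contDiffAt_chart {f : M → G'} {y : M}
    (hf : ContDiffAt ℝ ∞ (f ∘ (extChartAt 𝓘(ℝ, G) y).symm) (extChartAt 𝓘(ℝ, G) y y)) :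
    ContMDiffAt 𝓘(ℝ, G) 𝓘(ℝ, G') ∞ f y := by
  have h1 : ContMDiffAt 𝓘(ℝ, G) 𝓘(ℝ, G') ∞
      ((f ∘ (extChartAt 𝓘(ℝ, G) y).symm) ∘ extChartAt 𝓘(ℝ, G) y) y :=
    hf.contMDiffAt.comp y contMDiffAt_extChartAt
  refine h1.congr_of_eventuallyEq ?_
  filter_upwards [extChartAt_source_mem_nhds (I := 𝓘(ℝ, G)) y] with y' hy'
  rw [Function.comp_apply, Function.comp_apply, (extChartAt 𝓘(ℝ, G) y).left_inv hy']

/-- The tangent space at y is identified with the model space by the preferred chart at y itself, so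
forms written in that chart have their original value at the base point. -/
theorem mfderiv_chart_symm_self (y : M) :
    (mfderiv 𝓘(ℝ, G) 𝓘(ℝ, G) (extChartAt 𝓘(ℝ, G) y).symm (extChartAt 𝓘(ℝ, G) y y) : G →L[ℝ] G) =
      ContinuousLinearMap.id ℝ G := by
  have : IsManifold 𝓘(ℝ, G) 1 M := IsManifold.of_le (n := ∞) (by simp)
  have h := mfderivWithin_range_extChartAt_symm (I := 𝓘(ℝ, G)) (x := y)
  rw [ModelWithCorners.range_eq_univ, mfderivWithin_univ] at h
  exact h

theorem mfderiv_chart_self (y : M) :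
    (mfderiv 𝓘(ℝ, G) 𝓘(ℝ, G) (extChartAt 𝓘(ℝ, G) y) y : G →L[ℝ] G) =
      ContinuousLinearMap.id ℝ G := by
  have : IsManifold 𝓘(ℝ, G) 1 M := IsManifold.of_le (n := ∞) (by simp)
  exact mfderiv_extChartAt_self (I := 𝓘(ℝ, G)) (x := y)

theorem fderiv_comp_chart_symm {f : M → G'} {y₀ : M} {z : G}
    (hz : z ∈ (extChartAt 𝓘(ℝ, G) y₀).target)
    (hf : MDifferentiableAt 𝓘(ℝ, G) 𝓘(ℝ, G') f ((extChartAt 𝓘(ℝ, G) y₀).symm z)) (v : G) :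
    fderiv ℝ (f ∘ (extChartAt 𝓘(ℝ, G) y₀).symm) z v =
      (mfderiv 𝓘(ℝ, G) 𝓘(ℝ, G') f ((extChartAt 𝓘(ℝ, G) y₀).symm z)
        (mfderiv 𝓘(ℝ, G) 𝓘(ℝ, G) (extChartAt 𝓘(ℝ, G) y₀).symm z v) : G') := by
  have h1 := HasMFDerivAt.comp z hf.hasMFDerivAt
    ((contMDiffAt_chart_symm hz).mdifferentiableAt (by simp)).hasMFDerivAt
  rw [← mfderiv_eq_fderiv, h1.mfderiv]
  rfl

omit [IsManifold 𝓘(ℝ, G) ∞ M] in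
theorem mfderiv_eq_fderiv_chart {f : M → G'} {y : M}
    (hf : MDifferentiableAt 𝓘(ℝ, G) 𝓘(ℝ, G') f y) :
    (mfderiv 𝓘(ℝ, G) 𝓘(ℝ, G') f y : G →L[ℝ] G') =
      fderiv ℝ (f ∘ (extChartAt 𝓘(ℝ, G) y).symm) (extChartAt 𝓘(ℝ, G) y y) := by
  refine hf.mfderiv.trans ?_
  rw [ModelWithCorners.range_eq_univ, fderivWithin_univ]
  rfl

end Chart

section Coframe

variable {G : Type*} [NormedAddCommGroup G] [NormedSpace ℝ G]
  {M : Type*} [TopologicalSpace M] [ChartedSpace G M]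

/-- A complex-valued 1-form in the chart around `y₀`, applied to a vector. -/
def chartForm (θ : ∀ y : M, TangentSpace 𝓘(ℝ, G) y →L[ℝ] ℂ) (y₀ : M) (v z : G) : ℂ :=
  θ ((extChartAt 𝓘(ℝ, G) y₀).symm z)
    (mfderiv 𝓘(ℝ, G) 𝓘(ℝ, G) (extChartAt 𝓘(ℝ, G) y₀).symm z v)

/-- A smooth complex coframe `θ` on the open set `V` with dual frame `e` and constant structure
coefficients: `dθ a = ∑ k a b c θ b ⊗ θ c`. -/
structure IsCoframe {ι : Type*} [Fintype ι] [DecidableEq ι] (V : Set M)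
    (θ : ι → ∀ y : M, TangentSpace 𝓘(ℝ, G) y →L[ℝ] ℂ) (e : ι → ∀ y : M, CTangent (E := G) y)
    (k : ι → ι → ι → ℂ) : Prop where
  isOpen : IsOpen V
  dual : ∀ y ∈ V, ∀ a b, LinearMap.liftBaseChange ℂ
    (θ a y : TangentSpace 𝓘(ℝ, G) y →ₗ[ℝ] ℂ) (e b y) = if a = b then 1 else 0
  span : ∀ y ∈ V, ∀ v : TangentSpace 𝓘(ℝ, G) y, (1 : ℂ) ⊗ₜ[ℝ] v = ∑ a, θ a y v • e a y
  smooth : ∀ a y₀ v, ContDiffOn ℝ ∞ (chartForm (θ a) y₀ v)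
    ((extChartAt 𝓘(ℝ, G) y₀).target ∩ (extChartAt 𝓘(ℝ, G) y₀).symm ⁻¹' V)
  deriv : ∀ y ∈ V, ∀ a, ∀ u v : G,
    fderiv ℝ (chartForm (θ a) y v) (extChartAt 𝓘(ℝ, G) y y) u -
      fderiv ℝ (chartForm (θ a) y u) (extChartAt 𝓘(ℝ, G) y y) v =
    ∑ b, ∑ c, k a b c * (θ b y u * θ c y v)

theorem contDiffAt_liftBaseChange {L : G → G →ₗ[ℝ] ℂ} {z : G}
    (hL : ∀ v, ContDiffAt ℝ ∞ (fun z => L z v) z) (w : ℂ ⊗[ℝ] G) :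
    ContDiffAt ℝ ∞ (fun z => LinearMap.liftBaseChange ℂ (L z) w) z := by
  induction w using TensorProduct.induction_on with
  | zero => simpa using contDiffAt_const
  | tmul a v => simpa using contDiffAt_const.mul (hL v)
  | add w₁ w₂ h₁ h₂ => simpa using h₁.add h₂

theorem contDiffAt_det {ι : Type*} [Fintype ι] [DecidableEq ι] {m : G → Matrix ι ι ℂ} {z : G}
    (hm : ∀ i j, ContDiffAt ℝ ∞ (fun z => m z i j) z) :
    ContDiffAt ℝ ∞ (fun z => (m z).det) z := by
  simp only [Matrix.det_apply]
  refine ContDiffAt.sum fun σ _ => ?_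
  exact (contDiffAt_prod fun i _ => hm _ _).const_smul _

/-- The solution of a smooth system of linear equations is smooth. -/
theorem contDiffAt_of_mulVec {ι : Type*} [Fintype ι] [DecidableEq ι] {m : G → Matrix ι ι ℂ}
    {g h : G → ι → ℂ} {z : G} (hm : ∀ i j, ContDiffAt ℝ ∞ (fun z => m z i j) z)
    (hh : ∀ i, ContDiffAt ℝ ∞ (fun z => h z i) z) (hdet : (m z).det ≠ 0)
    (heq : ∀ᶠ z in 𝓝 z, (m z).mulVec (g z) = h z) (i : ι) :
    ContDiffAt ℝ ∞ (fun z => g z i) z := by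
  have hd := contDiffAt_det hm
  -- Cramer's rule: the solution is a quotient of determinants of smooth matrices.
  have hc : ContDiffAt ℝ ∞ (fun z => (m z).cramer (h z) i) z := by
    simp only [Matrix.cramer_apply]
    refine contDiffAt_det fun j l => ?_
    simp only [Matrix.updateCol_apply]
    split_ifs
    exacts [hh j, hm j l]
  refine ((hd.inv hdet).mul hc).congr_of_eventuallyEq ?_
  filter_upwards [heq, hd.continuousAt.eventually_ne hdet] with z hz hz'
  rw [← hz, Matrix.cramer_eq_adjugate_mulVec, Matrix.mulVec_mulVec, Matrix.adjugate_mul,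
    Matrix.smul_mulVec, Matrix.one_mulVec]
  simp [hz']

namespace IsCoframe

variable {ι : Type*} [Fintype ι] [DecidableEq ι] {V : Set M}
  {θ : ι → ∀ y : M, TangentSpace 𝓘(ℝ, G) y →L[ℝ] ℂ} {e : ι → ∀ y : M, CTangent (E := G) y}
  {k : ι → ι → ι → ℂ} (h : IsCoframe V θ e k)
include h

theorem dR_eq (f : M → ℂ) {y : M} (hy : y ∈ V) (v : TangentSpace 𝓘(ℝ, G) y) :
    dR f y v = ∑ a, θ a y v * lieD (e a) f y := by
  have h1 := congrArg (dC f y) (h.span y hy v)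
  rw [dC_tmul, one_mul, map_sum] at h1
  simpa [lieD] using h1

/-- The relation extends complex-linearly from real to complexified tangent vectors, where
evaluation on `e b` isolates the coefficient `r b`. This lets coefficients be compared although the
dual frame is not real. -/
theorem eq_zero_of_sum {y : M} (hy : y ∈ V) {r : ι → ℂ}
    (hr : ∀ v : TangentSpace 𝓘(ℝ, G) y, ∑ a, r a * θ a y v = 0) (b : ι) : r b = 0 := by
  have h1 : ∀ w : CTangent (E := G) y, ∑ a, r a * LinearMap.liftBaseChange ℂ
      (θ a y : TangentSpace 𝓘(ℝ, G) y →ₗ[ℝ] ℂ) w = 0 := by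
    intro w
    induction w using TensorProduct.induction_on with
    | zero => simp
    | tmul c v =>
      have := congrArg (c * ·) (hr v)
      simp only [Finset.mul_sum, mul_zero] at this
      rw [← this]
      refine Finset.sum_congr rfl fun a _ => ?_
      simp
      ring
    | add w₁ w₂ h₁ h₂ => simp only [map_add, mul_add, Finset.sum_add_distrib, h₁, h₂, add_zero]
  simpa [h.dual y hy] using h1 (e b y)

variable [IsManifold 𝓘(ℝ, G) ∞ M]

theorem fderiv_chart (f : M → ℂ) (y₀ : M) {z : G}
    (hz : z ∈ (extChartAt 𝓘(ℝ, G) y₀).target) (hzV : (extChartAt 𝓘(ℝ, G) y₀).symm z ∈ V)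
    (hf : MDifferentiableAt 𝓘(ℝ, G) 𝓘(ℝ, ℂ) f ((extChartAt 𝓘(ℝ, G) y₀).symm z)) (v : G) :
    fderiv ℝ (f ∘ (extChartAt 𝓘(ℝ, G) y₀).symm) z v =
      ∑ a, chartForm (θ a) y₀ v z * lieD (e a) f ((extChartAt 𝓘(ℝ, G) y₀).symm z) := by
  rw [fderiv_comp_chart_symm hz hf]
  exact h.dR_eq f hzV _

omit [IsManifold 𝓘(ℝ, G) ∞ M] in
theorem contDiffAt_chartForm (a : ι) {y : M} (hy : y ∈ V) (v : G) :
    ContDiffAt ℝ ∞ (chartForm (θ a) y v) (extChartAt 𝓘(ℝ, G) y y) := by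
  refine (h.smooth a y v).contDiffAt (Filter.inter_mem (extChartAt_target_mem_nhds y) ?_)
  refine (continuousAt_extChartAt_symm y).preimage_mem_nhds ?_
  rw [extChartAt_to_inv]
  exact h.isOpen.mem_nhds hy

omit [Fintype ι] [DecidableEq ι] h in
theorem chartForm_self (a : ι) (y : M) (v : G) :
    chartForm (θ a) y v (extChartAt 𝓘(ℝ, G) y y) = θ a y v := by
  have h1 : ∀ y', y' = y → (θ a y' : G →L[ℝ] ℂ) = θ a y := by rintro _ rfl; rfl
  have h2 := congrArg (fun L : G →L[ℝ] G => L v) (mfderiv_chart_symm_self y)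
  have h3 := congrArg (fun L : G →L[ℝ] ℂ => L v) (h1 _ (extChartAt_to_inv (I := 𝓘(ℝ, G)) y))
  refine Eq.trans ?_ h3
  exact congrArg (fun w : G => (θ a ((extChartAt 𝓘(ℝ, G) y).symm (extChartAt 𝓘(ℝ, G) y y)) w)) h2

/-- The expansion df = ∑ e_a(f) θ_a is needed near the base point and not only at it, because it is
going to be differentiated. -/
theorem eventually_chart {f : M → ℂ} {y : M} (hy : y ∈ V)
    (hf : ContMDiffAt 𝓘(ℝ, G) 𝓘(ℝ, ℂ) ∞ f y) :
    ∀ᶠ z in 𝓝 (extChartAt 𝓘(ℝ, G) y y), ∀ v,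
      fderiv ℝ (f ∘ (extChartAt 𝓘(ℝ, G) y).symm) z v =
      ∑ a, chartForm (θ a) y v z * lieD (e a) f ((extChartAt 𝓘(ℝ, G) y).symm z) := by
  have h1 : ∀ᶠ y' in 𝓝 y, ContMDiffAt 𝓘(ℝ, G) 𝓘(ℝ, ℂ) 1 f y' :=
    contMDiffAt_iff_contMDiffAt_nhds (by simp) |>.mp (hf.of_le (by simp))
  have hc := continuousAt_extChartAt_symm (I := 𝓘(ℝ, G)) y
  rw [ContinuousAt, extChartAt_to_inv] at hc
  filter_upwards [extChartAt_target_mem_nhds y, hc.eventually h1,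
    hc.eventually (h.isOpen.mem_nhds hy)] with z hz hz1 hz2
  exact h.fderiv_chart f y hz hz2 (hz1.mdifferentiableAt (by simp))

/-- The derivatives of a smooth function along the dual frame are smooth. -/
theorem contMDiffAt_lieD {f : M → ℂ} {y : M} (hy : y ∈ V)
    (hf : ContMDiffAt 𝓘(ℝ, G) 𝓘(ℝ, ℂ) ∞ f y) (a : ι) :
    ContMDiffAt 𝓘(ℝ, G) 𝓘(ℝ, ℂ) ∞ (lieD (e a) f) y := by
  apply contMDiffAt_of_contDiffAt_chart
  set φ := extChartAt 𝓘(ℝ, G) y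
  have hyt : φ y ∈ φ.target := mem_extChartAt_target y
  let Θ' : ι → G → G →L[ℝ] ℂ := fun a z =>
    (θ a (φ.symm z) : G →L[ℝ] ℂ).comp (mfderiv 𝓘(ℝ, G) 𝓘(ℝ, G) φ.symm z : G →L[ℝ] G)
  let Θ : ι → G → G →ₗ[ℝ] ℂ := fun a z => (Θ' a z).toLinearMap
  have hΘ : ∀ a z v, Θ a z v = chartForm (θ a) y v z := fun _ _ _ => rfl
  -- No smoothness of the dual frame is assumed. Its vectors are frozen at y, and the functions
  -- e_a(f) are recovered as the solution of a linear system whose matrix θ_a(e_b(y)) varies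
  -- smoothly and is the identity at y.
  let e₀ : ι → ℂ ⊗[ℝ] G := fun b => e b y
  let m : G → Matrix ι ι ℂ := fun z => Matrix.of fun b a =>
    LinearMap.liftBaseChange ℂ (Θ a z) (e₀ b)
  let H : G → ι → ℂ := fun z b =>
    LinearMap.liftBaseChange ℂ (fderiv ℝ (f ∘ φ.symm) z : G →ₗ[ℝ] ℂ) (e₀ b)
  have hfc : ContDiffAt ℝ ∞ (f ∘ φ.symm) (φ y) :=
    contDiffAt_comp_chart_symm hyt (by rwa [extChartAt_to_inv])
  refine contDiffAt_of_mulVec (m := m) (h := H) (g := fun z a => lieD (e a) f (φ.symm z))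
    ?_ ?_ ?_ ?_ a
  · intro b a
    exact contDiffAt_liftBaseChange (fun v => h.contDiffAt_chartForm a hy v) _
  · intro b
    refine contDiffAt_liftBaseChange (fun v => ?_) _
    exact (hfc.fderiv_right (m := ∞) (by simp)).clm_apply contDiffAt_const
  · have : m (φ y) = 1 := by
      ext b a
      have h1 : Θ a (φ y) = (θ a y : TangentSpace 𝓘(ℝ, G) y →ₗ[ℝ] ℂ) :=
        LinearMap.ext fun v => chartForm_self a y v
      have h2 := h.dual y hy a b
      simp only [m, Matrix.of_apply, h1, Matrix.one_apply, e₀]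
      simpa only [eq_comm (a := b)] using! h2
    rw [this]; simp
  · filter_upwards [h.eventually_chart hy hf] with z hz
    ext b
    have key : ∀ w : ℂ ⊗[ℝ] G, ∑ a, LinearMap.liftBaseChange ℂ (Θ a z) w *
        lieD (e a) f (φ.symm z) =
        LinearMap.liftBaseChange ℂ (fderiv ℝ (f ∘ φ.symm) z : G →ₗ[ℝ] ℂ) w := by
      intro w
      induction w using TensorProduct.induction_on with
      | zero => simp
      | tmul c v =>
        simp only [LinearMap.liftBaseChange_tmul, smul_eq_mul, hΘ, mul_assoc, ← Finset.mul_sum]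
        congr 1
        exact (hz v).symm
      | add w₁ w₂ h₁ h₂ => simp only [map_add, add_mul, Finset.sum_add_distrib, h₁, h₂]
    exact key (e₀ b)

/-- The commutators of the dual frame. -/
theorem commutator {f : M → ℂ} {y : M} (hy : y ∈ V)
    (hf : ContMDiffAt 𝓘(ℝ, G) 𝓘(ℝ, ℂ) ∞ f y) (b c : ι) :
    lieD (e b) (lieD (e c) f) y = lieD (e c) (lieD (e b) f) y - ∑ a, k a b c * lieD (e a) f y := by
  have hyt : extChartAt 𝓘(ℝ, G) y y ∈ (extChartAt 𝓘(ℝ, G) y).target := mem_extChartAt_target y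
  have hfc : ContDiffAt ℝ ∞ (f ∘ (extChartAt 𝓘(ℝ, G) y).symm) (extChartAt 𝓘(ℝ, G) y y) :=
    contDiffAt_comp_chart_symm hyt (by rwa [extChartAt_to_inv])
  have hg : ∀ a, ContMDiffAt 𝓘(ℝ, G) 𝓘(ℝ, ℂ) ∞ (lieD (e a) f) y := h.contMDiffAt_lieD hy hf
  have hgc : ∀ a, ContDiffAt ℝ ∞ (lieD (e a) f ∘ (extChartAt 𝓘(ℝ, G) y).symm)
      (extChartAt 𝓘(ℝ, G) y y) := fun a =>
    contDiffAt_comp_chart_symm hyt (by rw [extChartAt_to_inv]; exact hg a)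
  have hsymm := hfc.isSymmSndFDerivAt (by
    simpa using (WithTop.coe_le_coe.mpr le_top : ((2 : ℕ∞) : WithTop ℕ∞) ≤ ∞))
  -- The second derivative of f in the chart, obtained by differentiating df = ∑ θ_a e_a(f) once
  -- more.
  have h1 : ∀ u v : G, fderiv ℝ (fderiv ℝ (f ∘ (extChartAt 𝓘(ℝ, G) y).symm))
      (extChartAt 𝓘(ℝ, G) y y) u v = ∑ a,
        (fderiv ℝ (chartForm (θ a) y v) (extChartAt 𝓘(ℝ, G) y y) u * lieD (e a) f y +
          θ a y v * dR (lieD (e a) f) y u) := by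
    intro u v
    have h2 : fderiv ℝ (fun z => fderiv ℝ (f ∘ (extChartAt 𝓘(ℝ, G) y).symm) z v)
        (extChartAt 𝓘(ℝ, G) y y) u = fderiv ℝ (fderiv ℝ (f ∘ (extChartAt 𝓘(ℝ, G) y).symm))
      (extChartAt 𝓘(ℝ, G) y y) u v := by
      have h3 : DifferentiableAt ℝ (fderiv ℝ (f ∘ (extChartAt 𝓘(ℝ, G) y).symm))
          (extChartAt 𝓘(ℝ, G) y y) :=
        (hfc.fderiv_right (m := 1) (WithTop.coe_le_coe.mpr le_top)).differentiableAt (by simp)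
      rw [fderiv_clm_apply h3 (differentiableAt_const v)]
      simp
    rw [← h2]
    have h4 : (fun z => fderiv ℝ (f ∘ (extChartAt 𝓘(ℝ, G) y).symm) z v) =ᶠ[𝓝 (extChartAt 𝓘(ℝ, G) y y)]
        fun z => ∑ a, chartForm (θ a) y v z *
          (lieD (e a) f ∘ (extChartAt 𝓘(ℝ, G) y).symm) z := by
      filter_upwards [h.eventually_chart hy hf] with z hz using hz v
    have h5 : ∀ a, HasFDerivAt (fun z => chartForm (θ a) y v z *
          (lieD (e a) f ∘ (extChartAt 𝓘(ℝ, G) y).symm) z) _ (extChartAt 𝓘(ℝ, G) y y) := fun a =>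
      HasFDerivAt.mul ((h.contDiffAt_chartForm a hy v).differentiableAt (by simp)).hasFDerivAt
        ((hgc a).differentiableAt (by simp)).hasFDerivAt
    have h6 := HasFDerivAt.fun_sum (u := Finset.univ) fun a _ => h5 a
    rw [h4.fderiv_eq, h6.fderiv]
    simp only [_root_.sum_apply, _root_.add_apply,
      _root_.smul_apply, Function.comp_apply, extChartAt_to_inv, smul_eq_mul,
      chartForm_self]
    refine Finset.sum_congr rfl fun a _ => ?_
    have h7 : (dR (lieD (e a) f) y : G →L[ℝ] ℂ) = _ :=
      mfderiv_eq_fderiv_chart ((hg a).mdifferentiableAt (by simp))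
    have h8 := congrArg (fun L : G →L[ℝ] ℂ => L u) h7
    rw [add_comm]
    congr 1
    · ring
    · exact congrArg (θ a y v * ·) h8.symm
  have h2 : ∀ u v : TangentSpace 𝓘(ℝ, G) y, ∑ b, (∑ c, (∑ a, k a b c * lieD (e a) f y +
      lieD (e b) (lieD (e c) f) y - lieD (e c) (lieD (e b) f) y) * θ c y v) * θ b y u = 0 := by
    intro u v
    -- By symmetry of the second derivative the antisymmetric part of this expansion vanishes; the
    -- derivatives of the θ_a enter it only through dθ_a, hence through the structure coefficients.
    have h3 := (h1 u v).symm.trans ((hsymm u v).trans (h1 v u))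
    rw [← sub_eq_zero, ← Finset.sum_sub_distrib] at h3
    have h4 : ∑ a, (fderiv ℝ (chartForm (θ a) y v) (extChartAt 𝓘(ℝ, G) y y) u -
        fderiv ℝ (chartForm (θ a) y u) (extChartAt 𝓘(ℝ, G) y y) v) * lieD (e a) f y +
        ∑ a, θ a y v * dR (lieD (e a) f) y u - ∑ a, θ a y u * dR (lieD (e a) f) y v = 0 := by
      rw [← Finset.sum_add_distrib, ← Finset.sum_sub_distrib, ← h3]
      refine Finset.sum_congr rfl fun a _ => ?_
      ring
    have h5 : ∑ a, (fderiv ℝ (chartForm (θ a) y v) (extChartAt 𝓘(ℝ, G) y y) u -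
        fderiv ℝ (chartForm (θ a) y u) (extChartAt 𝓘(ℝ, G) y y) v) * lieD (e a) f y =
        ∑ b, ∑ c, (∑ a, k a b c * lieD (e a) f y) * θ c y v * θ b y u := by
      trans ∑ a, (∑ b, ∑ c, k a b c * (θ b y u * θ c y v)) * lieD (e a) f y
      · exact Finset.sum_congr rfl fun a _ => congrArg (· * lieD (e a) f y) (h.deriv y hy a u v)
      · simp only [Finset.sum_mul]
        rw [Finset.sum_comm]
        refine Finset.sum_congr rfl fun b _ => ?_
        rw [Finset.sum_comm]
        exact Finset.sum_congr rfl fun c _ => Finset.sum_congr rfl fun a _ => by ring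
    have h6 : ∑ a, θ a y v * dR (lieD (e a) f) y u =
        ∑ b, ∑ c, lieD (e b) (lieD (e c) f) y * θ c y v * θ b y u := by
      simp only [h.dR_eq _ hy, Finset.mul_sum]
      rw [Finset.sum_comm]
      exact Finset.sum_congr rfl fun c _ => Finset.sum_congr rfl fun a _ => by ring
    have h7 : ∑ a, θ a y u * dR (lieD (e a) f) y v =
        ∑ b, ∑ c, lieD (e c) (lieD (e b) f) y * θ c y v * θ b y u := by
      simp only [h.dR_eq _ hy, Finset.mul_sum]
      exact Finset.sum_congr rfl fun c _ => Finset.sum_congr rfl fun a _ => by ring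
    rw [h5, h6, h7] at h4
    rw [← h4, ← Finset.sum_add_distrib, ← Finset.sum_sub_distrib]
    refine Finset.sum_congr rfl fun b _ => ?_
    rw [← Finset.sum_add_distrib, ← Finset.sum_sub_distrib, Finset.sum_mul]
    exact Finset.sum_congr rfl fun c _ => by ring
  -- Independence of the coframe, used once for each of the two tangent vectors, isolates the
  -- coefficient of θ_b ⊗ θ_c.
  have h3 := h.eq_zero_of_sum hy (fun v =>
    h.eq_zero_of_sum hy (fun u => h2 u v) b) c
  linear_combination h3

end IsCoframe

end Coframe


/-! ### The coframe of a Darboux chart on a prequantum bundle -/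

section Darboux

variable {E : Type*} [NormedAddCommGroup E] [NormedSpace ℝ E]
  {X : Type*} [TopologicalSpace X] [ChartedSpace E X] {n : ℕ} {Ω : DForm E X 2}
  {J K : ∀ x : X, Submodule ℂ (CTangent (E := E) x)}

theorem exists_eq_one_tmul_add_I_tmul {V : Type*} [AddCommGroup V] [Module ℝ V] (w : ℂ ⊗[ℝ] V) :
    ∃ a b : V, w = (1 : ℂ) ⊗ₜ[ℝ] a + Complex.I ⊗ₜ[ℝ] b := by
  induction w using TensorProduct.induction_on with
  | zero => exact ⟨0, 0, by simp⟩
  | tmul z v =>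
    refine ⟨z.re • v, z.im • v, ?_⟩
    rw [← TensorProduct.smul_tmul, ← TensorProduct.smul_tmul, ← TensorProduct.add_tmul]
    congr 1
    simpa [mul_comm] using (Complex.re_add_im z).symm
  | add w₁ w₂ h₁ h₂ =>
    obtain ⟨a₁, b₁, rfl⟩ := h₁
    obtain ⟨a₂, b₂, rfl⟩ := h₂
    exact ⟨a₁ + a₂, b₁ + b₂, by simp only [TensorProduct.tmul_add]; abel⟩

namespace DarbouxChart

variable (c : DarbouxChart n Ω J K)

theorem dC_one_tmul_add (f : X → ℂ) (x : X) (a b : TangentSpace 𝓘(ℝ, E) x) :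
    dC f x ((1 : ℂ) ⊗ₜ[ℝ] a + Complex.I ⊗ₜ[ℝ] b) = dR f x a + Complex.I * dR f x b := by
  rw [map_add, dC_tmul, dC_tmul, one_mul]

/-- Write w = a + ib with a, b real. As the coordinates may be complex, a and b are not annihilated
separately; but the Darboux formula yields Ω(a, u) + iΩ(b, u) = 0 for every real u, and real and
imaginary parts vanish by nondegeneracy. -/
theorem eq_zero_of_dC (hΩ : IsSymplectic Ω) {x : X} (hx : x ∈ c.U) {w : CTangent (E := E) x}
    (hp : ∀ j, dC (c.p j) x w = 0) (hq : ∀ j, dC (c.q j) x w = 0) : w = 0 := by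
  obtain ⟨a, b, rfl⟩ := exists_eq_one_tmul_add_I_tmul w
  have key : ∀ u, Ω x ![a, u] = 0 ∧ Ω x ![b, u] = 0 := by
    intro u
    have h1 : ((Ω x ![a, u] : ℝ) : ℂ) + Complex.I * ((Ω x ![b, u] : ℝ) : ℂ) = 0 := by
      rw [c.darboux x hx, c.darboux x hx, Finset.mul_sum, ← Finset.sum_add_distrib]
      refine Finset.sum_eq_zero fun j _ => ?_
      have h1 := hp j
      have h2 := hq j
      rw [dC_one_tmul_add] at h1 h2
      linear_combination dR (c.q j) x u * h1 - dR (c.p j) x u * h2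
    have h2 := congrArg Complex.re h1
    have h3 := congrArg Complex.im h1
    simp at h2 h3
    exact ⟨h2, h3⟩
  rw [hΩ.nondegenerate x a fun u => (key u).1, hΩ.nondegenerate x b fun u => (key u).2]
  simp

/-- The difference of the two sides is annihilated by all dp_i and dq^i, so nondegeneracy replaces a
dimension count. -/
theorem one_tmul_eq (hΩ : IsSymplectic Ω) {x : X} (hx : x ∈ c.U) (v : TangentSpace 𝓘(ℝ, E) x) :
    (1 : ℂ) ⊗ₜ[ℝ] v = ∑ j, dR (c.p j) x v • c.P j x + ∑ j, dR (c.q j) x v • c.Q j x := by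
  rw [← sub_eq_zero]
  refine c.eq_zero_of_dC hΩ hx (fun i => ?_) fun i => ?_
  · simp [map_sub, dC_tmul, c.dp_P x hx, c.dp_Q x hx]
  · simp [map_sub, dC_tmul, c.dq_P x hx, c.dq_Q x hx]

end DarbouxChart

end Darboux

section Coframe

variable {E : Type*} [NormedAddCommGroup E] [NormedSpace ℝ E]
  {X : Type*} [TopologicalSpace X] [ChartedSpace E X]
  {F : Type*} [NormedAddCommGroup F] [NormedSpace ℝ F]
  {Y : Type*} [TopologicalSpace Y] [ChartedSpace F Y] [MulAction Circle Y]
  {n : ℕ} {ħ : ℝ} {Ω : DForm E X 2} {J K : ∀ x : X, Submodule ℂ (CTangent (E := E) x)}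
  (B : PrequantumBundle F Y ħ Ω) (c : DarbouxChart n Ω J K)

/-- The coframe `(α, dp_j, dq^j)` on `Y`. -/
def coframe : Option (Fin n ⊕ Fin n) → ∀ y : Y, TangentSpace 𝓘(ℝ, F) y →L[ℝ] ℂ
  | none => fun y => Complex.ofRealCLM.comp (B.α y)
  | some (.inl j) => fun y => (dR (c.p j) (B.proj y)).comp (mfderiv 𝓘(ℝ, F) 𝓘(ℝ, E) B.proj y)
  | some (.inr j) => fun y => (dR (c.q j) (B.proj y)).comp (mfderiv 𝓘(ℝ, F) 𝓘(ℝ, E) B.proj y)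

/-- The complexified generator of the circle action. -/
def genC (y : Y) : CTangent (E := F) y := (1 : ℂ) ⊗ₜ[ℝ] generator F Y y

/-- The frame `(η, ∂_{p_j}^#, ∂_{q^j}^#)` on `Y`. -/
def frame : Option (Fin n ⊕ Fin n) → ∀ y : Y, CTangent (E := F) y
  | none => genC
  | some (.inl j) => B.lift (c.P j)
  | some (.inr j) => B.lift (c.Q j)

variable (n ħ) in
/-- The structure coefficients `dα = (1 / ħ) ∑ dp_j ∧ dq^j`. -/
def structureCoeff : Option (Fin n ⊕ Fin n) → Option (Fin n ⊕ Fin n) → Option (Fin n ⊕ Fin n) → ℂ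
  | none, some (.inl i), some (.inr j) => if i = j then (ħ : ℂ)⁻¹ else 0
  | none, some (.inr i), some (.inl j) => if i = j then -(ħ : ℂ)⁻¹ else 0
  | _, _, _ => 0

variable [FiniteDimensional ℝ F]

theorem liftBaseChange_hliftC {x' : ℂ} (f : X → ℂ) (y : Y) (w : CTangent (E := E) (B.proj y))
    (hw : dC f (B.proj y) w = x') :
    LinearMap.liftBaseChange ℂ (((dR f (B.proj y)).comp (mfderiv 𝓘(ℝ, F) 𝓘(ℝ, E) B.proj y) :
      TangentSpace 𝓘(ℝ, F) y →L[ℝ] ℂ) : TangentSpace 𝓘(ℝ, F) y →ₗ[ℝ] ℂ) (B.hliftC y w) = x' := by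
  subst hw
  induction w using TensorProduct.induction_on with
  | zero => simp
  | tmul a v =>
    rw [dC_tmul, PrequantumBundle.hliftC, LinearMap.baseChange_tmul,
      LinearMap.liftBaseChange_tmul]
    have := B.mfderiv_proj_hlift y v
    simp [this]
  | add w₁ w₂ h₁ h₂ => simp only [map_add, h₁, h₂]

theorem liftBaseChange_α_hliftC (y : Y) (w : CTangent (E := E) (B.proj y)) :
    LinearMap.liftBaseChange ℂ ((Complex.ofRealCLM.comp (B.α y) :
      TangentSpace 𝓘(ℝ, F) y →L[ℝ] ℂ) : TangentSpace 𝓘(ℝ, F) y →ₗ[ℝ] ℂ) (B.hliftC y w) = 0 := by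
  induction w using TensorProduct.induction_on with
  | zero => simp
  | tmul a v =>
    rw [PrequantumBundle.hliftC, LinearMap.baseChange_tmul,
      LinearMap.liftBaseChange_tmul]
    have := B.α_hlift y v
    simp [this]
  | add w₁ w₂ h₁ h₂ => simp only [map_add, h₁, h₂, add_zero]

theorem coframe_dual {y : Y} (hy : B.proj y ∈ c.U) (a b : Option (Fin n ⊕ Fin n)) :
    LinearMap.liftBaseChange ℂ (coframe B c a y : TangentSpace 𝓘(ℝ, F) y →ₗ[ℝ] ℂ)
      (frame B c b y) = if a = b then 1 else 0 := by
  have hα := B.α_generator y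
  have hp := B.isBundle.mfderiv_proj_generator y
  rcases a with _ | a | a <;> rcases b with _ | b | b
  · simp [coframe, frame, genC, hα]
  · simpa [coframe, frame, PrequantumBundle.lift] using liftBaseChange_α_hliftC B y _
  · simpa [coframe, frame, PrequantumBundle.lift] using liftBaseChange_α_hliftC B y _
  · simp [coframe, frame, genC, hp]
  · simpa [coframe, frame, PrequantumBundle.lift] using liftBaseChange_hliftC B (c.p a) y _ (c.dp_P _ hy a b)
  · simpa [coframe, frame, PrequantumBundle.lift] using liftBaseChange_hliftC B (c.p a) y _ (c.dp_Q _ hy a b)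
  · simp [coframe, frame, genC, hp]
  · simpa [coframe, frame, PrequantumBundle.lift] using liftBaseChange_hliftC B (c.q a) y _ (c.dq_P _ hy a b)
  · simpa [coframe, frame, PrequantumBundle.lift] using liftBaseChange_hliftC B (c.q a) y _ (c.dq_Q _ hy a b)

theorem coframe_span (hΩ : IsSymplectic Ω) {y : Y} (hy : B.proj y ∈ c.U)
    (v : TangentSpace 𝓘(ℝ, F) y) :
    (1 : ℂ) ⊗ₜ[ℝ] v = ∑ a, coframe B c a y v • frame B c a y := by
  have h1 := congrArg (B.hliftC y) (c.one_tmul_eq hΩ hy (mfderiv 𝓘(ℝ, F) 𝓘(ℝ, E) B.proj y v))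
  rw [PrequantumBundle.hliftC, LinearMap.baseChange_tmul] at h1
  have h2 : ((1 : ℂ) ⊗ₜ[ℝ] (B.α y v • generator F Y y) : CTangent (E := F) y) =
      (B.α y v : ℂ) • genC y := by
    rw [← TensorProduct.smul_tmul, genC, TensorProduct.smul_tmul']
    simp
  conv_lhs => rw [B.eq_hlift_add y v]
  rw [TensorProduct.tmul_add, h2, Fintype.sum_option, Fintype.sum_sum_type, add_comm]
  refine congrArg₂ (· + ·) rfl (h1.trans ?_)
  rw [map_add, map_sum, map_sum]
  simp only [map_smul]
  rfl

variable [IsManifold 𝓘(ℝ, F) ∞ Y]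

omit [FiniteDimensional ℝ F] in
/-- The function form of `d(f ∘ proj)` in a chart. -/
theorem chartForm_comp_proj {f : X → ℂ} {U : Set X} (hU : IsOpen U)
    (hf : ContMDiffOn 𝓘(ℝ, E) 𝓘(ℝ, ℂ) ∞ f U) (y₀ : Y) (v : F) {z : F}
    (hz : z ∈ (extChartAt 𝓘(ℝ, F) y₀).target)
    (hzU : B.proj ((extChartAt 𝓘(ℝ, F) y₀).symm z) ∈ U) :
    chartForm (fun y => (dR f (B.proj y)).comp (mfderiv 𝓘(ℝ, F) 𝓘(ℝ, E) B.proj y)) y₀ v z =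
      fderiv ℝ ((f ∘ B.proj) ∘ (extChartAt 𝓘(ℝ, F) y₀).symm) z v := by
  have h1 : MDifferentiableAt 𝓘(ℝ, E) 𝓘(ℝ, ℂ) f (B.proj ((extChartAt 𝓘(ℝ, F) y₀).symm z)) :=
    (hf.contMDiffAt (hU.mem_nhds hzU)).mdifferentiableAt (by simp)
  have h2 := HasMFDerivAt.comp _ h1.hasMFDerivAt
    (B.isBundle.smooth_proj.mdifferentiable (by simp) _).hasMFDerivAt
  rw [fderiv_comp_chart_symm hz h2.mdifferentiableAt, h2.mfderiv]
  rfl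

omit [FiniteDimensional ℝ F] [IsManifold 𝓘(ℝ, F) ∞ Y] in
theorem contMDiffOn_comp_proj {f : X → ℂ} {U : Set X}
    (hf : ContMDiffOn 𝓘(ℝ, E) 𝓘(ℝ, ℂ) ∞ f U) :
    ContMDiffOn 𝓘(ℝ, F) 𝓘(ℝ, ℂ) ∞ (f ∘ B.proj) (B.proj ⁻¹' U) :=
  hf.comp B.isBundle.smooth_proj.contMDiffOn (fun _ h => h)

omit [FiniteDimensional ℝ F] in
theorem chartForm_comp_proj_smooth {f : X → ℂ} {U : Set X} (hU : IsOpen U)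
    (hf : ContMDiffOn 𝓘(ℝ, E) 𝓘(ℝ, ℂ) ∞ f U) (y₀ : Y) (v : F) :
    ContDiffOn ℝ ∞
      (chartForm (fun y => (dR f (B.proj y)).comp (mfderiv 𝓘(ℝ, F) 𝓘(ℝ, E) B.proj y)) y₀ v)
      ((extChartAt 𝓘(ℝ, F) y₀).target ∩ (extChartAt 𝓘(ℝ, F) y₀).symm ⁻¹' (B.proj ⁻¹' U)) := by
  refine ContDiffOn.congr (fun z hz => ContDiffAt.contDiffWithinAt ?_)
    fun z hz => chartForm_comp_proj B hU hf y₀ v hz.1 hz.2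
  have h1 := contDiffAt_comp_chart_symm hz.1 ((contMDiffOn_comp_proj B hf).contMDiffAt
    ((hU.preimage B.isBundle.smooth_proj.continuous).mem_nhds hz.2))
  exact (h1.fderiv_right (m := ∞) (by simp)).clm_apply contDiffAt_const

-- This is d(d(f ∘ proj)) = 0, by symmetry of the second derivative in the chart.
omit [FiniteDimensional ℝ F] in
theorem chartForm_comp_proj_closed {f : X → ℂ} {U : Set X} (hU : IsOpen U)
    (hf : ContMDiffOn 𝓘(ℝ, E) 𝓘(ℝ, ℂ) ∞ f U) {y : Y} (hy : B.proj y ∈ U) (u v : F) :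
    fderiv ℝ (chartForm (fun y => (dR f (B.proj y)).comp
        (mfderiv 𝓘(ℝ, F) 𝓘(ℝ, E) B.proj y)) y v) (extChartAt 𝓘(ℝ, F) y y) u -
      fderiv ℝ (chartForm (fun y => (dR f (B.proj y)).comp
        (mfderiv 𝓘(ℝ, F) 𝓘(ℝ, E) B.proj y)) y u) (extChartAt 𝓘(ℝ, F) y y) v = 0 := by
  have hyU : B.proj ⁻¹' U ∈ 𝓝 y := (hU.preimage B.isBundle.smooth_proj.continuous).mem_nhds hy
  have h1 := contDiffAt_comp_chart_symm (mem_extChartAt_target (I := 𝓘(ℝ, F)) y)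
    ((extChartAt_to_inv (I := 𝓘(ℝ, F)) y).symm ▸ (contMDiffOn_comp_proj B hf).contMDiffAt hyU)
  have hev : ∀ v, chartForm (fun y => (dR f (B.proj y)).comp
        (mfderiv 𝓘(ℝ, F) 𝓘(ℝ, E) B.proj y)) y v =ᶠ[𝓝 (extChartAt 𝓘(ℝ, F) y y)]
        fun z => fderiv ℝ ((f ∘ B.proj) ∘ (extChartAt 𝓘(ℝ, F) y).symm) z v := by
    intro v
    have hc := continuousAt_extChartAt_symm (I := 𝓘(ℝ, F)) y
    rw [ContinuousAt, extChartAt_to_inv] at hc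
    filter_upwards [extChartAt_target_mem_nhds y, hc.eventually hyU] with z hz hzU
    exact chartForm_comp_proj B hU hf y v hz hzU
  have hd : ∀ u v, fderiv ℝ (fun z => fderiv ℝ ((f ∘ B.proj) ∘ (extChartAt 𝓘(ℝ, F) y).symm) z v)
        (extChartAt 𝓘(ℝ, F) y y) u =
      fderiv ℝ (fderiv ℝ ((f ∘ B.proj) ∘ (extChartAt 𝓘(ℝ, F) y).symm))
        (extChartAt 𝓘(ℝ, F) y y) u v := by
    intro u v
    have h3 : DifferentiableAt ℝ (fderiv ℝ ((f ∘ B.proj) ∘ (extChartAt 𝓘(ℝ, F) y).symm))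
        (extChartAt 𝓘(ℝ, F) y y) :=
      (h1.fderiv_right (m := 1) (WithTop.coe_le_coe.mpr le_top)).differentiableAt (by simp)
    rw [fderiv_clm_apply h3 (differentiableAt_const v)]
    simp
  have hsymm := h1.isSymmSndFDerivAt (by
    simpa using (WithTop.coe_le_coe.mpr le_top : ((2 : ℕ∞) : WithTop ℕ∞) ≤ ∞))
  rw [(hev v).fderiv_eq, (hev u).fderiv_eq, hd, hd, hsymm u v, sub_self]

/-- The connection form as a differential form. -/
def connForm : DForm F Y 1 := fun y => .ofSubsingleton ℝ _ ℝ (0 : Fin 1) (B.α y)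

omit [FiniteDimensional ℝ F] [IsManifold 𝓘(ℝ, F) ∞ Y] in
theorem chartForm_connForm (y₀ : Y) (v : F) :
    chartForm (fun y => Complex.ofRealCLM.comp (B.α y)) y₀ v =
      fun z => Complex.ofRealCLM ((connForm B).inChart y₀ z ![v]) := by
  ext z
  rfl

omit [FiniteDimensional ℝ F] [IsManifold 𝓘(ℝ, F) ∞ Y] in
theorem chartForm_connForm_smooth (y₀ : Y) (v : F) :
    ContDiffOn ℝ ∞ (chartForm (fun y => Complex.ofRealCLM.comp (B.α y)) y₀ v)
      (extChartAt 𝓘(ℝ, F) y₀).target := by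
  rw [chartForm_connForm]
  have h1 : ContDiffOn ℝ ∞ ((connForm B).inChart y₀) (extChartAt 𝓘(ℝ, F) y₀).target :=
    B.smooth_α y₀
  have h2 := (ContinuousAlternatingMap.apply ℝ F ℝ ![v]).contDiff.comp_contDiffOn h1
  exact Complex.ofRealCLM.contDiff.comp_contDiffOn h2

-- The prequantum condition dα = Ω/ħ combined with the Darboux formula. It is the only source of
-- nonzero structure coefficients.
omit [FiniteDimensional ℝ F] in
theorem chartForm_connForm_deriv {y : Y} (hy : B.proj y ∈ c.U) (u v : F) :
    fderiv ℝ (chartForm (fun y => Complex.ofRealCLM.comp (B.α y)) y v)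
        (extChartAt 𝓘(ℝ, F) y y) u -
      fderiv ℝ (chartForm (fun y => Complex.ofRealCLM.comp (B.α y)) y u)
        (extChartAt 𝓘(ℝ, F) y y) v =
    (ħ : ℂ)⁻¹ * ∑ j, (coframe B c (some (.inl j)) y u * coframe B c (some (.inr j)) y v -
      coframe B c (some (.inl j)) y v * coframe B c (some (.inr j)) y u) := by
  have h1 : ContDiffAt ℝ ∞ ((connForm B).inChart y) (extChartAt 𝓘(ℝ, F) y y) :=
    (B.smooth_α y).contDiffAt (extChartAt_target_mem_nhds y)
  have hA : DifferentiableAt ℝ ((connForm B).inChart y) (extChartAt 𝓘(ℝ, F) y y) :=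
    h1.differentiableAt (by simp)
  have h2 : ∀ v, DifferentiableAt ℝ (fun z => (connForm B).inChart y z ![v])
      (extChartAt 𝓘(ℝ, F) y y) := fun v =>
    (ContinuousAlternatingMap.apply ℝ F ℝ ![v]).differentiableAt.comp _ hA
  have h3 : ∀ u v, fderiv ℝ (chartForm (fun y => Complex.ofRealCLM.comp (B.α y)) y v)
        (extChartAt 𝓘(ℝ, F) y y) u =
      ((fderiv ℝ (fun z => (connForm B).inChart y z ![v]) (extChartAt 𝓘(ℝ, F) y y) u : ℝ) : ℂ) := by
    intro u v
    rw [chartForm_connForm]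
    have := (Complex.ofRealCLM.hasFDerivAt.comp _ (h2 v).hasFDerivAt).fderiv
    exact congrArg (fun L : F →L[ℝ] ℂ => L u) this
  have h4 := congrArg (fun L : F [⋀^Fin 2]→L[ℝ] ℝ => L ![u, v]) (B.curvature y)
  have h5 : (DForm.d (connForm B) y : F [⋀^Fin 2]→L[ℝ] ℝ) ![u, v] =
      extDeriv ((connForm B).inChart y) (extChartAt 𝓘(ℝ, F) y y) ![u, v] := by
    have h6 := mfderiv_chart_self (G := F) y
    have h7 : ∀ L : F →L[ℝ] F, L = ContinuousLinearMap.id ℝ F →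
      ((extDeriv ((connForm B).inChart y) (extChartAt 𝓘(ℝ, F) y y)).compContinuousLinearMap L)
        ![u, v] = extDeriv ((connForm B).inChart y) (extChartAt 𝓘(ℝ, F) y y) ![u, v] := by
      rintro _ rfl; rfl
    exact h7 _ h6
  rw [extDeriv_apply hA] at h5
  have hr0 : (0 : Fin 2).removeNth ![u, v] = ![v] := by
    ext j; fin_cases j; rfl
  have hr1 : (1 : Fin 2).removeNth ![u, v] = ![u] := by
    ext j; fin_cases j; rfl
  have h6 : (DForm.d (connForm B) y : F [⋀^Fin 2]→L[ℝ] ℝ) ![u, v] =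
      fderiv ℝ (fun z => (connForm B).inChart y z ![v]) (extChartAt 𝓘(ℝ, F) y y) u -
      fderiv ℝ (fun z => (connForm B).inChart y z ![u]) (extChartAt 𝓘(ℝ, F) y y) v := by
    refine h5.trans ((Fin.sum_univ_two _).trans ?_)
    rw [hr0, hr1]
    simp [sub_eq_add_neg]
  rw [h3, h3, ← Complex.ofReal_sub, ← h6]
  have h8 := c.darboux _ hy (mfderiv 𝓘(ℝ, F) 𝓘(ℝ, E) B.proj y u)
    (mfderiv 𝓘(ℝ, F) 𝓘(ℝ, E) B.proj y v)
  refine (congrArg (fun r : ℝ => (r : ℂ)) h4).trans ?_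
  have h9 : ((ħ⁻¹ • (Ω (B.proj y)).compContinuousLinearMap
      (mfderiv 𝓘(ℝ, F) 𝓘(ℝ, E) B.proj y) : F [⋀^Fin 2]→L[ℝ] ℝ)) ![u, v] =
      ħ⁻¹ * Ω (B.proj y) ![mfderiv 𝓘(ℝ, F) 𝓘(ℝ, E) B.proj y u,
        mfderiv 𝓘(ℝ, F) 𝓘(ℝ, E) B.proj y v] := by
    have : (⇑(mfderiv 𝓘(ℝ, F) 𝓘(ℝ, E) B.proj y) ∘ ![u, v]) =
      ![mfderiv 𝓘(ℝ, F) 𝓘(ℝ, E) B.proj y u, mfderiv 𝓘(ℝ, F) 𝓘(ℝ, E) B.proj y v] := by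
      ext j; fin_cases j <;> rfl
    rw [← this]
    rfl
  refine (congrArg (fun r : ℝ => (r : ℂ)) h9).trans ?_
  rw [Complex.ofReal_mul, h8, Complex.ofReal_inv]
  rfl

/-- `(α, dp_j, dq^j)` is a coframe, with dual frame `(η, ∂_{p_j}^#, ∂_{q^j}^#)`. -/
theorem isCoframe (hΩ : IsSymplectic Ω) :
    IsCoframe (B.proj ⁻¹' c.U) (coframe B c) (frame B c) (structureCoeff n ħ) where
  isOpen := c.isOpen.preimage B.isBundle.smooth_proj.continuous
  dual := fun y hy => coframe_dual B c hy
  span := fun y hy => coframe_span B c hΩ hy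
  smooth := by
    rintro (_ | a | a) y₀ v
    · exact (chartForm_connForm_smooth B y₀ v).mono Set.inter_subset_left
    · exact chartForm_comp_proj_smooth B c.isOpen (c.smooth_p a) y₀ v
    · exact chartForm_comp_proj_smooth B c.isOpen (c.smooth_q a) y₀ v
  deriv := by
    rintro y hy (_ | a | a) u v
    · refine (chartForm_connForm_deriv B c hy u v).trans ?_
      simp only [Fintype.sum_option, Fintype.sum_sum_type, structureCoeff]
      simp only [Finset.sum_sub_distrib, zero_mul, Finset.sum_const_zero, add_zero,
        zero_add, ite_mul, Finset.sum_ite_eq, Finset.mem_univ, if_true, ← Finset.mul_sum]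
      simp only [neg_mul]
      simp only [mul_comm (coframe B c (some (Sum.inr _)) y u)]
      ring
    · refine (chartForm_comp_proj_closed B c.isOpen (c.smooth_p a) hy u v).trans ?_
      simp [structureCoeff]
    · refine (chartForm_comp_proj_closed B c.isOpen (c.smooth_q a) hy u v).trans ?_
      simp [structureCoeff]

end Coframe


/-! ### Differential operators on spaces of smooth functions -/

section SmoothOn

variable (G : Type*) [NormedAddCommGroup G] [NormedSpace ℝ G]
  {M : Type*} [TopologicalSpace M] [ChartedSpace G M]

/-- The functions which are smooth on `V` and vanish outside `V`. -/
def smoothOn (V : Set M) : Submodule ℂ (M → ℂ) where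
  carrier := {f | ContMDiffOn 𝓘(ℝ, G) 𝓘(ℝ, ℂ) ∞ f V ∧ ∀ y ∉ V, f y = 0}
  zero_mem' := ⟨contMDiffOn_const, fun _ _ => rfl⟩
  add_mem' := fun hf hg => ⟨hf.1.add hg.1, fun y hy => by simp [hf.2 y hy, hg.2 y hy]⟩
  smul_mem' := fun a f hf => ⟨(contDiff_const_smul (𝕜 := ℝ) (n := ∞) (F := ℂ) a).contMDiff.comp_contMDiffOn
    hf.1, fun y hy => by simp [hf.2 y hy]⟩

variable {G}

/-- The restriction to `V`, extended by zero. -/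
def res {V : Set M} (f : M → ℂ) (hf : ContMDiffOn 𝓘(ℝ, G) 𝓘(ℝ, ℂ) ∞ f V) : smoothOn G V :=
  ⟨V.indicator f, hf.congr fun _ hy => Set.indicator_of_mem hy f,
    fun _ hy => Set.indicator_of_notMem hy f⟩

theorem res_eqOn {V : Set M} (f : M → ℂ) (hf : ContMDiffOn 𝓘(ℝ, G) 𝓘(ℝ, ℂ) ∞ f V) :
    Set.EqOn f (res f hf : M → ℂ) V := fun _ hy => (Set.indicator_of_mem hy f).symm

/-- Vanishing outside V is imposed so that agreement on V suffices for equality; identities of local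
operators then become identities of linear maps. -/
theorem smoothOn_ext {V : Set M} {f g : smoothOn G V}
    (h : Set.EqOn (f : M → ℂ) (g : M → ℂ) V) : f = g := by
  ext y
  by_cases hy : y ∈ V
  · exact h hy
  · rw [f.2.2 y hy, g.2.2 y hy]

theorem mdifferentiableAt_smoothOn {V : Set M} (hV : IsOpen V) (f : smoothOn G V) {y : M}
    (hy : y ∈ V) : MDifferentiableAt 𝓘(ℝ, G) 𝓘(ℝ, ℂ) (f : M → ℂ) y :=
  (f.2.1.contMDiffAt (hV.mem_nhds hy)).mdifferentiableAt (by simp)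

theorem dR_congr {f g : M → ℂ} {V : Set M} (hV : IsOpen V) (h : Set.EqOn f g V) {y : M}
    (hy : y ∈ V) : dR (E := G) f y = dR g y := by
  have h1 : f =ᶠ[𝓝 y] g := Filter.eventuallyEq_of_mem (hV.mem_nhds hy) h
  exact h1.mfderiv_eq

theorem lieD_congr (D : ∀ y : M, CTangent (E := G) y) {f g : M → ℂ} {V : Set M} (hV : IsOpen V)
    (h : Set.EqOn f g V) : Set.EqOn (lieD D f) (lieD D g) V := fun y hy => by
  simp only [lieD, dC, dR_congr hV h hy]

theorem lieD_eq_zero (D : ∀ y : M, CTangent (E := G) y) {f : M → ℂ} {V : Set M} (hV : IsOpen V)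
    {a : ℂ} (h : ∀ y ∈ V, f y = a) {y : M} (hy : y ∈ V) : lieD D f y = 0 := by
  rw [lieD_congr D hV (g := fun _ => a) h hy]
  have : dR (E := G) (fun _ : M => a) y = 0 := mfderiv_const
  simp only [lieD, dC, this]
  simp

theorem dC_mul {f g : M → ℂ} {y : M} (hf : MDifferentiableAt 𝓘(ℝ, G) 𝓘(ℝ, ℂ) f y)
    (hg : MDifferentiableAt 𝓘(ℝ, G) 𝓘(ℝ, ℂ) g y) (w : CTangent (E := G) y) :
    dC (fun y => f y * g y) y w = dC f y w * g y + f y * dC g y w := by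
  have h1 : dR (E := G) (fun y => f y * g y) y = f y • dR g y + g y • dR f y :=
    (hf.hasMFDerivAt.mul hg.hasMFDerivAt).mfderiv
  induction w using TensorProduct.induction_on with
  | zero => simp
  | tmul a v =>
    have h2 : dR (E := G) (fun y => f y * g y) y v = f y * dR g y v + g y * dR f y v := by
      rw [h1]; rfl
    rw [dC_tmul, dC_tmul, dC_tmul, h2]
    ring
  | add w₁ w₂ h₁ h₂ => rw [map_add, map_add, map_add, h₁, h₂]; ring

/-- The derivative along a vector field as an operator on `smoothOn G V`. -/
def lieOp {V : Set M} (hV : IsOpen V) (D : ∀ y : M, CTangent (E := G) y)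
    (hD : ∀ f : M → ℂ, ContMDiffOn 𝓘(ℝ, G) 𝓘(ℝ, ℂ) ∞ f V →
      ContMDiffOn 𝓘(ℝ, G) 𝓘(ℝ, ℂ) ∞ (lieD D f) V) : smoothOn G V →ₗ[ℂ] smoothOn G V where
  toFun f := res (lieD D f) (hD f f.2.1)
  map_add' f g := smoothOn_ext fun y hy => by
    rw [← res_eqOn _ _ hy, Submodule.coe_add, lieD, dC_add _ _ _ (mdifferentiableAt_smoothOn hV f hy)
      (mdifferentiableAt_smoothOn hV g hy), Submodule.coe_add, Pi.add_apply, ← res_eqOn _ _ hy,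
      ← res_eqOn _ _ hy]
    rfl
  map_smul' a f := smoothOn_ext fun y hy => by
    rw [← res_eqOn _ _ hy, Submodule.coe_smul, lieD, dC_const_smul _ _ _
      (mdifferentiableAt_smoothOn hV f hy), RingHom.id_apply, Submodule.coe_smul, Pi.smul_apply,
      ← res_eqOn _ _ hy]
    rfl

section lieOp

variable {V : Set M} (hV : IsOpen V) (D : ∀ y : M, CTangent (E := G) y)
    (hD : ∀ f : M → ℂ, ContMDiffOn 𝓘(ℝ, G) 𝓘(ℝ, ℂ) ∞ f V →
      ContMDiffOn 𝓘(ℝ, G) 𝓘(ℝ, ℂ) ∞ (lieD D f) V)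

theorem lieOp_apply (f : smoothOn G V) {y : M} (hy : y ∈ V) :
    (lieOp hV D hD f : M → ℂ) y = lieD D f y :=
  (res_eqOn _ (hD f f.2.1) hy).symm

theorem lieOp_eqOn {f : M → ℂ} {f' : smoothOn G V} (h : Set.EqOn f f' V) :
    Set.EqOn (lieD D f) (lieOp hV D hD f' : M → ℂ) V := fun y hy => by
  rw [lieOp_apply hV D hD f' hy, lieD_congr D hV h hy]

end lieOp

theorem contMDiffOn_mul {H : Type*} [TopologicalSpace H] {I : ModelWithCorners ℝ G H}
    {N : Type*} [TopologicalSpace N] [ChartedSpace H N] {V : Set N} {f g : N → ℂ}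
    (hf : ContMDiffOn I 𝓘(ℝ, ℂ) ∞ f V) (hg : ContMDiffOn I 𝓘(ℝ, ℂ) ∞ g V) :
    ContMDiffOn I 𝓘(ℝ, ℂ) ∞ (fun y => f y * g y) V :=
  (contDiff_mul (𝕜 := ℝ) (𝔸 := ℂ)).contMDiff.comp_contMDiffOn (hf.prodMk_space hg)

/-- The product of functions. -/
def mulS (V : Set M) : smoothOn G V →ₗ[ℂ] smoothOn G V →ₗ[ℂ] smoothOn G V :=
  LinearMap.mk₂ ℂ (fun f g => ⟨fun y => (f : M → ℂ) y * (g : M → ℂ) y, contMDiffOn_mul f.2.1 g.2.1,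
      fun y hy => by simp [f.2.2 y hy]⟩)
    (fun f₁ f₂ g => by ext y; simp [add_mul]) (fun a f g => by ext y; simp [mul_assoc])
    (fun f g₁ g₂ => by ext y; simp [mul_add]) (fun a f g => by ext y; simp [mul_left_comm])

theorem mulS_apply {V : Set M} (f g : smoothOn G V) (y : M) :
    (mulS V f g : M → ℂ) y = (f : M → ℂ) y * (g : M → ℂ) y := rfl

theorem lieOp_mulS {V : Set M} (hV : IsOpen V) (D : ∀ y : M, CTangent (E := G) y)
    (hD : ∀ f : M → ℂ, ContMDiffOn 𝓘(ℝ, G) 𝓘(ℝ, ℂ) ∞ f V →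
      ContMDiffOn 𝓘(ℝ, G) 𝓘(ℝ, ℂ) ∞ (lieD D f) V) (f g : smoothOn G V) :
    lieOp hV D hD (mulS V f g) = mulS V (lieOp hV D hD f) g + mulS V f (lieOp hV D hD g) :=
  smoothOn_ext fun y hy => by
    rw [lieOp_apply hV D hD _ hy, Submodule.coe_add, Pi.add_apply, mulS_apply, mulS_apply,
      lieOp_apply hV D hD _ hy, lieOp_apply hV D hD _ hy]
    exact dC_mul (mdifferentiableAt_smoothOn hV f hy) (mdifferentiableAt_smoothOn hV g hy) _

variable (G) in
/-- Evaluation at a point. -/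
def evalS (V : Set M) (y : M) : smoothOn G V →ₗ[ℂ] ℂ :=
  (LinearMap.proj y : (M → ℂ) →ₗ[ℂ] ℂ).comp (smoothOn G V).subtype

@[simp] theorem evalS_apply (V : Set M) (y : M) (f : smoothOn G V) :
    evalS G V y f = (f : M → ℂ) y := rfl

end SmoothOn

/-! ### From pointwise powers of bidifferential operators to `biPow`. -/

section TensorPow

variable {n : ℕ} {Z A M : Type*} [AddCommGroup A] [Module ℂ A] [AddCommGroup M] [Module ℂ M]

/-- The powers of a bidifferential operator, computed in spaces `A` and `M` of functions on `V`. -/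
theorem tensorPow_eq_biPow {P : Fin n → A →ₗ[ℂ] A} {Q : Fin n → M →ₗ[ℂ] M}
    {β : A →ₗ[ℂ] M →ₗ[ℂ] ℂ} {V : Set Z} {oA oM : Fin n → (Z → ℂ) → Z → ℂ} {a : A → Z → ℂ}
    {b : M → Z → ℂ} (hA : ∀ j f f', Set.EqOn f (a f') V → Set.EqOn (oA j f) (a (P j f')) V)
    (hM : ∀ j g g', Set.EqOn g (b g') V → Set.EqOn (oM j g) (b (Q j g')) V)
    {z : Z × Z} (h₁ : z.1 ∈ V) (h₂ : z.2 ∈ V) (hβ : ∀ f g, β f g = a f z.1 * b g z.2)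
    (k : ℕ) {f : Z → ℂ} {f' : A} {g : Z → ℂ} {g' : M} (hf : Set.EqOn f (a f') V)
    (hg : Set.EqOn g (b g') V) :
    tensorPow oA oM k f g z = biPow P Q β k f' g' := by
  induction k generalizing f f' g g' with
  | zero => simp [tensorPow, hβ, hf h₁, hg h₂]
  | succ k ih =>
    rw [tensorPow, biPow_succ]
    exact Finset.sum_congr rfl fun j _ => ih (hA j f f' hf) (hM j g g' hg)

end TensorPow

/-! ### Derivatives along a dual frame as linear operators; locally constant functions. -/

section CoframeOp

variable {G : Type*} [NormedAddCommGroup G] [NormedSpace ℝ G]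
  {M : Type*} [TopologicalSpace M] [ChartedSpace G M] [IsManifold 𝓘(ℝ, G) ∞ M]
  {ι : Type*} [Fintype ι] [DecidableEq ι] {V : Set M}
  {θ : ι → ∀ y : M, TangentSpace 𝓘(ℝ, G) y →L[ℝ] ℂ} {e : ι → ∀ y : M, CTangent (E := G) y}
  {k : ι → ι → ι → ℂ}

namespace IsCoframe

omit [IsManifold 𝓘(ℝ, G) ∞ M] in
theorem mono (h : IsCoframe V θ e k) {V' : Set M} (hV' : IsOpen V') (hs : V' ⊆ V) :
    IsCoframe V' θ e k where
  isOpen := hV'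
  dual := fun y hy => h.dual y (hs hy)
  span := fun _ hy => h.span _ (hs hy)
  smooth := fun a y₀ v => (h.smooth a y₀ v).mono
    (Set.inter_subset_inter_right _ (Set.preimage_mono hs))
  deriv := fun _ hy => h.deriv _ (hs hy)

variable (h : IsCoframe V θ e k)
include h

theorem contMDiffOn_lieD (a : ι) (f : M → ℂ) (hf : ContMDiffOn 𝓘(ℝ, G) 𝓘(ℝ, ℂ) ∞ f V) :
    ContMDiffOn 𝓘(ℝ, G) 𝓘(ℝ, ℂ) ∞ (lieD (e a) f) V := fun _ hy =>
  (h.contMDiffAt_lieD hy (hf.contMDiffAt (h.isOpen.mem_nhds hy)) a).contMDiffWithinAt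

/-- The derivatives along the dual frame. -/
def op (a : ι) : smoothOn G V →ₗ[ℂ] smoothOn G V := lieOp h.isOpen (e a) (h.contMDiffOn_lieD a)

theorem op_apply (a : ι) (f : smoothOn G V) {y : M} (hy : y ∈ V) :
    (h.op a f : M → ℂ) y = lieD (e a) f y := lieOp_apply _ _ _ f hy

theorem op_eqOn (a : ι) {f : M → ℂ} {f' : smoothOn G V} (hf : Set.EqOn f f' V) :
    Set.EqOn (lieD (e a) f) (h.op a f' : M → ℂ) V := lieOp_eqOn _ _ _ hf

theorem op_mulS (a : ι) (f g : smoothOn G V) :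
    h.op a (mulS V f g) = mulS V (h.op a f) g + mulS V f (h.op a g) := lieOp_mulS _ _ _ f g

theorem op_comm (b c : ι) (f : smoothOn G V) :
    h.op b (h.op c f) = h.op c (h.op b f) - ∑ a, k a b c • h.op a f :=
  smoothOn_ext fun y hy => by
    have h1 : ∀ b c, (h.op b (h.op c f) : M → ℂ) y = lieD (e b) (lieD (e c) f) y := fun b c =>
      (h.op_eqOn b (h.op_eqOn c fun _ _ => rfl) hy).symm
    rw [h1, Submodule.coe_sub, Pi.sub_apply, h1,
      h.commutator hy (f.2.1.contMDiffAt (h.isOpen.mem_nhds hy))]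
    simp [h.op_apply _ f hy]

end IsCoframe

/-- A function with zero differential is locally constant. -/
theorem eventually_eq_of_dR_eq_zero {W : Set M} (hW : IsOpen W) {f : M → ℂ}
    (hf : ContMDiffOn 𝓘(ℝ, G) 𝓘(ℝ, ℂ) ∞ f W) (h : ∀ y ∈ W, ∀ v, dR (E := G) f y v = 0) {y : M}
    (hy : y ∈ W) : ∀ᶠ y' in 𝓝 y, f y' = f y := by
  have hc := continuousAt_extChartAt_symm (I := 𝓘(ℝ, G)) y
  rw [ContinuousAt, extChartAt_to_inv] at hc
  obtain ⟨r, hr, hball⟩ := Metric.mem_nhds_iff.mp (Filter.inter_mem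
    (extChartAt_target_mem_nhds (I := 𝓘(ℝ, G)) y) (hc (hW.mem_nhds hy)))
  have hd : ∀ z ∈ Metric.ball (extChartAt 𝓘(ℝ, G) y y) r,
      MDifferentiableAt 𝓘(ℝ, G) 𝓘(ℝ, ℂ) f ((extChartAt 𝓘(ℝ, G) y).symm z) := fun z hz =>
    (hf.contMDiffAt (hW.mem_nhds (hball hz).2)).mdifferentiableAt (by simp)
  have hconst : ∀ z ∈ Metric.ball (extChartAt 𝓘(ℝ, G) y y) r,
      (f ∘ (extChartAt 𝓘(ℝ, G) y).symm) z =
        (f ∘ (extChartAt 𝓘(ℝ, G) y).symm) (extChartAt 𝓘(ℝ, G) y y) := fun z hz => Metric.isOpen_ball.is_const_of_fderiv_eq_zero (𝕜 := ℝ)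
    (f := f ∘ (extChartAt 𝓘(ℝ, G) y).symm) (convex_ball _ r).isPreconnected
    (fun z hz => (contDiffAt_comp_chart_symm (hball hz).1
      (hf.contMDiffAt (hW.mem_nhds (hball hz).2))).differentiableAt (by simp)
        |>.differentiableWithinAt)
    (fun z hz => by
      ext v
      rw [fderiv_comp_chart_symm (hball hz).1 (hd z hz)]
      exact h _ (hball hz).2 _) hz (Metric.mem_ball_self hr)
  filter_upwards [(continuousAt_extChartAt (I := 𝓘(ℝ, G)) y) (Metric.ball_mem_nhds _ hr),
    extChartAt_source_mem_nhds (I := 𝓘(ℝ, G)) y] with y' hy' hs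
  have h1 := hconst _ hy'
  rwa [Function.comp_apply, Function.comp_apply, (extChartAt 𝓘(ℝ, G) y).left_inv hs,
    extChartAt_to_inv] at h1

end CoframeOp


/-! ### Change of Darboux chart -/

section ChangeChart

variable {E : Type*} [NormedAddCommGroup E] [NormedSpace ℝ E]
  {X : Type*} [TopologicalSpace X] [ChartedSpace E X] {n : ℕ} {Ω : DForm E X 2}
  {J K : ∀ x : X, Submodule ℂ (CTangent (E := E) x)}

namespace DarbouxChart

variable (c c' : DarbouxChart n Ω J K)

theorem eq_sum_frame (hΩ : IsSymplectic Ω) {x : X} (hx : x ∈ c.U) (w : CTangent (E := E) x) :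
    w = ∑ j, dC (c.p j) x w • c.P j x + ∑ j, dC (c.q j) x w • c.Q j x := by
  induction w using TensorProduct.induction_on with
  | zero => simp
  | tmul a v =>
    have h1 := congrArg (a • ·) (c.one_tmul_eq hΩ hx v)
    simp only [TensorProduct.smul_tmul', smul_eq_mul, mul_one] at h1
    refine h1.trans ?_
    simp only [dC_tmul, smul_add, Finset.smul_sum, smul_smul]
  | add w₁ w₂ h₁ h₂ =>
    conv_lhs => rw [h₁, h₂]
    simp only [map_add, add_smul, Finset.sum_add_distrib]
    abel

theorem dC_q_of_mem {x : X} (hx : x ∈ c.U) {w : CTangent (E := E) x} (hw : w ∈ J x) (i : Fin n) :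
    dC (c.q i) x w = 0 := by
  rw [c.span_P x hx] at hw
  have h : Submodule.span ℂ (Set.range fun j => c.P j x) ≤ LinearMap.ker (dC (c.q i) x) := by
    rw [Submodule.span_le]
    rintro _ ⟨j, rfl⟩
    exact c.dq_P x hx i j
  exact h hw

theorem dC_p_of_mem {x : X} (hx : x ∈ c.U) {w : CTangent (E := E) x} (hw : w ∈ K x) (i : Fin n) :
    dC (c.p i) x w = 0 := by
  rw [c.span_Q x hx] at hw
  have h : Submodule.span ℂ (Set.range fun j => c.Q j x) ≤ LinearMap.ker (dC (c.p i) x) := by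
    rw [Submodule.span_le]
    rintro _ ⟨j, rfl⟩
    exact c.dp_Q x hx i j
  exact h hw

theorem P_mem {x : X} (hx : x ∈ c.U) (j : Fin n) : c.P j x ∈ J x := by
  rw [c.span_P x hx]; exact Submodule.subset_span ⟨j, rfl⟩

theorem Q_mem {x : X} (hx : x ∈ c.U) (j : Fin n) : c.Q j x ∈ K x := by
  rw [c.span_Q x hx]; exact Submodule.subset_span ⟨j, rfl⟩

/-- Both families of momentum fields lie in the same J, which every dq' annihilates; hence no ∂_{q'}
occurs in the expansion. -/
theorem P_eq_sum (hΩ : IsSymplectic Ω) {x : X} (hx : x ∈ c.U) (hx' : x ∈ c'.U) (j : Fin n) :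
    c.P j x = ∑ i, dC (c'.p i) x (c.P j x) • c'.P i x := by
  conv_lhs => rw [c'.eq_sum_frame hΩ hx' (c.P j x)]
  simp [c'.dC_q_of_mem hx' (c.P_mem hx j)]

theorem Q_eq_sum (hΩ : IsSymplectic Ω) {x : X} (hx : x ∈ c.U) (hx' : x ∈ c'.U) (j : Fin n) :
    c.Q j x = ∑ i, dC (c'.q i) x (c.Q j x) • c'.Q i x := by
  conv_lhs => rw [c'.eq_sum_frame hΩ hx' (c.Q j x)]
  simp [c'.dC_p_of_mem hx' (c.Q_mem hx j)]

/-- The Darboux formula for the complexified symplectic form. -/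
theorem darbouxC {x : X} (hx : x ∈ c.U) (hx' : x ∈ c'.U) (w w' : CTangent (E := E) x) :
    ∑ j, (dC (c.p j) x w * dC (c.q j) x w' - dC (c.p j) x w' * dC (c.q j) x w) =
      ∑ j, (dC (c'.p j) x w * dC (c'.q j) x w' - dC (c'.p j) x w' * dC (c'.q j) x w) := by
  induction w using TensorProduct.induction_on with
  | zero => simp
  | tmul a v =>
    induction w' using TensorProduct.induction_on with
    | zero => simp
    | tmul b v' =>
      have h1 := (c.darboux x hx v v').symm.trans (c'.darboux x hx' v v')
      have h2 := congrArg (a * b * ·) h1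
      simp only [Finset.mul_sum] at h2
      simp only [dC_tmul]
      convert h2 using 2 <;> ring
    | add w₁ w₂ h₁ h₂ =>
      simp only [Finset.sum_sub_distrib, map_add, mul_add, add_mul, Finset.sum_add_distrib]
        at h₁ h₂ ⊢
      linear_combination h₁ + h₂
  | add w₁ w₂ h₁ h₂ =>
    simp only [Finset.sum_sub_distrib, map_add, mul_add, add_mul, Finset.sum_add_distrib]
      at h₁ h₂ ⊢
    linear_combination h₁ + h₂

/-- Evaluate the complexified symplectic form on (∂_{p_j}, ∂_{q^l}) in both charts; the cross terms
vanish because dq' annihilates J. With a and b the transition matrices of the momentum and position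
frames, this is a bᵀ = 1. -/
theorem sum_P_mul_Q {x : X} (hx : x ∈ c.U) (hx' : x ∈ c'.U) (j l : Fin n) :
    ∑ i, dC (c'.p i) x (c.P j x) * dC (c'.q i) x (c.Q l x) = if j = l then 1 else 0 := by
  have h := c.darbouxC c' hx hx' (c.P j x) (c.Q l x)
  simp only [c'.dC_q_of_mem hx' (c.P_mem hx j), c.dp_P x hx, c.dp_Q x hx, c.dq_P x hx,
    c.dq_Q x hx] at h
  simp only [mul_ite, mul_one, mul_zero, sub_zero] at h
  rw [← h]
  simp [eq_comm]

end DarbouxChart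

variable {F : Type*} [NormedAddCommGroup F] [NormedSpace ℝ F] [FiniteDimensional ℝ F]
  {Y : Type*} [TopologicalSpace Y] [ChartedSpace F Y] [MulAction Circle Y]
  {ħ : ℝ} (B : PrequantumBundle F Y ħ Ω)

/-- The lift of a vector field is related to the vector field by the projection. -/
theorem lieD_lift_comp_proj (D : ∀ x : X, CTangent (E := E) x) {f : X → ℂ} {y : Y}
    (hf : MDifferentiableAt 𝓘(ℝ, E) 𝓘(ℝ, ℂ) f (B.proj y)) :
    lieD (B.lift D) (f ∘ B.proj) y = lieD D f (B.proj y) := by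
  have h1 : dR (E := F) (f ∘ B.proj) y =
      (dR f (B.proj y)).comp (mfderiv 𝓘(ℝ, F) 𝓘(ℝ, E) B.proj y) :=
    (HasMFDerivAt.comp y hf.hasMFDerivAt
      (B.isBundle.smooth_proj.mdifferentiable (by simp) y).hasMFDerivAt).mfderiv
  rw [lieD, dC, h1]
  exact liftBaseChange_hliftC B f y _ rfl

omit [FiniteDimensional ℝ F] in
theorem lieD_genC_comp_proj {f : X → ℂ} {y : Y}
    (hf : MDifferentiableAt 𝓘(ℝ, E) 𝓘(ℝ, ℂ) f (B.proj y)) :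
    lieD (E := F) genC (f ∘ B.proj) y = 0 := by
  have h1 : dR (E := F) (f ∘ B.proj) y =
      (dR f (B.proj y)).comp (mfderiv 𝓘(ℝ, F) 𝓘(ℝ, E) B.proj y) :=
    (HasMFDerivAt.comp y hf.hasMFDerivAt
      (B.isBundle.smooth_proj.mdifferentiable (by simp) y).hasMFDerivAt).mfderiv
  have h2 := B.isBundle.mfderiv_proj_generator y
  rw [lieD, genC, dC_tmul, h1]
  simp [h2]

omit [FiniteDimensional ℝ F] [MulAction Circle Y] in
theorem lieD_sum_smul {D : ∀ y : Y, CTangent (E := F) y}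
    {D' : Fin n → ∀ y : Y, CTangent (E := F) y} (a : Fin n → ℂ) {y : Y}
    (h : D y = ∑ i, a i • D' i y) (f : Y → ℂ) : lieD D f y = ∑ i, a i * lieD (D' i) f y := by
  simp [lieD, h]

omit [FiniteDimensional ℝ F] in
theorem lift_eq_sum {D : ∀ x : X, CTangent (E := E) x}
    {D' : Fin n → ∀ x : X, CTangent (E := E) x} (a : Fin n → ℂ) {y : Y}
    (h : D (B.proj y) = ∑ i, a i • D' i (B.proj y)) (f : Y → ℂ) :
    lieD (B.lift D) f y = ∑ i, a i * lieD (B.lift (D' i)) f y := by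
  refine lieD_sum_smul a ?_ f
  simp [PrequantumBundle.lift, h]

variable [IsManifold 𝓘(ℝ, F) ∞ Y] (c c' : DarbouxChart n Ω J K)

section Commutators

variable {B c} {V : Set Y} (h : IsCoframe V (coframe B c) (frame B c) (structureCoeff n ħ))
  (f : smoothOn F V)
include h
omit [FiniteDimensional ℝ F]

theorem op_none_comm (a : Option (Fin n ⊕ Fin n)) :
    h.op none (h.op a f) = h.op a (h.op none f) := by
  rw [h.op_comm]
  simp [structureCoeff]

theorem op_P_comm (i j : Fin n) :
    h.op (some (.inl i)) (h.op (some (.inl j)) f) =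
      h.op (some (.inl j)) (h.op (some (.inl i)) f) := by
  rw [h.op_comm]
  simp [structureCoeff]

theorem op_Q_comm (i j : Fin n) :
    h.op (some (.inr i)) (h.op (some (.inr j)) f) =
      h.op (some (.inr j)) (h.op (some (.inr i)) f) := by
  rw [h.op_comm]
  simp [structureCoeff]

/-- The canonical commutation relation: the curvature of the connection obstructs the commuting of
the lifted coordinate fields. -/
theorem op_P_op_Q (i j : Fin n) :
    h.op (some (.inl i)) (h.op (some (.inr j)) f) =
      h.op (some (.inr j)) (h.op (some (.inl i)) f) +
        (if i = j then -(ħ : ℂ)⁻¹ else 0) • h.op none f := by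
  rw [h.op_comm]
  simp only [structureCoeff, Fintype.sum_option, zero_smul, Finset.sum_const_zero, add_zero]
  split_ifs
  · module
  · module

end Commutators

omit [FiniteDimensional ℝ F] in
theorem op_P_op_Q_of_gen_eq_zero {B : PrequantumBundle F Y ħ Ω} {c : DarbouxChart n Ω J K}
    {V : Set Y} (h : IsCoframe V (coframe B c) (frame B c) (structureCoeff n ħ))
    {f : smoothOn F V} (hf : h.op none f = 0) (i j : Fin n) :
    h.op (some (.inl i)) (h.op (some (.inr j)) f) =
      h.op (some (.inr j)) (h.op (some (.inl i)) f) := by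
  rw [op_P_op_Q, hf, smul_zero, add_zero]

omit [FiniteDimensional ℝ F] in
theorem op_none_comp_proj {B : PrequantumBundle F Y ħ Ω} {c : DarbouxChart n Ω J K}
    {V : Set Y} (h : IsCoframe V (coframe B c) (frame B c) (structureCoeff n ħ))
    {U : Set X} (hU : IsOpen U) (hVU : V ⊆ B.proj ⁻¹' U) {f : X → ℂ}
    (hf : ContMDiffOn 𝓘(ℝ, E) 𝓘(ℝ, ℂ) ∞ f U) {f' : smoothOn F V}
    (hff' : Set.EqOn (f ∘ B.proj) f' V) : h.op none f' = 0 :=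
  smoothOn_ext fun y hy => by
    rw [← h.op_eqOn none hff' hy]
    exact lieD_genC_comp_proj B
      ((hf.contMDiffAt (hU.mem_nhds (hVU hy))).mdifferentiableAt (by simp))

/-- The transition matrices between the frames of two Darboux charts are locally constant. -/
theorem eventually_transition (hΩ : IsSymplectic Ω) {y : Y} (hy : B.proj y ∈ c.U)
    (hy' : B.proj y ∈ c'.U) (i j : Fin n) :
    (∀ᶠ z in 𝓝 y, dC (c'.p i) (B.proj z) (c.P j (B.proj z)) =
      dC (c'.p i) (B.proj y) (c.P j (B.proj y))) ∧
    ∀ᶠ z in 𝓝 y, dC (c'.q i) (B.proj z) (c.Q j (B.proj z)) =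
      dC (c'.q i) (B.proj y) (c.Q j (B.proj y)) := by
  have hW : IsOpen (B.proj ⁻¹' (c.U ∩ c'.U)) :=
    (c.isOpen.inter c'.isOpen).preimage B.isBundle.smooth_proj.continuous
  have h := (isCoframe B c hΩ).mono hW (Set.preimage_mono Set.inter_subset_left)
  set W := B.proj ⁻¹' (c.U ∩ c'.U)
  have hWsub : W ⊆ B.proj ⁻¹' c'.U := Set.preimage_mono Set.inter_subset_right
  have hps := fun i => (contMDiffOn_comp_proj B (c'.smooth_p i)).mono hWsub
  have hqs := fun i => (contMDiffOn_comp_proj B (c'.smooth_q i)).mono hWsub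
  let p : Fin n → smoothOn F W := fun i => res _ (hps i)
  let q : Fin n → smoothOn F W := fun i => res _ (hqs i)
  let a : Fin n → Fin n → smoothOn F W := fun j i => h.op (some (.inl j)) (p i)
  let b : Fin n → Fin n → smoothOn F W := fun j i => h.op (some (.inr j)) (q i)
  have ha : ∀ j i, ∀ z ∈ W, (a j i : Y → ℂ) z = dC (c'.p i) (B.proj z) (c.P j (B.proj z)) :=
    fun j i z hz => by
      rw [← h.op_eqOn _ (res_eqOn _ (hps i)) hz]
      exact lieD_lift_comp_proj B _
        (((c'.smooth_p i).contMDiffAt (c'.isOpen.mem_nhds hz.2)).mdifferentiableAt (by simp))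
  have hb : ∀ j i, ∀ z ∈ W, (b j i : Y → ℂ) z = dC (c'.q i) (B.proj z) (c.Q j (B.proj z)) :=
    fun j i z hz => by
      rw [← h.op_eqOn _ (res_eqOn _ (hqs i)) hz]
      exact lieD_lift_comp_proj B _
        (((c'.smooth_q i).contMDiffAt (c'.isOpen.mem_nhds hz.2)).mdifferentiableAt (by simp))
  have hgp : ∀ i, h.op none (p i) = 0 := fun i =>
    op_none_comp_proj h c'.isOpen hWsub (c'.smooth_p i) (res_eqOn _ (hps i))
  have hgq : ∀ i, h.op none (q i) = 0 := fun i =>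
    op_none_comp_proj h c'.isOpen hWsub (c'.smooth_q i) (res_eqOn _ (hqs i))
  have hQp : ∀ j i, h.op (some (.inr j)) (p i) = 0 := fun j i => smoothOn_ext fun z hz => by
    rw [← h.op_eqOn _ (res_eqOn _ (hps i)) hz]
    refine (lieD_lift_comp_proj B _ (((c'.smooth_p i).contMDiffAt
      (c'.isOpen.mem_nhds hz.2)).mdifferentiableAt (by simp))).trans ?_
    exact c'.dC_p_of_mem hz.2 (c.Q_mem hz.1 j) i
  have hPq : ∀ j i, h.op (some (.inl j)) (q i) = 0 := fun j i => smoothOn_ext fun z hz => by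
    rw [← h.op_eqOn _ (res_eqOn _ (hqs i)) hz]
    refine (lieD_lift_comp_proj B _ (((c'.smooth_q i).contMDiffAt
      (c'.isOpen.mem_nhds hz.2)).mdifferentiableAt (by simp))).trans ?_
    exact c'.dC_q_of_mem hz.2 (c.P_mem hz.1 j) i
  -- On functions pulled back from X the fields P and Q commute, so Q_m P_j p'_i = P_j Q_m p'_i,
  -- which vanishes since dp' annihilates K. The same argument gives P_m b = 0.
  have hQa : ∀ m j i, h.op (some (.inr m)) (a j i) = 0 := fun m j i => by
    simp only [a]
    rw [← op_P_op_Q_of_gen_eq_zero h (hgp i), hQp, map_zero]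
  have hPb : ∀ m j i, h.op (some (.inl m)) (b j i) = 0 := fun m j i => by
    simp only [b]
    rw [op_P_op_Q_of_gen_eq_zero h (hgq i), hPq, map_zero]
  have hga : ∀ j i, h.op none (a j i) = 0 := fun j i => by
    simp only [a]
    rw [op_none_comm, hgp, map_zero]
  have hgb : ∀ j i, h.op none (b j i) = 0 := fun j i => by
    simp only [b]
    rw [op_none_comm, hgq, map_zero]
  have hab : ∀ z ∈ W, ∀ j l, ∑ i, (a j i : Y → ℂ) z * (b l i : Y → ℂ) z =
      if j = l then 1 else 0 := fun z hz j l => by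
    simp only [ha _ _ z hz, hb _ _ z hz]
    exact c.sum_P_mul_Q c' hz.1 hz.2 j l
  have hab' : ∀ z ∈ W, ∀ j l, ∑ i, (b i j : Y → ℂ) z * (a i l : Y → ℂ) z =
      if j = l then 1 else 0 := fun z hz j l => by
    have h1 : (Matrix.of fun j i => (a j i : Y → ℂ) z) *
        (Matrix.of fun i l => (b l i : Y → ℂ) z) = 1 := by
      ext j l
      simpa [Matrix.mul_apply, Matrix.one_apply] using hab z hz j l
    have h2 := congrArg (fun m : Matrix (Fin n) (Fin n) ℂ => m j l) (mul_eq_one_comm.mp h1)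
    simpa [Matrix.mul_apply, Matrix.one_apply] using h2
  -- The product rule applied to the constant matrix a bᵀ = 1.
  have hder : ∀ m, ∀ z ∈ W, ∀ j l, ∑ i, ((h.op m (a j i) : Y → ℂ) z * (b l i : Y → ℂ) z +
      (a j i : Y → ℂ) z * (h.op m (b l i) : Y → ℂ) z) = 0 := fun m z hz j l => by
    have h1 : (h.op m (∑ i, mulS W (a j i) (b l i)) : Y → ℂ) z = 0 := by
      rw [h.op_apply _ _ hz]
      refine lieD_eq_zero _ hW (a := if j = l then 1 else 0) (fun z hz => ?_) hz
      rw [← hab z hz j l]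
      simp [mulS_apply]
    rw [← h1, map_sum]
    simp [h.op_mulS, mulS_apply]
  -- Since P_m b = 0, the product rule leaves (P_m a) bᵀ = 0; multiplying by a on the right and
  -- using bᵀ a = 1 gives P_m a = 0. The argument for Q_m b exchanges the roles of a and b.
  have hPa : ∀ m j i, h.op (some (.inl m)) (a j i) = 0 := fun m j i => smoothOn_ext fun z hz => by
    have h1 : ∀ l, ∑ i, (h.op (some (.inl m)) (a j i) : Y → ℂ) z * (b l i : Y → ℂ) z = 0 :=
      fun l => by simpa [hPb] using hder (some (.inl m)) z hz j l
    have h2 : ∑ l, (∑ k, (h.op (some (.inl m)) (a j k) : Y → ℂ) z * (b l k : Y → ℂ) z) *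
        (a l i : Y → ℂ) z = 0 := by simp [h1]
    simp only [Finset.sum_mul, mul_assoc] at h2
    rw [Finset.sum_comm] at h2
    simp only [← Finset.mul_sum, hab' z hz] at h2
    simpa using h2
  have hQb : ∀ m j i, h.op (some (.inr m)) (b j i) = 0 := fun m j i => smoothOn_ext fun z hz => by
    have h1 : ∀ l, ∑ i, (h.op (some (.inr m)) (b j i) : Y → ℂ) z * (a l i : Y → ℂ) z = 0 :=
      fun l => by simpa [hQa, mul_comm] using hder (some (.inr m)) z hz l j
    have h2 : ∑ l, (∑ k, (h.op (some (.inr m)) (b j k) : Y → ℂ) z * (a l k : Y → ℂ) z) *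
        (b l i : Y → ℂ) z = 0 := by simp [h1]
    have hab'' : ∀ j l, ∑ i, (a i j : Y → ℂ) z * (b i l : Y → ℂ) z =
        if j = l then 1 else 0 := fun j l => by
      rw [← Finset.sum_congr rfl fun i _ => mul_comm _ _, hab' z hz l j]
      simp [eq_comm]
    simp only [Finset.sum_mul, mul_assoc] at h2
    rw [Finset.sum_comm] at h2
    simp only [← Finset.mul_sum, hab''] at h2
    simpa using h2
  have hloc : ∀ f : smoothOn F W, (∀ m, h.op m f = 0) →
      ∀ᶠ z in 𝓝 y, z ∈ W ∧ (f : Y → ℂ) z = (f : Y → ℂ) y := fun f hf =>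
    Filter.Eventually.and (hW.mem_nhds ⟨hy, hy'⟩)
      (eventually_eq_of_dR_eq_zero hW f.2.1 (fun z hz v => by
      rw [h.dR_eq _ hz]
      refine Finset.sum_eq_zero fun m _ => ?_
      rw [← h.op_apply m f hz, hf m]
      simp) ⟨hy, hy'⟩)
  constructor
  · have h1 := hloc (a j i) (by rintro (_ | m | m); exacts [hga j i, hPa m j i, hQa m j i])
    rw [ha j i y ⟨hy, hy'⟩] at h1
    filter_upwards [h1] with z hz
    rw [← ha j i z hz.1, hz.2]
  · have h1 := hloc (b j i) (by rintro (_ | m | m); exacts [hgb j i, hPb m j i, hQb m j i])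
    rw [hb j i y ⟨hy, hy'⟩] at h1
    filter_upwards [h1] with z hz
    rw [← hb j i z hz.1, hz.2]

omit [FiniteDimensional ℝ F] in
/-- The powers of the lifted normal tensor, in the space of smooth functions on `V`. -/
theorem nuLiftPow_eq {B : PrequantumBundle F Y ħ Ω} {c : DarbouxChart n Ω J K}
    {V : Set Y} (h : IsCoframe V (coframe B c) (frame B c) (structureCoeff n ħ)) {z : Y × Y}
    (h₁ : z.1 ∈ V) (h₂ : z.2 ∈ V) {β : smoothOn F V →ₗ[ℂ] smoothOn F V →ₗ[ℂ] ℂ}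
    (hβ : ∀ f g, β f g = (f : Y → ℂ) z.1 * (g : Y → ℂ) z.2) (k : ℕ) {f g : Y → ℂ}
    {f' g' : smoothOn F V} (hf : Set.EqOn f f' V) (hg : Set.EqOn g g' V) :
    nuLiftPow B c k f g z =
      biPow (fun j => h.op (some (.inl j))) (fun j => h.op (some (.inr j))) β k f' g' :=
  tensorPow_eq_biPow (a := fun f : smoothOn F V => (f : Y → ℂ))
    (b := fun f : smoothOn F V => (f : Y → ℂ)) (V := V)
    (fun j _ _ hf => h.op_eqOn (some (.inl j)) hf)
    (fun j _ _ hf => h.op_eqOn (some (.inr j)) hf) h₁ h₂ hβ k hf hg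

/-- Evaluation of `f ⊗ g` at a point. -/
def evalTensor (V : Set Y) (z : Y × Y) : smoothOn F V →ₗ[ℂ] smoothOn F V →ₗ[ℂ] ℂ :=
  (LinearMap.mul ℂ ℂ).compl₁₂ (evalS F V z.1) (evalS F V z.2)

/-- Near the diagonal, the powers of the lifted normal tensor do not depend on the chart. -/
theorem exists_nuLiftPow_eq (hΩ : IsSymplectic Ω) {y : Y} (hy : B.proj y ∈ c.U)
    (hy' : B.proj y ∈ c'.U) :
    ∃ V : Set Y, IsOpen V ∧ y ∈ V ∧ V ⊆ B.proj ⁻¹' (c.U ∩ c'.U) ∧ ∀ f g : Y → ℂ,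
      ContMDiffOn 𝓘(ℝ, F) 𝓘(ℝ, ℂ) ∞ f V → ContMDiffOn 𝓘(ℝ, F) 𝓘(ℝ, ℂ) ∞ g V →
      ∀ z : Y × Y, z.1 ∈ V → z.2 ∈ V → ∀ k,
        nuLiftPow B c k f g z = nuLiftPow B c' k f g z := by
  have hW : IsOpen (B.proj ⁻¹' (c.U ∩ c'.U)) :=
    (c.isOpen.inter c'.isOpen).preimage B.isBundle.smooth_proj.continuous
  have h1 : ∀ᶠ z in 𝓝 y, (∀ i j, dC (c'.p i) (B.proj z) (c.P j (B.proj z)) =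
      dC (c'.p i) (B.proj y) (c.P j (B.proj y))) ∧
      (∀ i j, dC (c'.q i) (B.proj z) (c.Q j (B.proj z)) =
      dC (c'.q i) (B.proj y) (c.Q j (B.proj y))) ∧ z ∈ B.proj ⁻¹' (c.U ∩ c'.U) := by
    refine Filter.Eventually.and ?_ (Filter.Eventually.and ?_ (hW.mem_nhds ⟨hy, hy'⟩)) <;>
    simp only [Filter.eventually_all]
    exacts [fun i j => (eventually_transition B c c' hΩ hy hy' i j).1,
      fun i j => (eventually_transition B c c' hΩ hy hy' i j).2]
  obtain ⟨V, hV, hVo, hyV⟩ := eventually_nhds_iff.mp h1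
  have hVs : V ⊆ B.proj ⁻¹' (c.U ∩ c'.U) := fun z hz => (hV z hz).2.2
  refine ⟨V, hVo, hyV, hVs, fun f g hf hg z h₁ h₂ k => ?_⟩
  have hc := (isCoframe B c hΩ).mono hVo fun z hz => (hVs hz).1
  have hc' := (isCoframe B c' hΩ).mono hVo fun z hz => (hVs hz).2
  have hβ : ∀ f g, evalTensor (F := F) V z f g = (f : Y → ℂ) z.1 * (g : Y → ℂ) z.2 := fun f g => rfl
  rw [nuLiftPow_eq hc h₁ h₂ hβ k (res_eqOn f hf) (res_eqOn g hg),
    nuLiftPow_eq hc' h₁ h₂ hβ k (res_eqOn f hf) (res_eqOn g hg)]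
  -- On V the transition matrices keep their values at y, so constant matrices relate the two
  -- families of operators.
  refine biPow_congr_frame _ _ _
    (Matrix.of fun j i => dC (c'.p i) (B.proj y) (c.P j (B.proj y)))
    (Matrix.of fun j i => dC (c'.q i) (B.proj y) (c.Q j (B.proj y))) (fun j f => ?_)
    (fun j f => ?_) ?_ k _ _
  · refine smoothOn_ext fun z hz => ?_
    rw [hc.op_apply _ _ hz]
    refine (lift_eq_sum B (D' := c'.P) _
      (c.P_eq_sum c' hΩ (hVs hz).1 (hVs hz).2 j) f).trans ?_
    simp only [(hV z hz).1, Matrix.of_apply, AddSubmonoidClass.coe_finsetSum, Finset.sum_apply,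
      Submodule.coe_smul, Pi.smul_apply, hc'.op_apply _ _ hz, smul_eq_mul]
    rfl
  · refine smoothOn_ext fun z hz => ?_
    rw [hc.op_apply _ _ hz]
    refine (lift_eq_sum B (D' := c'.Q) _
      (c.Q_eq_sum c' hΩ (hVs hz).1 (hVs hz).2 j) f).trans ?_
    simp only [(hV z hz).2.1, Matrix.of_apply, AddSubmonoidClass.coe_finsetSum, Finset.sum_apply,
      Submodule.coe_smul, Pi.smul_apply, hc'.op_apply _ _ hz, smul_eq_mul]
    rfl
  -- The change of frame needs aᵀ b = 1, whereas the symplectic pairing gives a bᵀ = 1; for square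
  -- matrices these are equivalent by transposition and two-sidedness of inverses.
  · rw [← Matrix.transpose_inj, Matrix.transpose_mul, Matrix.transpose_transpose,
      Matrix.transpose_one, mul_eq_one_comm]
    ext j l
    simpa [Matrix.mul_apply, Matrix.one_apply] using c.sum_P_mul_Q c' hy hy' j l

end ChangeChart


/-! ### The lifted product -/

section Pullback

variable {E : Type*} [NormedAddCommGroup E] [NormedSpace ℝ E]
  {X : Type*} [TopologicalSpace X] [ChartedSpace E X] {n : ℕ} {Ω : DForm E X 2}
  {J K : ∀ x : X, Submodule ℂ (CTangent (E := E) x)}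
  {F : Type*} [NormedAddCommGroup F] [NormedSpace ℝ F]
  {Y : Type*} [TopologicalSpace Y] [ChartedSpace F Y] [MulAction Circle Y]
  {ħ : ℝ} (B : PrequantumBundle F Y ħ Ω)

theorem proj_surjective : Function.Surjective B.proj := fun x =>
  let ⟨_, s, _, _, hx, _, _, hs, _⟩ := B.isBundle.locally_trivial x
  ⟨s x, hs x hx⟩

/-- Composing with a smooth local section of the bundle recovers f locally from its pull-back. -/
theorem contMDiffOn_of_comp_proj {U : Set X} (hU : IsOpen U) {f : X → ℂ}
    (hf : ContMDiffOn 𝓘(ℝ, F) 𝓘(ℝ, ℂ) ∞ (f ∘ B.proj) (B.proj ⁻¹' U)) :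
    ContMDiffOn 𝓘(ℝ, E) 𝓘(ℝ, ℂ) ∞ f U := fun x hx => by
  obtain ⟨U', s, _, hU', hx', hs, _, hps, _⟩ := B.isBundle.locally_trivial x
  have hV : B.proj ⁻¹' U ∈ 𝓝 (s x) :=
    (hU.preimage B.isBundle.smooth_proj.continuous).mem_nhds (by simpa [hps x hx'] using hx)
  have h1 : ContMDiffAt 𝓘(ℝ, E) 𝓘(ℝ, ℂ) ∞ ((f ∘ B.proj) ∘ s) x :=
    (hf.contMDiffAt hV).comp x (hs.contMDiffAt (hU'.mem_nhds hx'))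
  refine (h1.congr_of_eventuallyEq ?_).contMDiffWithinAt
  filter_upwards [hU'.mem_nhds hx'] with x' hx'
  simp [hps x' hx']

/-- The pull-back of functions to `Y`. -/
def pull (U : Set X) : smoothOn E U →ₗ[ℂ] smoothOn F (B.proj ⁻¹' U) where
  toFun f := ⟨(f : X → ℂ) ∘ B.proj, contMDiffOn_comp_proj B f.2.1, fun _ hy => f.2.2 _ hy⟩
  map_add' _ _ := rfl
  map_smul' _ _ := rfl

theorem pull_apply {U : Set X} (f : smoothOn E U) (y : Y) :
    (pull B U f : Y → ℂ) y = (f : X → ℂ) (B.proj y) := rfl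

theorem pull_injective (U : Set X) : Function.Injective (pull B U) := fun f g h => by
  ext x
  obtain ⟨y, rfl⟩ := proj_surjective B x
  rw [← pull_apply, h, pull_apply]

/-- The frame `(∂_{p_j}, ∂_{q^j})` on `X`. -/
def baseFrame (c : DarbouxChart n Ω J K) : Fin n ⊕ Fin n → ∀ x : X, CTangent (E := E) x :=
  Sum.elim c.P c.Q

theorem frame_some (c : DarbouxChart n Ω J K) (a : Fin n ⊕ Fin n) :
    frame B c (some a) = B.lift (baseFrame c a) := by
  rcases a with a | a <;> rfl

variable [FiniteDimensional ℝ F] [IsManifold 𝓘(ℝ, F) ∞ Y] (c : DarbouxChart n Ω J K)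
  (hΩ : IsSymplectic Ω)

omit [IsManifold 𝓘(ℝ, F) ∞ Y] in
theorem lieD_frame_comp_proj (a : Fin n ⊕ Fin n) {f : X → ℂ}
    (hf : ContMDiffOn 𝓘(ℝ, E) 𝓘(ℝ, ℂ) ∞ f c.U) :
    Set.EqOn (lieD (frame B c (some a)) (f ∘ B.proj)) (lieD (baseFrame c a) f ∘ B.proj)
      (B.proj ⁻¹' c.U) := fun y hy => by
  rw [frame_some]
  exact lieD_lift_comp_proj B _
    ((hf.contMDiffAt (c.isOpen.mem_nhds hy)).mdifferentiableAt (by simp))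

-- Smoothness of the coordinate derivatives is obtained on Y, where the coframe calculus applies,
-- and descends along proj.
include B hΩ in
theorem contMDiffOn_lieD_baseFrame (a : Fin n ⊕ Fin n) (f : X → ℂ)
    (hf : ContMDiffOn 𝓘(ℝ, E) 𝓘(ℝ, ℂ) ∞ f c.U) :
    ContMDiffOn 𝓘(ℝ, E) 𝓘(ℝ, ℂ) ∞ (lieD (baseFrame c a) f) c.U :=
  contMDiffOn_of_comp_proj B c.isOpen
    (((isCoframe B c hΩ).contMDiffOn_lieD (some a) _ (contMDiffOn_comp_proj B hf)).congr
      (lieD_frame_comp_proj B c a hf).symm)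

/-- The coordinate derivatives on `X`. -/
def baseOp (a : Fin n ⊕ Fin n) : smoothOn E c.U →ₗ[ℂ] smoothOn E c.U :=
  lieOp c.isOpen (baseFrame c a) (contMDiffOn_lieD_baseFrame B c hΩ a)

theorem pull_baseOp (a : Fin n ⊕ Fin n) (f : smoothOn E c.U) :
    pull B c.U (baseOp B c hΩ a f) = (isCoframe B c hΩ).op (some a) (pull B c.U f) :=
  smoothOn_ext fun y hy => by
    rw [(isCoframe B c hΩ).op_apply _ _ hy, pull_apply]
    exact (lieOp_apply c.isOpen (baseFrame c a) _ f hy).trans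
      (lieD_frame_comp_proj B c a f.2.1 hy).symm

theorem op_none_pull (f : smoothOn E c.U) :
    (isCoframe B c hΩ).op none (pull B c.U f) = 0 :=
  op_none_comp_proj (isCoframe B c hΩ) c.isOpen subset_rfl f.2.1 fun _ _ => rfl

/-- After pulling back to Y, every possible commutator is a multiple of η, which annihilates
pull-backs. -/
theorem baseOp_comm (a b : Fin n ⊕ Fin n) (f : smoothOn E c.U) :
    baseOp B c hΩ a (baseOp B c hΩ b f) = baseOp B c hΩ b (baseOp B c hΩ a f) := by
  apply pull_injective B
  simp only [pull_baseOp]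
  rw [(isCoframe B c hΩ).op_comm, Fintype.sum_option, op_none_pull B c hΩ, smul_zero]
  simp [structureCoeff]

/-- The product of a function on `X` and a function on `Y`. -/
def mulPull (U : Set X) :
    smoothOn E U →ₗ[ℂ] smoothOn F (B.proj ⁻¹' U) →ₗ[ℂ] smoothOn F (B.proj ⁻¹' U) :=
  (mulS _).comp (pull B U)

/-- The lifted tensor applied to a function on `X` and a function on `Y`. -/
theorem nuLiftPow_comp_proj_eq {z : Y × Y} (h₁ : B.proj z.1 ∈ c.U) (h₂ : B.proj z.2 ∈ c.U)
    {β : smoothOn E c.U →ₗ[ℂ] smoothOn F (B.proj ⁻¹' c.U) →ₗ[ℂ] ℂ}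
    (hβ : ∀ f g, β f g = (f : X → ℂ) (B.proj z.1) * (g : Y → ℂ) z.2) (k : ℕ) {f g : Y → ℂ}
    {f' : smoothOn E c.U} {g' : smoothOn F (B.proj ⁻¹' c.U)}
    (hf : Set.EqOn f (f' ∘ B.proj) (B.proj ⁻¹' c.U)) (hg : Set.EqOn g g' (B.proj ⁻¹' c.U)) :
    nuLiftPow B c k f g z = biPow (fun j => baseOp B c hΩ (.inl j))
      (fun j => (isCoframe B c hΩ).op (some (.inr j))) β k f' g' := by
  refine tensorPow_eq_biPow (a := fun f : smoothOn E c.U => (f : X → ℂ) ∘ B.proj)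
    (b := fun f : smoothOn F (B.proj ⁻¹' c.U) => (f : Y → ℂ)) (V := B.proj ⁻¹' c.U)
    (fun j f f' hf z hz => ?_) (fun j _ _ hf => (isCoframe B c hΩ).op_eqOn (some (.inr j)) hf)
    h₁ h₂ hβ k hf hg
  have h2 := (isCoframe B c hΩ).op_eqOn (some (.inl j)) (f' := pull B c.U f') hf hz
  rw [← pull_baseOp B c hΩ] at h2
  exact h2

/-- The lifted product of a function on `X` and a function on `Y`, in a Darboux chart. -/
theorem nuLiftPow_eq_base {y : Y} (hy : B.proj y ∈ c.U) (k : ℕ) {f g : Y → ℂ}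
    {f' : smoothOn E c.U} {g' : smoothOn F (B.proj ⁻¹' c.U)}
    (hf : Set.EqOn f (f' ∘ B.proj) (B.proj ⁻¹' c.U)) (hg : Set.EqOn g g' (B.proj ⁻¹' c.U)) :
    (k.factorial : ℂ)⁻¹ * nuLiftPow B c k f g (y, y) =
      (biCoeff (fun j => baseOp B c hΩ (.inl j)) (fun j => (isCoframe B c hΩ).op (some (.inr j)))
        (mulPull B c.U) k f' g' : Y → ℂ) y := by
  have h1 := map_biPow (fun j => baseOp B c hΩ (.inl j))
    (fun j => (isCoframe B c hΩ).op (some (.inr j))) (mulPull B c.U)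
    (evalS F (B.proj ⁻¹' c.U) y) k f' g'
  rw [biCoeff_apply, Submodule.coe_smul, Pi.smul_apply, smul_eq_mul, ← evalS_apply, h1]
  congr 1
  exact nuLiftPow_comp_proj_eq B c hΩ (z := (y, y)) hy hy (fun _ _ => rfl) k hf hg

/-- The star product of functions on `X`, in a Darboux chart. -/
theorem nuPow_eq_base {x : X} (hx : x ∈ c.U) (k : ℕ) {f g : X → ℂ} {f' g' : smoothOn E c.U}
    (hf : Set.EqOn f f' c.U) (hg : Set.EqOn g g' c.U) :
    (k.factorial : ℂ)⁻¹ * nuPow c k f g (x, x) =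
      (biCoeff (fun j => baseOp B c hΩ (.inl j)) (fun j => baseOp B c hΩ (.inr j))
        (mulS c.U) k f' g' : X → ℂ) x := by
  have h1 := map_biPow (fun j => baseOp B c hΩ (.inl j))
    (fun j => baseOp B c hΩ (.inr j)) (mulS c.U) (evalS E c.U x) k f' g'
  rw [biCoeff_apply, Submodule.coe_smul, Pi.smul_apply, smul_eq_mul, ← evalS_apply, h1]
  congr 1
  exact tensorPow_eq_biPow (P := fun j => baseOp B c hΩ (.inl j))
    (Q := fun j => baseOp B c hΩ (.inr j)) (β := (mulS c.U).compr₂ (evalS E c.U x))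
    (a := fun f : smoothOn E c.U => (f : X → ℂ))
    (b := fun f : smoothOn E c.U => (f : X → ℂ)) (V := c.U)
    (fun j _ _ hf => lieOp_eqOn _ _ _ hf) (fun j _ _ hf => lieOp_eqOn _ _ _ hf)
    (z := (x, x)) hx hx (fun _ _ => rfl) k hf hg

/-- The star product on X is the restriction of the lifted product to pulled-back functions, because
lifted fields are related by proj to the fields on X. -/
theorem pull_biCoeff (k : ℕ) (f g : smoothOn E c.U) :
    pull B c.U (biCoeff (fun j => baseOp B c hΩ (.inl j)) (fun j => baseOp B c hΩ (.inr j))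
        (mulS c.U) k f g) =
      biCoeff (fun j => baseOp B c hΩ (.inl j))
        (fun j => (isCoframe B c hΩ).op (some (.inr j))) (mulPull B c.U) k f (pull B c.U g) := by
  simp only [biCoeff_apply, map_smul]
  congr 1
  induction k generalizing f g with
  | zero => rfl
  | succ k ih => simp only [biPow_succ, map_sum, ih, pull_baseOp]

end Pullback

/-! ### Equivariance as a differential equation along the orbits. -/

section Equivariance

variable {E : Type*} [NormedAddCommGroup E] [NormedSpace ℝ E]
  {X : Type*} [TopologicalSpace X] [ChartedSpace E X]
  {F : Type*} [NormedAddCommGroup F] [NormedSpace ℝ F]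
  {Y : Type*} [TopologicalSpace Y] [ChartedSpace F Y] [MulAction Circle Y]
  {proj : Y → X} (hB : IsCircleBundle E X F Y proj)
include hB

/-- The derivative at time t reduces to the one at time 0 by starting from exp t • y, through exp s
= exp (s - t) exp t. -/
theorem hasDerivAt_orbit {f : Y → ℂ} (hf : ContMDiff 𝓘(ℝ, F) 𝓘(ℝ, ℂ) ∞ f) (y : Y) (t : ℝ) :
    HasDerivAt (fun t : ℝ => f (Circle.exp t • y)) (lieD (E := F) genC f (Circle.exp t • y)) t := by
  have h1 : ∀ y, HasDerivAt (fun t : ℝ => f (Circle.exp t • y)) (lieD (E := F) genC f y) 0 := by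
    intro y
    have h2 : DifferentiableAt ℝ (fun t : ℝ => f (Circle.exp t • y)) 0 :=
      ((hf.comp (hB.contMDiff_orbit y)).mdifferentiable (by simp) 0).differentiableAt
    have h3 := hB.mfderiv_generator y (hf.mdifferentiable (by simp) y)
    rw [mfderiv_eq_fderiv] at h3
    have h3' : dR (E := F) f y (generator F Y y) =
      (fderiv ℝ (fun t : ℝ => f (Circle.exp t • y)) 0 : ℝ →L[ℝ] ℂ) 1 := h3
    rw [fderiv_apply_one_eq_deriv] at h3'
    have h4 : lieD (E := F) genC f y = deriv (fun t : ℝ => f (Circle.exp t • y)) 0 := by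
      rw [lieD, genC, dC_tmul, one_mul]
      exact h3'
    rw [h4]
    exact h2.hasDerivAt
  have h5 := h1 (Circle.exp t • y)
  have h6 : HasDerivAt (fun s : ℝ => f (Circle.exp (s - t) • Circle.exp t • y))
      (lieD (E := F) genC f (Circle.exp t • y)) t := by
    have h7 : HasDerivAt (fun t' : ℝ => f (Circle.exp t' • Circle.exp t • y))
      (lieD (E := F) genC f (Circle.exp t • y)) (t - t) := by rwa [sub_self]
    exact h7.comp_sub_const t t
  refine h6.congr_of_eventuallyEq (Filter.Eventually.of_forall fun s => ?_)
  simp only [smul_smul, ← Circle.exp_add, sub_add_cancel]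

theorem lieD_genC_of_mem {Ψ : Y → ℂ} (hΨ : Ψ ∈ waveFunctions F Y) (y : Y) :
    lieD (E := F) genC Ψ y = Complex.I * Ψ y := by
  have h1 := hasDerivAt_orbit hB hΨ.1 y 0
  have h2 : HasDerivAt (fun t : ℝ => Complex.exp (t * Complex.I) * Ψ y)
      (Complex.I * Ψ y) 0 := by
    have h3 : HasDerivAt (fun t : ℝ => Complex.exp (t * Complex.I))
        (Complex.exp ((0 : ℝ) * Complex.I) * (1 * Complex.I)) 0 :=
      (Complex.ofRealCLM.hasDerivAt.mul_const _).cexp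
    simpa using h3.mul_const (Ψ y)
  have h4 : (fun t : ℝ => Ψ (Circle.exp t • y)) = fun t : ℝ => Complex.exp (t * Complex.I) * Ψ y := by
    ext t; rw [hΨ.2, Circle.coe_exp]
  rw [h4] at h1
  simpa using h1.unique h2

/-- The function t ↦ e^{-it} Ψ(e^{it} • y) has zero derivative, hence is constant, and every element
of the circle is some e^{it}. Equivariance can thus be verified with the derivation calculus. -/
theorem mem_waveFunctions_of_lieD {Ψ : Y → ℂ} (hΨ : ContMDiff 𝓘(ℝ, F) 𝓘(ℝ, ℂ) ∞ Ψ)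
    (h : ∀ y, lieD (E := F) genC Ψ y = Complex.I * Ψ y) : Ψ ∈ waveFunctions F Y := by
  refine ⟨hΨ, fun u y => ?_⟩
  obtain ⟨t, rfl⟩ := Circle.exp_surjective u
  have h1 : ∀ t : ℝ, HasDerivAt (fun t : ℝ => Complex.exp (t * -Complex.I) *
      Ψ (Circle.exp t • y)) 0 t := fun t => by
    have h3 : HasDerivAt (fun t : ℝ => Complex.exp (t * -Complex.I))
        (Complex.exp (t * -Complex.I) * (1 * -Complex.I)) t :=
      (Complex.ofRealCLM.hasDerivAt.mul_const _).cexp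
    refine (h3.mul (hasDerivAt_orbit hB hΨ y t)).congr_deriv ?_
    rw [h]
    ring
  have h2 := is_const_of_deriv_eq_zero (fun t => (h1 t).differentiableAt)
    (fun t => (h1 t).deriv) t 0
  simp only [Circle.exp_zero, one_smul, Complex.ofReal_zero, zero_mul, Complex.exp_zero,
    one_mul] at h2
  rw [← h2, Circle.coe_exp, ← mul_assoc, ← Complex.exp_add]
  simp

end Equivariance

/-! ### The coefficients C_k: chart independence, equivariance, associativity. -/

section LiftCoeff

variable {E : Type*} [NormedAddCommGroup E] [NormedSpace ℝ E]
  {X : Type*} [TopologicalSpace X] [ChartedSpace E X] {n : ℕ}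
  {F : Type*} [NormedAddCommGroup F] [NormedSpace ℝ F]
  {Y : Type*} [TopologicalSpace Y] [ChartedSpace F Y] [MulAction Circle Y]
  {ħ : ℝ} (S : FlatBiPolarized E X n) (B : PrequantumBundle F Y ħ S.Ω)

theorem mem_chart (x : X) : x ∈ (chart S x).U := (S.flat x).choose_spec

variable [FiniteDimensional ℝ F] [IsManifold 𝓘(ℝ, F) ∞ Y]

theorem nuLiftPow_diag_eq {f g : Y → ℂ} (hf : ContMDiff 𝓘(ℝ, F) 𝓘(ℝ, ℂ) ∞ f)
    (hg : ContMDiff 𝓘(ℝ, F) 𝓘(ℝ, ℂ) ∞ g) (k : ℕ) (c c' : DarbouxChart n S.Ω S.J S.K) {y : Y}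
    (hy : B.proj y ∈ c.U) (hy' : B.proj y ∈ c'.U) :
    nuLiftPow B c k f g (y, y) = nuLiftPow B c' k f g (y, y) := by
  obtain ⟨V, _, hyV, _, h⟩ := exists_nuLiftPow_eq B c c' S.symplectic hy hy'
  exact h f g hf.contMDiffOn hg.contMDiffOn (y, y) hyV hyV k

theorem liftCoeff_eq {f g : Y → ℂ} (hf : ContMDiff 𝓘(ℝ, F) 𝓘(ℝ, ℂ) ∞ f)
    (hg : ContMDiff 𝓘(ℝ, F) 𝓘(ℝ, ℂ) ∞ g) (k : ℕ) (c : DarbouxChart n S.Ω S.J S.K) {y : Y}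
    (hy : B.proj y ∈ c.U) :
    (k.factorial : ℂ)⁻¹ * nuLiftPow B c k f g (y, y) = liftCoeff S B k f g y := by
  rw [liftCoeff, nuLiftPow_diag_eq S B hf hg k c _ hy (mem_chart S _)]

theorem nuLiftPow_diag_eq_biPow (c : DarbouxChart n S.Ω S.J S.K) {y : Y} (hy : B.proj y ∈ c.U)
    (k : ℕ) {f g : Y → ℂ} {f' g' : smoothOn F (B.proj ⁻¹' c.U)}
    (hf : Set.EqOn f f' (B.proj ⁻¹' c.U)) (hg : Set.EqOn g g' (B.proj ⁻¹' c.U)) :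
    (k.factorial : ℂ)⁻¹ * nuLiftPow B c k f g (y, y) =
      (biCoeff (fun j => (isCoframe B c S.symplectic).op (some (.inl j)))
        (fun j => (isCoframe B c S.symplectic).op (some (.inr j)))
        (mulS (B.proj ⁻¹' c.U)) k f' g' : Y → ℂ) y := by
  have h1 := map_biPow (fun j => (isCoframe B c S.symplectic).op (some (.inl j)))
    (fun j => (isCoframe B c S.symplectic).op (some (.inr j))) (mulS (B.proj ⁻¹' c.U))
    (evalS F (B.proj ⁻¹' c.U) y) k f' g'
  rw [biCoeff_apply, Submodule.coe_smul, Pi.smul_apply, smul_eq_mul, ← evalS_apply, h1]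
  congr 1
  exact nuLiftPow_eq (isCoframe B c S.symplectic) (z := (y, y)) hy hy (fun _ _ => rfl) k hf hg

/-- `liftCoeff` picks a chart separately at each point; by chart independence a single expression
represents it over a whole chart domain, so it can be differentiated there. -/
theorem liftCoeff_eqOn (c : DarbouxChart n S.Ω S.J S.K) {f g : Y → ℂ}
    (hf : ContMDiff 𝓘(ℝ, F) 𝓘(ℝ, ℂ) ∞ f) (hg : ContMDiff 𝓘(ℝ, F) 𝓘(ℝ, ℂ) ∞ g) (k : ℕ) :
    Set.EqOn (liftCoeff S B k f g)
      (biCoeff (fun j => (isCoframe B c S.symplectic).op (some (.inl j)))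
        (fun j => (isCoframe B c S.symplectic).op (some (.inr j)))
        (mulS (B.proj ⁻¹' c.U)) k (res f hf.contMDiffOn) (res g hg.contMDiffOn) : Y → ℂ)
      (B.proj ⁻¹' c.U) := fun y hy => by
  rw [← liftCoeff_eq S B hf hg k c hy]
  exact nuLiftPow_diag_eq_biPow S B c hy k (res_eqOn _ _) (res_eqOn _ _)

theorem contMDiff_liftCoeff {f g : Y → ℂ}
    (hf : ContMDiff 𝓘(ℝ, F) 𝓘(ℝ, ℂ) ∞ f) (hg : ContMDiff 𝓘(ℝ, F) 𝓘(ℝ, ℂ) ∞ g) (k : ℕ) :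
    ContMDiff 𝓘(ℝ, F) 𝓘(ℝ, ℂ) ∞ (liftCoeff S B k f g) := fun y => by
  have h1 := (smoothOn F _).coe_mem (biCoeff
    (fun j => (isCoframe B (chart S (B.proj y)) S.symplectic).op (some (.inl j)))
    (fun j => (isCoframe B (chart S (B.proj y)) S.symplectic).op (some (.inr j)))
    (mulS (B.proj ⁻¹' (chart S (B.proj y)).U)) k (res f hf.contMDiffOn) (res g hg.contMDiffOn))
  exact (h1.1.congr (liftCoeff_eqOn S B (chart S (B.proj y)) hf hg k)).contMDiffAt
    ((isCoframe B (chart S (B.proj y)) S.symplectic).isOpen.mem_nhds (mem_chart S _))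

omit [FiniteDimensional ℝ F] [IsManifold 𝓘(ℝ, F) ∞ Y] in
theorem contMDiff_comp_proj {H : X → ℂ} (hH : ContMDiff 𝓘(ℝ, E) 𝓘(ℝ, ℂ) ∞ H) :
    ContMDiff 𝓘(ℝ, F) 𝓘(ℝ, ℂ) ∞ (H ∘ B.proj) :=
  hH.comp B.isBundle.smooth_proj

/-- At each point both sides use the same chosen chart. The identity transfers chart independence
from the lifted product to the star product. -/
theorem starCoeff_comp_proj {H₁ H₂ : X → ℂ} (h₁ : ContMDiff 𝓘(ℝ, E) 𝓘(ℝ, ℂ) ∞ H₁)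
    (h₂ : ContMDiff 𝓘(ℝ, E) 𝓘(ℝ, ℂ) ∞ H₂) (k : ℕ) :
    starCoeff S k H₁ H₂ ∘ B.proj = liftCoeff S B k (H₁ ∘ B.proj) (H₂ ∘ B.proj) := by
  ext y
  set c := chart S (B.proj y) with hc
  have hy : B.proj y ∈ c.U := mem_chart S _
  have e₁ := res_eqOn H₁ (h₁.contMDiffOn (s := c.U))
  have e₂ := res_eqOn H₂ (h₂.contMDiffOn (s := c.U))
  have h3 : ((k.factorial : ℂ)⁻¹ * nuLiftPow B c k (H₁ ∘ B.proj) (H₂ ∘ B.proj) (y, y)) = _ :=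
    nuLiftPow_eq_base B c S.symplectic hy k (fun y hy => e₁ hy)
      (g' := pull B c.U (res H₂ h₂.contMDiffOn)) (fun y hy => e₂ hy)
  rw [← pull_biCoeff, pull_apply] at h3
  rw [liftCoeff, ← hc, h3]
  exact nuPow_eq_base B c S.symplectic hy k e₁ e₂

/-- Over one chart this is `biCoeff_assoc`, with the algebra of smooth functions on the chart domain
in X and its module of smooth functions on the preimage in Y. -/
theorem liftCoeff_assoc {H₁ H₂ : X → ℂ} {h : Y → ℂ} (h₁ : ContMDiff 𝓘(ℝ, E) 𝓘(ℝ, ℂ) ∞ H₁)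
    (h₂ : ContMDiff 𝓘(ℝ, E) 𝓘(ℝ, ℂ) ∞ H₂) (hh : ContMDiff 𝓘(ℝ, F) 𝓘(ℝ, ℂ) ∞ h) (N : ℕ) :
    ∑ ab ∈ Finset.HasAntidiagonal.antidiagonal N,
        liftCoeff S B ab.1 (starCoeff S ab.2 H₁ H₂ ∘ B.proj) h =
      ∑ ab ∈ Finset.HasAntidiagonal.antidiagonal N,
        liftCoeff S B ab.1 (H₁ ∘ B.proj) (liftCoeff S B ab.2 (H₂ ∘ B.proj) h) := by
  ext y
  set c := chart S (B.proj y) with hc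
  have hy : B.proj y ∈ c.U := mem_chart S _
  have e₁ := res_eqOn H₁ (h₁.contMDiffOn (s := c.U))
  have e₂ := res_eqOn H₂ (h₂.contMDiffOn (s := c.U))
  have eh := res_eqOn h (hh.contMDiffOn (s := B.proj ⁻¹' c.U))
  have key := biCoeff_assoc (fun j => baseOp B c S.symplectic (.inl j))
    (fun j => baseOp B c S.symplectic (.inr j))
    (fun j => (isCoframe B c S.symplectic).op (some (.inr j))) (mulS c.U) (mulPull B c.U)
    (fun f g h => by ext z; exact mul_assoc _ _ _)
    (fun j f g => lieOp_mulS _ _ _ f g)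
    (fun j f g => by
      simp only [mulPull, LinearMap.comp_apply, IsCoframe.op_mulS, pull_baseOp])
    (fun i j f => baseOp_comm B c S.symplectic _ _ f)
    (fun i j f => baseOp_comm B c S.symplectic _ _ f)
    (fun i j f => op_Q_comm _ f i j) N (res H₁ h₁.contMDiffOn) (res H₂ h₂.contMDiffOn)
    (res h hh.contMDiffOn)
  have key' := congrArg (fun f : smoothOn F (B.proj ⁻¹' c.U) => (f : Y → ℂ) y) key
  simp only [AddSubmonoidClass.coe_finsetSum, Finset.sum_apply] at key' ⊢
  convert key' using 2 with ab hab ab hab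
  -- The inner star product at a nearby point is defined through the chart chosen there. Passing to
  -- the lifted product, whose chart independence is known, rewrites it in the fixed chart c.
  · refine nuLiftPow_eq_base B c S.symplectic hy ab.1 (fun z hz => ?_) eh
    have hz' := starCoeff_comp_proj S B h₁ h₂ ab.2
    rw [hz', ← liftCoeff_eq S B (contMDiff_comp_proj S B h₁) (contMDiff_comp_proj S B h₂) ab.2 c hz,
      nuLiftPow_eq_base B c S.symplectic hz ab.2 (f := H₁ ∘ B.proj) (g := H₂ ∘ B.proj)
        (fun y hy => e₁ hy)
        (g' := pull B c.U (res H₂ h₂.contMDiffOn)) (fun y hy => e₂ hy), ← pull_biCoeff, pull_apply]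
    rfl
  · refine nuLiftPow_eq_base B c S.symplectic hy ab.1 (fun z hz => e₁ hz) (fun z hz => ?_)
    rw [← liftCoeff_eq S B (contMDiff_comp_proj S B h₂) hh ab.2 c hz]
    exact nuLiftPow_eq_base B c S.symplectic hz ab.2 (fun y hy => e₂ hy) eh

/-- Since η commutes with the frame and annihilates H ∘ proj, it acts on C_k(H, Ψ) through Ψ alone,
and there as multiplication by i. -/
theorem liftCoeff_mem_waveFunctions {H : X → ℂ} (hH : ContMDiff 𝓘(ℝ, E) 𝓘(ℝ, ℂ) ∞ H) {Ψ : Y → ℂ}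
    (hΨ : Ψ ∈ waveFunctions F Y) (k : ℕ) :
    liftCoeff S B k (H ∘ B.proj) Ψ ∈ waveFunctions F Y := by
  have hf := contMDiff_comp_proj S B hH
  refine mem_waveFunctions_of_lieD B.isBundle (contMDiff_liftCoeff S B hf hΨ.1 k) fun y => ?_
  set c := chart S (B.proj y)
  have hy : y ∈ B.proj ⁻¹' c.U := mem_chart S _
  have h := isCoframe B c S.symplectic
  have h1 := liftCoeff_eqOn S B c hf hΨ.1 k
  have h2 : h.op none (res Ψ hΨ.1.contMDiffOn) = Complex.I • res Ψ hΨ.1.contMDiffOn :=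
    smoothOn_ext fun z hz => by
      rw [← h.op_eqOn none (res_eqOn _ _) hz, Submodule.coe_smul, Pi.smul_apply,
        ← res_eqOn _ _ hz]
      exact lieD_genC_of_mem B.isBundle hΨ z
  have h3 : h.op none (res (H ∘ B.proj) hf.contMDiffOn) = 0 :=
    op_none_comp_proj h c.isOpen subset_rfl hH.contMDiffOn (res_eqOn _ _)
  have h4 := biCoeff_derivation (fun j => h.op (some (.inl j))) (fun j => h.op (some (.inr j)))
    (mulS (B.proj ⁻¹' c.U)) (h.op_mulS none) (fun j f => op_none_comm h f _)
    (fun j f => op_none_comm h f _) k (res (H ∘ B.proj) hf.contMDiffOn) (res Ψ hΨ.1.contMDiffOn)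
  have h5 := h.op_eqOn none h1 hy
  rw [h4, h2, h3, map_zero, LinearMap.zero_apply, zero_add, map_smul, Submodule.coe_smul,
    Pi.smul_apply, ← h1 hy] at h5
  exact h5

end LiftCoeff


/-! ### Convergence in the smooth topology -/

section SmoothTendsto

variable {G H M : Type*} [NormedAddCommGroup G] [NormedSpace ℝ G] [TopologicalSpace H]
  {I : ModelWithCorners ℝ G H} [TopologicalSpace M] [ChartedSpace H M]
  {f f' : ℕ → M → ℂ} {g g' : M → ℂ} {W : Set M}

theorem SmoothTendstoOn.mono (h : SmoothTendstoOn I f g W) {W' : Set M} (hW : W' ⊆ W) :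
    SmoothTendstoOn I f g W' :=
  ⟨h.1.mono hW, fun m z₀ => (h.2 m z₀).mono
    (Set.inter_subset_inter_right _ (Set.preimage_mono hW))⟩

theorem SmoothTendstoOn.tendsto (h : SmoothTendstoOn I f g W) {z : M} (hz : z ∈ W) :
    Filter.Tendsto (fun N => f N z) Filter.atTop (𝓝 (g z)) := by
  have hz' : (extChartAt I z).symm (extChartAt I z z) = z :=
    (extChartAt I z).left_inv (mem_extChartAt_source z)
  have h1 := (h.2 0 z).tendsto_at (a := extChartAt I z z)
    ⟨mem_extChartAt_target z, by rwa [Set.mem_preimage, hz']⟩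
  have h2 := ((ContinuousMultilinearMap.apply ℝ (fun _ : Fin 0 => G) ℂ 0).continuous.tendsto
    _).comp h1
  simpa [Function.comp_def, hz'] using h2

variable [I.Boundaryless]

theorem mfderiv_eq_fderiv_extChart {f : M → ℂ} {z : M} (hf : MDifferentiableAt I 𝓘(ℝ, ℂ) f z) :
    (mfderiv I 𝓘(ℝ, ℂ) f z : G →L[ℝ] ℂ) =
      fderiv ℝ (f ∘ (extChartAt I z).symm) (extChartAt I z z) := by
  refine hf.mfderiv.trans ?_
  rw [ModelWithCorners.range_eq_univ, fderivWithin_univ]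
  rfl

theorem SmoothTendstoOn.tendsto_mfderiv (h : SmoothTendstoOn I f g W) {z : M} (hz : z ∈ W)
    (hf : ∀ N, MDifferentiableAt I 𝓘(ℝ, ℂ) (f N) z) (hg : MDifferentiableAt I 𝓘(ℝ, ℂ) g z)
    (v : G) :
    Filter.Tendsto (fun N => ((mfderiv I 𝓘(ℝ, ℂ) (f N) z : G →L[ℝ] ℂ) v : ℂ)) Filter.atTop
      (𝓝 ((mfderiv I 𝓘(ℝ, ℂ) g z : G →L[ℝ] ℂ) v)) := by
  have hz' : (extChartAt I z).symm (extChartAt I z z) = z :=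
    (extChartAt I z).left_inv (mem_extChartAt_source z)
  have h1 := (h.2 1 z).tendsto_at (a := extChartAt I z z)
    ⟨mem_extChartAt_target z, by rwa [Set.mem_preimage, hz']⟩
  have h2 := ((ContinuousMultilinearMap.apply ℝ (fun _ : Fin 1 => G) ℂ
    (fun _ => v)).continuous.tendsto _).comp h1
  simp only [mfderiv_eq_fderiv_extChart hg, fun N => mfderiv_eq_fderiv_extChart (hf N)]
  simp only [Function.comp_def, ContinuousMultilinearMap.apply_apply,
    iteratedFDeriv_one_apply] at h2
  exact h2

theorem SmoothTendstoOn.of_eventually_eqOn (hW : IsOpen W) (hg : ContMDiffOn I 𝓘(ℝ, ℂ) ∞ g W)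
    (h : ∀ᶠ N in Filter.atTop, Set.EqOn (f N) g W) : SmoothTendstoOn I f g W := by
  refine ⟨hg, fun m z₀ => ?_⟩
  have hO : IsOpen ((extChartAt I z₀).target ∩ (extChartAt I z₀).symm ⁻¹' W) :=
    (continuousOn_extChartAt_symm z₀).isOpen_inter_preimage (isOpen_extChartAt_target z₀) hW
  refine TendstoUniformlyOn.tendstoLocallyUniformlyOn fun u hu => ?_
  filter_upwards [h] with N hN z hz
  have h1 : f N ∘ (extChartAt I z₀).symm =ᶠ[𝓝 z] g ∘ (extChartAt I z₀).symm :=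
    Filter.eventuallyEq_of_mem (hO.mem_nhds hz) fun z' hz' => hN hz'.2
  rw [(h1.iteratedFDeriv ℝ m).eq_of_nhds]
  exact refl_mem_uniformity hu

variable [IsManifold I ∞ M]

theorem contDiffAt_comp_extChart_symm {f : M → ℂ} {z₀ : M} (hW : IsOpen W)
    (hf : ContMDiffOn I 𝓘(ℝ, ℂ) ∞ f W) {z : G}
    (hz : z ∈ (extChartAt I z₀).target ∩ (extChartAt I z₀).symm ⁻¹' W) :
    ContDiffAt ℝ ∞ (f ∘ (extChartAt I z₀).symm) z :=
  ((hf.contMDiffAt (hW.mem_nhds hz.2)).comp z ((contMDiffOn_extChartAt_symm z₀).contMDiffAt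
    ((isOpen_extChartAt_target z₀).mem_nhds hz.1))).contDiffAt

/-- Linear combinations of convergent sequences; the sequence need only be given on `W`. -/
theorem SmoothTendstoOn.smul_add (hW : IsOpen W) (h : SmoothTendstoOn I f g W)
    (h' : SmoothTendstoOn I f' g' W) (hf : ∀ N, ContMDiffOn I 𝓘(ℝ, ℂ) ∞ (f N) W)
    (hf' : ∀ N, ContMDiffOn I 𝓘(ℝ, ℂ) ∞ (f' N) W) (a : ℂ) {f'' : ℕ → M → ℂ}
    (hf'' : ∀ N, Set.EqOn (f'' N) (a • f N + f' N) W) :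
    SmoothTendstoOn I f'' (a • g + g') W := by
  refine ⟨((contDiff_const_smul (𝕜 := ℝ) (n := ∞) (F := ℂ) a).contMDiff.comp_contMDiffOn h.1).add
    h'.1, fun m z₀ => ?_⟩
  have hO : IsOpen ((extChartAt I z₀).target ∩ (extChartAt I z₀).symm ⁻¹' W) :=
    (continuousOn_extChartAt_symm z₀).isOpen_inter_preimage (isOpen_extChartAt_target z₀) hW
  have key : ∀ {f g : M → ℂ}, ContMDiffOn I 𝓘(ℝ, ℂ) ∞ f W → ContMDiffOn I 𝓘(ℝ, ℂ) ∞ g W →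
      ∀ z ∈ (extChartAt I z₀).target ∩ (extChartAt I z₀).symm ⁻¹' W,
      iteratedFDeriv ℝ m ((a • f + g) ∘ (extChartAt I z₀).symm) z =
        a • iteratedFDeriv ℝ m (f ∘ (extChartAt I z₀).symm) z +
          iteratedFDeriv ℝ m (g ∘ (extChartAt I z₀).symm) z := fun {f g} hf hg z hz => by
    have h1 := (contDiffAt_comp_extChart_symm hW hf hz).of_le (m := m) (by exact_mod_cast le_top)
    have h2 := (contDiffAt_comp_extChart_symm hW hg hz).of_le (m := m) (by exact_mod_cast le_top)
    have h3 : (a • f + g) ∘ (extChartAt I z₀).symm =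
      a • (f ∘ (extChartAt I z₀).symm) + g ∘ (extChartAt I z₀).symm := rfl
    have h4 : ContDiffAt ℝ m (a • (f ∘ (extChartAt I z₀).symm)) z := h1.const_smul a
    rw [h3, iteratedFDeriv_add_apply h4 h2, iteratedFDeriv_const_smul_apply h1]
  have h1 := (((uniformContinuous_const_smul a).comp_tendstoLocallyUniformlyOn (h.2 m z₀)).add
    (h'.2 m z₀))
  refine (h1.congr fun N z hz => ?_).congr_right fun z hz => (key h.1 h'.1 z hz).symm
  have h2 : f'' N ∘ (extChartAt I z₀).symm =ᶠ[𝓝 z] (a • f N + f' N) ∘ (extChartAt I z₀).symm :=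
    Filter.eventuallyEq_of_mem (hO.mem_nhds hz) fun z' hz' => hf'' N hz'.2
  rw [(h2.iteratedFDeriv ℝ m).eq_of_nhds, key (hf N) (hf' N) z hz]
  rfl

-- First-order convergence transported along a map s. It is applied on Y × Y to the diagonal y' ↦
-- (y', y') and to the slice y' ↦ (y', y).
omit [IsManifold I ∞ M] in
theorem SmoothTendstoOn.tendsto_dC (hW : IsOpen W) (h : SmoothTendstoOn I f g W)
    (hf : ∀ N, ContMDiffOn I 𝓘(ℝ, ℂ) ∞ (f N) W) {F Y : Type*} [NormedAddCommGroup F]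
    [NormedSpace ℝ F] [TopologicalSpace Y] [ChartedSpace F Y] {s : Y → M} {y : Y}
    (hs : MDifferentiableAt 𝓘(ℝ, F) I s y) (hy : s y ∈ W) (ζ : CTangent (E := F) y) :
    Filter.Tendsto (fun N => dC (f N ∘ s) y ζ) Filter.atTop (𝓝 (dC (g ∘ s) y ζ)) := by
  have hd : ∀ {f : M → ℂ}, ContMDiffOn I 𝓘(ℝ, ℂ) ∞ f W → MDifferentiableAt I 𝓘(ℝ, ℂ) f (s y) :=
    fun hf => (hf.contMDiffAt (hW.mem_nhds hy)).mdifferentiableAt (by simp)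
  have hc : ∀ {f : M → ℂ}, ContMDiffOn I 𝓘(ℝ, ℂ) ∞ f W → ∀ v : TangentSpace 𝓘(ℝ, F) y,
      dR (E := F) (f ∘ s) y v =
        (mfderiv I 𝓘(ℝ, ℂ) f (s y) : G →L[ℝ] ℂ) (mfderiv 𝓘(ℝ, F) I s y v) := fun hf v => by
    rw [dR, ((hd hf).hasMFDerivAt.comp y hs.hasMFDerivAt).mfderiv]
    rfl
  induction ζ using TensorProduct.induction_on with
  | zero => simp
  | tmul a v =>
    simp only [dC_tmul, hc h.1, fun N => hc (hf N)]
    exact (h.tendsto_mfderiv hy (fun N => hd (hf N)) (hd h.1) _).const_mul a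
  | add ζ ζ' h₁ h₂ => simpa only [map_add] using h₁.add h₂

end SmoothTendsto

/-! ### Partial sums of the exponential -/

section ExpBi

variable {A M Z Z' : Type*} [AddCommGroup A] [Module ℂ A] [AddCommGroup M] [Module ℂ M]
  [AddCommGroup Z] [Module ℂ Z] [AddCommGroup Z'] [Module ℂ Z'] {n : ℕ}
  (P : Fin n → A →ₗ[ℂ] A) (Q : Fin n → M →ₗ[ℂ] M) (β : A →ₗ[ℂ] M →ₗ[ℂ] Z) (c : ℂ)

/-- The partial sums of `β ∘ exp (c ∑ P j ⊗ Q j)`. -/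
def expBi (N : ℕ) : A →ₗ[ℂ] M →ₗ[ℂ] Z :=
  ∑ k ∈ Finset.range N, c ^ k • biCoeff P Q β k

theorem expBi_apply (N : ℕ) (f : A) (g : M) :
    expBi P Q β c N f g = ∑ k ∈ Finset.range N, c ^ k • biCoeff P Q β k f g := by
  simp [expBi, LinearMap.sum_apply]

theorem map_expBi (L : Z →ₗ[ℂ] Z') (N : ℕ) (f : A) (g : M) :
    L (expBi P Q β c N f g) = expBi P Q (β.compr₂ L) c N f g := by
  simp only [expBi_apply, biCoeff_apply, map_sum, map_smul, map_biPow]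

variable {P Q β}

/-- A derivation which annihilates `g` and is canonically conjugate to `Q i` telescopes. -/
theorem expBi_telescope {R : Z →ₗ[ℂ] Z} {RM S : M →ₗ[ℂ] M} (κ s : ℂ) (i : Fin n)
    (hβ : ∀ f g, R (β f g) = β (P i f) g + β f (RM g))
    (hM : ∀ j g, RM (Q j g) = Q j (RM g) + (if i = j then κ else 0) • S g)
    (hP : ∀ j f, P i (P j f) = P j (P i f)) (hS : ∀ j g, S (Q j g) = Q j (S g)) {g : M}
    (hg : RM g = 0) (hSg : S g = s • g) (hc : c * κ * s = -1) (N : ℕ) (f : A) :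
    R (expBi P Q β c (N + 1) f g) = expBi P Q β c (N + 1) (P i f) g - expBi P Q β c N (P i f) g := by
  have h1 : ∀ N, expBi P Q β c (N + 1) (P i f) g - expBi P Q β c N (P i f) g =
      c ^ N • biCoeff P Q β N (P i f) g := fun N => by
    rw [expBi_apply, expBi_apply, Finset.sum_range_succ, add_sub_cancel_left]
  rw [h1]
  induction N with
  | zero =>
    simp [expBi_apply, biCoeff_apply, hβ, hg]
  | succ N ih =>
    -- The commutator contributes κ s times the previous coefficient at (P_i f, g). After
    -- multiplication by c ^ (N + 1), the condition c κ s = -1 makes it cancel what remained from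
    -- order N.
    have h2 : R (biCoeff P Q β (N + 1) f g) =
        biCoeff P Q β (N + 1) (P i f) g + (κ * s) • biCoeff P Q β N (P i f) g := by
      rw [biCoeff_apply, map_smul, biPow_leibniz P Q β κ i hβ hP hM hP hS, hg, hSg, map_zero, add_zero,
        map_smul, smul_add, biCoeff_apply, biCoeff_apply, Nat.add_sub_cancel, smul_smul, smul_smul,
        smul_smul, Nat.factorial_succ]
      congr 2
      have h3 : ((N + 1 : ℕ) : ℂ) ≠ 0 := by exact_mod_cast N.succ_ne_zero
      have h4 : (N.factorial : ℂ) ≠ 0 := by exact_mod_cast N.factorial_ne_zero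
      push_cast at h3 ⊢
      field_simp
    rw [expBi_apply, Finset.sum_range_succ, ← expBi_apply, map_add, ih, map_smul, h2, smul_add,
      smul_smul, add_comm, add_assoc, ← add_smul]
    have h5 : c ^ (N + 1) * (κ * s) + c ^ N = 0 := by
      linear_combination c ^ N * hc
    rw [h5, zero_smul, add_zero]

/-- The case in which R sees only the first factor; it is applied with the second point frozen,
where no commutator with the Q_j arises. -/
theorem expBi_derivation {R : Z →ₗ[ℂ] Z} {RA : A →ₗ[ℂ] A} (hβ : ∀ f g, R (β f g) = β (RA f) g)
    (hA : ∀ j f, RA (P j f) = P j (RA f)) (N : ℕ) (f : A) (g : M) :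
    R (expBi P Q β c N f g) = expBi P Q β c N (RA f) g := by
  simp only [expBi_apply, map_sum, map_smul]
  refine Finset.sum_congr rfl fun k _ => ?_
  rw [biCoeff_derivation (RM := 0) P Q β (fun f g => by simp [hβ]) hA (by simp)]
  simp

/-- If the operators `P` are nilpotent on `f`, so is `∑ P j ⊗ Q j`. -/
theorem biPow_eq_zero {d k : ℕ} (hd : d ≤ k) {f : A}
    (hf : ∀ l : List (Fin n), l.length = d → l.foldr (fun j f => P j f) f = 0) (g : M) :
    biPow P Q β k f g = 0 := by
  induction d generalizing k f g with
  | zero =>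
    have h1 : f = 0 := hf [] rfl
    rw [h1, map_zero, LinearMap.zero_apply]
  | succ d ih =>
    obtain ⟨k, rfl⟩ : ∃ k', k = k' + 1 := ⟨k - 1, by omega⟩
    rw [biPow_succ]
    refine Finset.sum_eq_zero fun j _ => ih (by omega) (fun l hl => ?_) _
    -- The new operator acts first on f, hence stands last in the list folded from the right.
    have h1 := hf (l ++ [j]) (by simp [hl])
    rwa [List.foldr_append] at h1

end ExpBi


/-! ### The normal product -/

section ExpSum

variable {E : Type*} [NormedAddCommGroup E] [NormedSpace ℝ E]
  {X : Type*} [TopologicalSpace X] [ChartedSpace E X] {n : ℕ} {Ω : DForm E X 2}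
  {J K : ∀ x : X, Submodule ℂ (CTangent (E := E) x)}
  {F : Type*} [NormedAddCommGroup F] [NormedSpace ℝ F] [FiniteDimensional ℝ F]
  {Y : Type*} [TopologicalSpace Y] [ChartedSpace F Y] [IsManifold 𝓘(ℝ, F) ∞ Y] [MulAction Circle Y]
  {ħ : ℝ} {B : PrequantumBundle F Y ħ Ω} {c : DarbouxChart n Ω J K}

omit [FiniteDimensional ℝ F] in
theorem expSum_eq_expBi {V : Set Y}
    (h : IsCoframe V (coframe B c) (frame B c) (structureCoeff n ħ)) {z : Y × Y}
    (h₁ : z.1 ∈ V) (h₂ : z.2 ∈ V) {β : smoothOn F V →ₗ[ℂ] smoothOn F V →ₗ[ℂ] ℂ}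
    (hβ : ∀ f g, β f g = (f : Y → ℂ) z.1 * (g : Y → ℂ) z.2) (N : ℕ) {f g : Y → ℂ}
    {f' g' : smoothOn F V} (hf : Set.EqOn f f' V) (hg : Set.EqOn g g' V) :
    expSum B c f g N z = expBi (fun j => h.op (some (.inl j))) (fun j => h.op (some (.inr j))) β
      ((ħ : ℂ) / Complex.I) N f' g' := by
  rw [expSum, expBi_apply]
  refine Finset.sum_congr rfl fun k _ => ?_
  rw [nuLiftPow_eq h h₁ h₂ hβ k hf hg, biCoeff_apply, smul_eq_mul, smul_eq_mul]
  ring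

theorem contMDiffOn_nuLiftPow (hΩ : IsSymplectic Ω) (k : ℕ) {f g : Y → ℂ}
    (hf : ContMDiffOn 𝓘(ℝ, F) 𝓘(ℝ, ℂ) ∞ f (B.proj ⁻¹' c.U))
    (hg : ContMDiffOn 𝓘(ℝ, F) 𝓘(ℝ, ℂ) ∞ g (B.proj ⁻¹' c.U)) :
    ContMDiffOn (𝓘(ℝ, F).prod 𝓘(ℝ, F)) 𝓘(ℝ, ℂ) ∞ (nuLiftPow B c k f g)
      {z | B.proj z.1 ∈ c.U ∧ B.proj z.2 ∈ c.U} := by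
  induction k generalizing f g with
  | zero =>
    exact contMDiffOn_mul (hf.comp contMDiffOn_fst fun z hz => hz.1)
      (hg.comp contMDiffOn_snd fun z hz => hz.2)
  | succ k ih =>
    have h := isCoframe B c hΩ
    exact contMDiffOn_finsetSum (t := Finset.univ) fun j _ =>
      ih (h.contMDiffOn_lieD (some (.inl j)) f hf) (h.contMDiffOn_lieD (some (.inr j)) g hg)

theorem contMDiffOn_expSum (hΩ : IsSymplectic Ω) (N : ℕ) {f g : Y → ℂ}
    (hf : ContMDiff 𝓘(ℝ, F) 𝓘(ℝ, ℂ) ∞ f) (hg : ContMDiff 𝓘(ℝ, F) 𝓘(ℝ, ℂ) ∞ g) :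
    ContMDiffOn (𝓘(ℝ, F).prod 𝓘(ℝ, F)) 𝓘(ℝ, ℂ) ∞ (expSum B c f g N)
      {z | B.proj z.1 ∈ c.U ∧ B.proj z.2 ∈ c.U} :=
  contMDiffOn_finsetSum fun k _ => contMDiffOn_mul contMDiffOn_const
    (contMDiffOn_nuLiftPow hΩ k hf.contMDiffOn hg.contMDiffOn)

theorem expSum_smul_add_left (hΩ : IsSymplectic Ω) {z : Y × Y} (h₁ : B.proj z.1 ∈ c.U)
    (h₂ : B.proj z.2 ∈ c.U) (N : ℕ) (a : ℂ) {f f' g : Y → ℂ}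
    (hf : ContMDiff 𝓘(ℝ, F) 𝓘(ℝ, ℂ) ∞ f) (hf' : ContMDiff 𝓘(ℝ, F) 𝓘(ℝ, ℂ) ∞ f')
    (hg : ContMDiff 𝓘(ℝ, F) 𝓘(ℝ, ℂ) ∞ g) :
    expSum B c (a • f + f') g N z = a * expSum B c f g N z + expSum B c f' g N z := by
  have e := res_eqOn f (hf.contMDiffOn (s := B.proj ⁻¹' c.U))
  have e' := res_eqOn f' (hf'.contMDiffOn (s := B.proj ⁻¹' c.U))
  have eg := res_eqOn g (hg.contMDiffOn (s := B.proj ⁻¹' c.U))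
  have h := isCoframe B c hΩ
  have hβ : ∀ f g : smoothOn F (B.proj ⁻¹' c.U), evalTensor (B.proj ⁻¹' c.U) z f g = (f : Y → ℂ) z.1 * (g : Y → ℂ) z.2 :=
    fun _ _ => rfl
  rw [expSum_eq_expBi h h₁ h₂ hβ N e eg, expSum_eq_expBi h h₁ h₂ hβ N e' eg,
    expSum_eq_expBi h h₁ h₂ hβ N (f' := a • res f hf.contMDiffOn + res f' hf'.contMDiffOn)
      (fun y hy => by simp [e hy, e' hy]) eg]
  simp

theorem expSum_smul_add_right (hΩ : IsSymplectic Ω) {z : Y × Y} (h₁ : B.proj z.1 ∈ c.U)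
    (h₂ : B.proj z.2 ∈ c.U) (N : ℕ) (a : ℂ) {f g g' : Y → ℂ}
    (hf : ContMDiff 𝓘(ℝ, F) 𝓘(ℝ, ℂ) ∞ f) (hg : ContMDiff 𝓘(ℝ, F) 𝓘(ℝ, ℂ) ∞ g)
    (hg' : ContMDiff 𝓘(ℝ, F) 𝓘(ℝ, ℂ) ∞ g') :
    expSum B c f (a • g + g') N z = a * expSum B c f g N z + expSum B c f g' N z := by
  have ef := res_eqOn f (hf.contMDiffOn (s := B.proj ⁻¹' c.U))
  have e := res_eqOn g (hg.contMDiffOn (s := B.proj ⁻¹' c.U))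
  have e' := res_eqOn g' (hg'.contMDiffOn (s := B.proj ⁻¹' c.U))
  have h := isCoframe B c hΩ
  have hβ : ∀ f g : smoothOn F (B.proj ⁻¹' c.U), evalTensor (B.proj ⁻¹' c.U) z f g = (f : Y → ℂ) z.1 * (g : Y → ℂ) z.2 :=
    fun _ _ => rfl
  rw [expSum_eq_expBi h h₁ h₂ hβ N ef e, expSum_eq_expBi h h₁ h₂ hβ N ef e',
    expSum_eq_expBi h h₁ h₂ hβ N ef (g' := a • res g hg.contMDiffOn + res g' hg'.contMDiffOn)
      (fun y hy => by simp [e hy, e' hy])]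
  simp

/-- The derivative of the partial sums on the diagonal along the polarization `J`. -/
theorem lieD_expSum_diag (hħ : ħ ≠ 0) (hΩ : IsSymplectic Ω) {H : X → ℂ}
    (hH : ContMDiff 𝓘(ℝ, E) 𝓘(ℝ, ℂ) ∞ H) {Ψ : Y → ℂ} (hΨ : Ψ ∈ polarized B J) (i : Fin n) {y : Y}
    (hy : B.proj y ∈ c.U) (N : ℕ) :
    lieD (B.lift (c.P i)) (fun y' => expSum B c (H ∘ B.proj) Ψ (N + 1) (y', y')) y =
      lieD (B.lift (c.P i)) (fun y' => expSum B c (H ∘ B.proj) Ψ (N + 1) (y', y)) y -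
        lieD (B.lift (c.P i)) (fun y' => expSum B c (H ∘ B.proj) Ψ N (y', y)) y := by
  set V := B.proj ⁻¹' c.U with hV
  have h : IsCoframe V _ _ _ := isCoframe B c hΩ
  have hf := hH.comp B.isBundle.smooth_proj
  set f' : smoothOn F V := res (H ∘ B.proj) hf.contMDiffOn
  set g' : smoothOn F V := res Ψ hΨ.1.1.contMDiffOn
  have ef : Set.EqOn (H ∘ B.proj) f' V := res_eqOn _ _
  have eg : Set.EqOn Ψ g' V := res_eqOn _ _
  have h1 : h.op none g' = Complex.I • g' := smoothOn_ext fun z hz => by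
    rw [← h.op_eqOn none eg hz, Submodule.coe_smul, Pi.smul_apply, ← eg hz]
    exact lieD_genC_of_mem B.isBundle hΨ.1 z
  have h2 : h.op (some (.inl i)) g' = 0 := smoothOn_ext fun z hz => by
    rw [← h.op_eqOn (some (.inl i)) eg hz]
    exact hΨ.2 z _ (c.P_mem hz i)
  -- Here c = ħ/i, κ = -1/ħ from the curvature and s = i from equivariance, so that c κ s = -1.
  have h3 := expBi_telescope (P := fun j => h.op (some (.inl j)))
    (Q := fun j => h.op (some (.inr j))) (β := mulS V) ((ħ : ℂ) / Complex.I)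
    (R := h.op (some (.inl i))) (RM := h.op (some (.inl i))) (S := h.op none) (-(ħ : ℂ)⁻¹)
    Complex.I i (h.op_mulS _) (fun j g => op_P_op_Q h g i j) (fun j f => op_P_comm h f i j)
    (fun j g => op_none_comm h g _) h2 h1 (by
      have : (ħ : ℂ) ≠ 0 := by exact_mod_cast hħ
      field_simp) N f'
  -- The product with the second factor evaluated at the fixed point y, as a function of the first
  -- point: differentiating it gives the partial derivative in the first variable.
  let β : smoothOn F V →ₗ[ℂ] smoothOn F V →ₗ[ℂ] smoothOn F V :=
    (LinearMap.lsmul ℂ (smoothOn F V)).flip.compl₂ (evalS F V y)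
  have hβ : ∀ f g, β f g = (g : Y → ℂ) y • f := fun _ _ => rfl
  have h4 : ∀ N, lieD (B.lift (c.P i)) (fun y' => expSum B c (H ∘ B.proj) Ψ N (y', y)) y =
      evalS F V y (expBi (fun j => h.op (some (.inl j))) (fun j => h.op (some (.inr j)))
        (mulS V) ((ħ : ℂ) / Complex.I) N (h.op (some (.inl i)) f') g') := fun N => by
    have h5 : Set.EqOn (fun y' => expSum B c (H ∘ B.proj) Ψ N (y', y))
        (expBi (fun j => h.op (some (.inl j))) (fun j => h.op (some (.inr j))) β
          ((ħ : ℂ) / Complex.I) N f' g' : smoothOn F V) V := fun y' hy' => by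
      have h6 := expSum_eq_expBi h (z := (y', y)) hy' hy (β := β.compr₂ (evalS F V y'))
        (fun f g => mul_comm ((g : Y → ℂ) y) ((f : Y → ℂ) y')) N ef eg
      rwa [← map_expBi] at h6
    have h7 := h.op_eqOn (some (.inl i)) h5 hy
    rw [expBi_derivation (RA := h.op (some (.inl i))) _ (fun f g => by simp [hβ])
      (fun j f => op_P_comm h f i j)] at h7
    refine h7.trans ?_
    have h8 : β.compr₂ (evalS F V y) = (mulS V).compr₂ (evalS F V y) :=
      LinearMap.ext₂ fun f g => mul_comm ((g : Y → ℂ) y) ((f : Y → ℂ) y)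
    rw [← evalS_apply, map_expBi, map_expBi, h8]
  have h8 : Set.EqOn (fun y' => expSum B c (H ∘ B.proj) Ψ (N + 1) (y', y'))
      (expBi (fun j => h.op (some (.inl j))) (fun j => h.op (some (.inr j))) (mulS V)
        ((ħ : ℂ) / Complex.I) (N + 1) f' g' : smoothOn F V) V := fun y' hy' => by
    have h6 := expSum_eq_expBi h (z := (y', y')) hy' hy' (β := (mulS V).compr₂ (evalS F V y'))
      (fun f g => rfl) (N + 1) ef eg
    rwa [← map_expBi] at h6
  have h9 := h.op_eqOn (some (.inl i)) h8 hy
  rw [h3] at h9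
  rw [h4, h4]
  exact h9

end ExpSum

/-! ### The sum of the series, its polarization, and the quantum operator. -/

section NormalProduct

variable {E : Type*} [NormedAddCommGroup E] [NormedSpace ℝ E]
  {X : Type*} [TopologicalSpace X] [ChartedSpace E X] {n : ℕ}
  {F : Type*} [NormedAddCommGroup F] [NormedSpace ℝ F] [FiniteDimensional ℝ F]
  {Y : Type*} [TopologicalSpace Y] [ChartedSpace F Y] [IsManifold 𝓘(ℝ, F) ∞ Y] [MulAction Circle Y]
  {ħ : ℝ} (S : FlatBiPolarized E X n) (B : PrequantumBundle F Y ħ S.Ω)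

theorem expSum_diag {f g : Y → ℂ} (hf : ContMDiff 𝓘(ℝ, F) 𝓘(ℝ, ℂ) ∞ f)
    (hg : ContMDiff 𝓘(ℝ, F) 𝓘(ℝ, ℂ) ∞ g) (c : DarbouxChart n S.Ω S.J S.K) {y : Y}
    (hy : B.proj y ∈ c.U) (N : ℕ) :
    expSum B c f g N (y, y) =
      ∑ k ∈ Finset.range N, ((ħ : ℂ) / Complex.I) ^ k * liftCoeff S B k f g y :=
  Finset.sum_congr rfl fun k _ => by
    rw [← liftCoeff_eq S B hf hg k c hy]
    ring

/-- The hypothesis provides a limit in one chart. On the diagonal the partial sums are combinations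
of the C_k and thus the same in all charts, so the limit also exists in the chart used by
`normalProduct` and has the same value. -/
theorem tendsto_normalProduct {H : X → ℂ} (hH : ContMDiff 𝓘(ℝ, E) 𝓘(ℝ, ℂ) ∞ H) {Ψ : Y → ℂ}
    (hΨ : ContMDiff 𝓘(ℝ, F) 𝓘(ℝ, ℂ) ∞ Ψ) (h : ExpConverges S B H Ψ)
    (c : DarbouxChart n S.Ω S.J S.K) {y : Y} (hy : B.proj y ∈ c.U) :
    Filter.Tendsto (fun N => expSum B c (H ∘ B.proj) Ψ N (y, y)) Filter.atTop
      (𝓝 (normalProduct S B H Ψ y)) := by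
  obtain ⟨c', W, G, _, hyW, hWU, hG⟩ := h y
  have h1 := hG.tendsto hyW
  have hf := contMDiff_comp_proj S B hH
  simp only [fun N => expSum_diag S B hf hΨ c hy N]
  simp only [fun N => expSum_diag S B hf hΨ c' (hWU _ hyW).1 N] at h1
  have h2 : normalProduct S B H Ψ y = G (y, y) := by
    refine Filter.Tendsto.limUnder_eq ?_
    simpa only [fun N => expSum_diag S B hf hΨ _ (mem_chart S (B.proj y)) N] using h1
  rwa [h2]

theorem normalProduct_eq {H : X → ℂ} (hH : ContMDiff 𝓘(ℝ, E) 𝓘(ℝ, ℂ) ∞ H) {Ψ : Y → ℂ}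
    (hΨ : ContMDiff 𝓘(ℝ, F) 𝓘(ℝ, ℂ) ∞ Ψ) (h : ExpConverges S B H Ψ)
    {c : DarbouxChart n S.Ω S.J S.K} {y : Y} (hy : B.proj y ∈ c.U) {a : ℂ}
    (ha : Filter.Tendsto (fun N => expSum B c (H ∘ B.proj) Ψ N (y, y)) Filter.atTop (𝓝 a)) :
    normalProduct S B H Ψ y = a :=
  tendsto_nhds_unique (tendsto_normalProduct S B hH hΨ h c hy) ha

theorem normalProduct_eqOn {H : X → ℂ} (hH : ContMDiff 𝓘(ℝ, E) 𝓘(ℝ, ℂ) ∞ H) {Ψ : Y → ℂ}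
    (hΨ : ContMDiff 𝓘(ℝ, F) 𝓘(ℝ, ℂ) ∞ Ψ) (h : ExpConverges S B H Ψ)
    {c : DarbouxChart n S.Ω S.J S.K} {W : Set (Y × Y)} {G : Y × Y → ℂ}
    (hWU : ∀ z ∈ W, B.proj z.1 ∈ c.U ∧ B.proj z.2 ∈ c.U)
    (hG : SmoothTendstoOn (𝓘(ℝ, F).prod 𝓘(ℝ, F)) (expSum B c (H ∘ B.proj) Ψ) G W) :
    Set.EqOn (normalProduct S B H Ψ) (G ∘ fun y => (y, y)) ((fun y => (y, y)) ⁻¹' W) :=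
  fun _ hy => normalProduct_eq S B hH hΨ h (hWU _ hy).1 (hG.tendsto hy)

theorem contMDiff_normalProduct {H : X → ℂ} (hH : ContMDiff 𝓘(ℝ, E) 𝓘(ℝ, ℂ) ∞ H) {Ψ : Y → ℂ}
    (hΨ : ContMDiff 𝓘(ℝ, F) 𝓘(ℝ, ℂ) ∞ Ψ) (h : ExpConverges S B H Ψ) :
    ContMDiff 𝓘(ℝ, F) 𝓘(ℝ, ℂ) ∞ (normalProduct S B H Ψ) := fun y => by
  obtain ⟨c, W, G, hW, hyW, hWU, hG⟩ := h y
  have hΔ : ContMDiff 𝓘(ℝ, F) (𝓘(ℝ, F).prod 𝓘(ℝ, F)) ∞ (fun y : Y => (y, y)) :=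
    contMDiff_id.prodMk contMDiff_id
  refine ContMDiffAt.congr_of_eventuallyEq (f := G ∘ fun y => (y, y)) ?_
    (Filter.eventuallyEq_of_mem ((hW.preimage hΔ.continuous).mem_nhds hyW)
      (normalProduct_eqOn S B hH hΨ h hWU hG))
  exact ContMDiffAt.comp (f := fun y : Y => (y, y)) y (hG.1.contMDiffAt (hW.mem_nhds hyW)) (hΔ y)

/-- Each coefficient C_k(H, Ψ) is equivariant, and equivariance passes to pointwise limits. -/
theorem normalProduct_mem_waveFunctions {H : X → ℂ} (hH : ContMDiff 𝓘(ℝ, E) 𝓘(ℝ, ℂ) ∞ H)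
    {Ψ : Y → ℂ} (hΨ : Ψ ∈ waveFunctions F Y) (h : ExpConverges S B H Ψ) :
    normalProduct S B H Ψ ∈ waveFunctions F Y := by
  refine ⟨contMDiff_normalProduct S B hH hΨ.1 h, fun u y => ?_⟩
  have hf := contMDiff_comp_proj S B hH
  have hy : B.proj (u • y) ∈ (chart S (B.proj y)).U := by
    rw [B.isBundle.proj_smul]
    exact mem_chart S _
  refine normalProduct_eq S B hH hΨ.1 h hy ?_
  have h1 := (tendsto_normalProduct S B hH hΨ.1 h _ (mem_chart S (B.proj y))).const_mul (u : ℂ)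
  refine h1.congr fun N => ?_
  rw [expSum_diag S B hf hΨ.1 _ hy, expSum_diag S B hf hΨ.1 _ (mem_chart S _), Finset.mul_sum]
  refine Finset.sum_congr rfl fun k _ => ?_
  rw [(liftCoeff_mem_waveFunctions S B hH hΨ k).2]
  ring

/-- Along J, the derivative of the partial sum on the diagonal is the difference of two consecutive
first-variable derivatives. These converge, so the difference tends to zero, while the diagonal
derivatives converge to the derivative of the limit. -/
theorem normalProduct_mem_polarized (hħ : ħ ≠ 0) {H : X → ℂ}
    (hH : ContMDiff 𝓘(ℝ, E) 𝓘(ℝ, ℂ) ∞ H) {Ψ : Y → ℂ} (hΨ : Ψ ∈ polarized B S.J)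
    (h : ExpConverges S B H Ψ) : normalProduct S B H Ψ ∈ polarized B S.J := by
  refine ⟨normalProduct_mem_waveFunctions S B hH hΨ.1 h, fun y ζ hζ => ?_⟩
  obtain ⟨c, W, G, hW, hyW, hWU, hG⟩ := h y
  have hf := contMDiff_comp_proj S B hH
  have hy : B.proj y ∈ c.U := (hWU _ hyW).1
  have hΔ : ContMDiff 𝓘(ℝ, F) (𝓘(ℝ, F).prod 𝓘(ℝ, F)) ∞ (fun y : Y => (y, y)) :=
    contMDiff_id.prodMk contMDiff_id
  have hs : ContMDiff 𝓘(ℝ, F) (𝓘(ℝ, F).prod 𝓘(ℝ, F)) ∞ (fun y' : Y => (y', y)) :=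
    contMDiff_id.prodMk contMDiff_const
  have hsm : ∀ N, ContMDiffOn (𝓘(ℝ, F).prod 𝓘(ℝ, F)) 𝓘(ℝ, ℂ) ∞
      (expSum B c (H ∘ B.proj) Ψ N) W := fun N =>
    (contMDiffOn_expSum S.symplectic N hf hΨ.1.1).mono hWU
  rw [c.span_P _ hy] at hζ
  induction hζ using Submodule.span_induction with
  | zero => simp
  | add ζ ζ' _ _ h₁ h₂ => rw [map_add, map_add, h₁, h₂, add_zero]
  | smul a ζ _ h₁ => rw [map_smul, map_smul, h₁, smul_zero]
  | mem ζ hζ =>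
    obtain ⟨i, rfl⟩ := hζ
    have h1 := hG.tendsto_dC hW hsm (hΔ.mdifferentiable (by simp) y) hyW (B.lift (c.P i) y)
    have h2 := hG.tendsto_dC hW hsm (hs.mdifferentiable (by simp) y) hyW (B.lift (c.P i) y)
    have h3 := ((Filter.tendsto_add_atTop_iff_nat 1).2 h2).sub h2
    rw [sub_self] at h3
    have h4 := tendsto_nhds_unique ((Filter.tendsto_add_atTop_iff_nat 1).2 h1)
      (h3.congr fun N => (lieD_expSum_diag hħ S.symplectic hH hΨ i hy N).symm)
    exact (lieD_congr (B.lift (c.P i)) (hW.preimage hΔ.continuous)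
      (normalProduct_eqOn S B hH hΨ.1.1 h hWU hG) hyW).trans h4

/-- Convergence is stable under linear combinations. -/
theorem ExpConverges.of_linear {H₁ H₂ H : X → ℂ} {Ψ₁ Ψ₂ Ψ : Y → ℂ}
    (hH₁ : ContMDiff 𝓘(ℝ, E) 𝓘(ℝ, ℂ) ∞ H₁) (hH₂ : ContMDiff 𝓘(ℝ, E) 𝓘(ℝ, ℂ) ∞ H₂)
    (hΨ₁ : ContMDiff 𝓘(ℝ, F) 𝓘(ℝ, ℂ) ∞ Ψ₁) (hΨ₂ : ContMDiff 𝓘(ℝ, F) 𝓘(ℝ, ℂ) ∞ Ψ₂)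
    (h₁ : ExpConverges S B H₁ Ψ₁) (h₂ : ExpConverges S B H₂ Ψ₂) (a : ℂ)
    (hlin : ∀ (c : DarbouxChart n S.Ω S.J S.K) (z : Y × Y) (N : ℕ), B.proj z.1 ∈ c.U →
      B.proj z.2 ∈ c.U → expSum B c (H ∘ B.proj) Ψ N z =
        a * expSum B c (H₁ ∘ B.proj) Ψ₁ N z + expSum B c (H₂ ∘ B.proj) Ψ₂ N z) :
    ExpConverges S B H Ψ := fun y => by
  obtain ⟨c₁, W₁, G₁, hW₁, hyW₁, hWU₁, hG₁⟩ := h₁ y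
  obtain ⟨c₂, W₂, G₂, hW₂, hyW₂, hWU₂, hG₂⟩ := h₂ y
  -- The two series may converge in different charts. Near the diagonal the charts give the same
  -- terms even off the diagonal, so the second series can be read in the first chart.
  obtain ⟨V, hV, hyV, hVU, hVeq⟩ := exists_nuLiftPow_eq B c₁ c₂ S.symplectic (hWU₁ _ hyW₁).1
    (hWU₂ _ hyW₂).1
  have hf₁ := contMDiff_comp_proj S B hH₁
  have hf₂ := contMDiff_comp_proj S B hH₂
  have hW : IsOpen (W₁ ∩ W₂ ∩ V ×ˢ V) := (hW₁.inter hW₂).inter (hV.prod hV)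
  have hWU : ∀ z ∈ W₁ ∩ W₂ ∩ V ×ˢ V, B.proj z.1 ∈ c₁.U ∧ B.proj z.2 ∈ c₁.U :=
    fun z hz => hWU₁ z hz.1.1
  refine ⟨c₁, W₁ ∩ W₂ ∩ V ×ˢ V, a • G₁ + G₂, hW, ⟨⟨hyW₁, hyW₂⟩, hyV, hyV⟩, hWU, ?_⟩
  refine SmoothTendstoOn.smul_add hW (hG₁.mono fun z hz => hz.1.1) (hG₂.mono fun z hz => hz.1.2)
    (fun N => (contMDiffOn_expSum S.symplectic N hf₁ hΨ₁).mono hWU)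
    (fun N => (contMDiffOn_expSum S.symplectic N hf₂ hΨ₂).mono fun z hz => hWU₂ z hz.1.2) a
    fun N z hz => ?_
  have h3 : expSum B c₁ (H₂ ∘ B.proj) Ψ₂ N z = expSum B c₂ (H₂ ∘ B.proj) Ψ₂ N z :=
    Finset.sum_congr rfl fun k _ => by
      rw [hVeq _ _ hf₂.contMDiffOn hΨ₂.contMDiffOn z hz.2.1 hz.2.2 k]
  rw [hlin c₁ z N (hWU z hz).1 (hWU z hz).2, h3]
  rfl

theorem normalProduct_of_linear {H₁ H₂ H : X → ℂ} {Ψ₁ Ψ₂ Ψ : Y → ℂ}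
    (hH₁ : ContMDiff 𝓘(ℝ, E) 𝓘(ℝ, ℂ) ∞ H₁) (hH₂ : ContMDiff 𝓘(ℝ, E) 𝓘(ℝ, ℂ) ∞ H₂)
    (hH : ContMDiff 𝓘(ℝ, E) 𝓘(ℝ, ℂ) ∞ H)
    (hΨ₁ : ContMDiff 𝓘(ℝ, F) 𝓘(ℝ, ℂ) ∞ Ψ₁) (hΨ₂ : ContMDiff 𝓘(ℝ, F) 𝓘(ℝ, ℂ) ∞ Ψ₂)
    (hΨ : ContMDiff 𝓘(ℝ, F) 𝓘(ℝ, ℂ) ∞ Ψ)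
    (h₁ : ExpConverges S B H₁ Ψ₁) (h₂ : ExpConverges S B H₂ Ψ₂) (a : ℂ)
    (hlin : ∀ (c : DarbouxChart n S.Ω S.J S.K) (z : Y × Y) (N : ℕ), B.proj z.1 ∈ c.U →
      B.proj z.2 ∈ c.U → expSum B c (H ∘ B.proj) Ψ N z =
        a * expSum B c (H₁ ∘ B.proj) Ψ₁ N z + expSum B c (H₂ ∘ B.proj) Ψ₂ N z) :
    normalProduct S B H Ψ = a • normalProduct S B H₁ Ψ₁ + normalProduct S B H₂ Ψ₂ := by
  ext y
  have hy := mem_chart S (B.proj y)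
  refine normalProduct_eq S B hH hΨ
    (ExpConverges.of_linear S B hH₁ hH₂ hΨ₁ hΨ₂ h₁ h₂ a hlin) hy ?_
  refine (((tendsto_normalProduct S B hH₁ hΨ₁ h₁ _ hy).const_mul a).add
    (tendsto_normalProduct S B hH₂ hΨ₂ h₂ _ hy)).congr fun N => ?_
  exact (hlin _ (y, y) N hy hy).symm

/-- A terminating exponential series converges. -/
theorem expConverges_of_nuLiftPow_eq_zero {H : X → ℂ} (hH : ContMDiff 𝓘(ℝ, E) 𝓘(ℝ, ℂ) ∞ H)
    {Ψ : Y → ℂ} (hΨ : ContMDiff 𝓘(ℝ, F) 𝓘(ℝ, ℂ) ∞ Ψ)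
    (h : ∀ x : X, ∃ (c : DarbouxChart n S.Ω S.J S.K) (d : ℕ), x ∈ c.U ∧ ∀ k, d ≤ k →
      ∀ z : Y × Y, B.proj z.1 ∈ c.U → B.proj z.2 ∈ c.U →
        nuLiftPow B c k (H ∘ B.proj) Ψ z = 0) : ExpConverges S B H Ψ := fun y => by
  obtain ⟨c, d, hy, hc⟩ := h (B.proj y)
  have hV : IsOpen (B.proj ⁻¹' c.U) := c.isOpen.preimage B.isBundle.smooth_proj.continuous
  have hW : IsOpen {z : Y × Y | B.proj z.1 ∈ c.U ∧ B.proj z.2 ∈ c.U} := hV.prod hV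
  refine ⟨c, _, expSum B c (H ∘ B.proj) Ψ d, hW, ⟨hy, hy⟩, fun z hz => hz, ?_⟩
  refine SmoothTendstoOn.of_eventually_eqOn hW
    (contMDiffOn_expSum S.symplectic d (contMDiff_comp_proj S B hH) hΨ) ?_
  filter_upwards [Filter.eventually_ge_atTop d] with N hN z hz
  symm
  refine Finset.sum_subset (Finset.range_subset_range.2 hN) fun k _ hk => ?_
  rw [hc k (by simpa using hk) z hz.1 hz.2, mul_zero]

theorem expConverges_zero {H : X → ℂ} (hH : ContMDiff 𝓘(ℝ, E) 𝓘(ℝ, ℂ) ∞ H) :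
    ExpConverges S B H 0 := by
  refine expConverges_of_nuLiftPow_eq_zero S B hH contMDiff_const fun x =>
    ⟨chart S x, 0, mem_chart S x, fun k _ z h₁ h₂ => ?_⟩
  rw [nuLiftPow_eq (g := 0) (isCoframe B (chart S x) S.symplectic) h₁ h₂
    (β := evalTensor (B.proj ⁻¹' (chart S x).U) z) (fun _ _ => rfl) k
    (res_eqOn _ (contMDiff_comp_proj S B hH).contMDiffOn) (g' := 0) (fun _ _ => rfl), map_zero]

/-- The k-th power of the lifted tensor applies k momentum derivatives to H, so all terms of order
at least d vanish and the series is a finite sum over the chart. -/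
theorem IsMomentumPolynomial.expConverges {H : X → ℂ} (hH : ContMDiff 𝓘(ℝ, E) 𝓘(ℝ, ℂ) ∞ H)
    (hp : IsMomentumPolynomial S H) {Ψ : Y → ℂ} (hΨ : ContMDiff 𝓘(ℝ, F) 𝓘(ℝ, ℂ) ∞ Ψ) :
    ExpConverges S B H Ψ := by
  refine expConverges_of_nuLiftPow_eq_zero S B hH hΨ fun x => ?_
  obtain ⟨c, d, hx, hc⟩ := hp x
  refine ⟨c, d, hx, fun k hk z h₁ h₂ => ?_⟩
  have h1 : ∀ l : List (Fin n), Set.EqOn (l.foldr (fun i f => lieD (c.P i) f) H)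
      (l.foldr (fun j f => baseOp B c S.symplectic (.inl j) f) (res H hH.contMDiffOn) :
        smoothOn E c.U) c.U := fun l => by
    induction l with
    | nil => exact res_eqOn _ _
    | cons i l ih => exact lieOp_eqOn _ _ _ ih
  rw [nuLiftPow_comp_proj_eq (f := H ∘ B.proj) B c S.symplectic h₁ h₂
    (β := (LinearMap.mul ℂ ℂ).compl₁₂ (evalS E c.U (B.proj z.1)) (evalS F _ z.2))
    (fun _ _ => rfl) k (f' := res H hH.contMDiffOn) (fun y hy => res_eqOn H hH.contMDiffOn hy)
    (res_eqOn _ hΨ.contMDiffOn)]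
  refine biPow_eq_zero hk (fun l hl => smoothOn_ext fun x' hx' => ?_) _
  rw [← h1 l hx']
  exact hc l hl x' hx'

/-- The wave functions on which the quantum operator of `H` is defined. -/
def operatorDomain {H : X → ℂ} (hH : ContMDiff 𝓘(ℝ, E) 𝓘(ℝ, ℂ) ∞ H) : Submodule ℂ (Y → ℂ) :=
  have key : ∀ (a : ℂ) {Ψ₁ Ψ₂ : Y → ℂ}, Ψ₁ ∈ polarized B S.J ∧ ExpConverges S B H Ψ₁ →
      Ψ₂ ∈ polarized B S.J ∧ ExpConverges S B H Ψ₂ →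
      a • Ψ₁ + Ψ₂ ∈ polarized B S.J ∧ ExpConverges S B H (a • Ψ₁ + Ψ₂) := fun a _ _ h₁ h₂ =>
    ⟨Submodule.add_mem _ (Submodule.smul_mem _ a h₁.1) h₂.1,
      ExpConverges.of_linear S B hH hH h₁.1.1.1 h₂.1.1.1 h₁.2 h₂.2 a fun _ _ N hz₁ hz₂ =>
        expSum_smul_add_right S.symplectic hz₁ hz₂ N a (contMDiff_comp_proj S B hH) h₁.1.1.1
          h₂.1.1.1⟩
  have zero : (0 : Y → ℂ) ∈ polarized B S.J ∧ ExpConverges S B H 0 :=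
    ⟨Submodule.zero_mem _, expConverges_zero S B hH⟩
  { carrier := {Ψ | Ψ ∈ polarized B S.J ∧ ExpConverges S B H Ψ}
    zero_mem' := zero
    add_mem' := fun {f g} hf hg => by simpa using key 1 hf hg
    smul_mem' := fun a f hf => by simpa using key a hf zero }

/-- The quantum operator of the observable `H`. -/
def quantumOperator (hħ : ħ ≠ 0) {H : X → ℂ} (hH : ContMDiff 𝓘(ℝ, E) 𝓘(ℝ, ℂ) ∞ H) :
    operatorDomain S B hH →ₗ[ℂ] polarized B S.J :=
  have key : ∀ (a : ℂ) (Ψ₁ Ψ₂ : operatorDomain S B hH),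
      normalProduct S B H (a • (Ψ₁ : Y → ℂ) + Ψ₂) =
        a • normalProduct S B H Ψ₁ + normalProduct S B H Ψ₂ := fun a Ψ₁ Ψ₂ =>
    normalProduct_of_linear S B hH hH hH Ψ₁.2.1.1.1 Ψ₂.2.1.1.1
      (a • Ψ₁ + Ψ₂).2.1.1.1 Ψ₁.2.2 Ψ₂.2.2 a fun _ _ N hz₁ hz₂ =>
        expSum_smul_add_right S.symplectic hz₁ hz₂ N a (contMDiff_comp_proj S B hH) Ψ₁.2.1.1.1
          Ψ₂.2.1.1.1
  have zero : normalProduct S B H 0 = 0 := by simpa using key 1 0 0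
  { toFun := fun Ψ => ⟨normalProduct S B H Ψ, normalProduct_mem_polarized S B hħ hH Ψ.2.1 Ψ.2.2⟩
    map_add' := fun Ψ₁ Ψ₂ => Subtype.ext (by simpa using key 1 Ψ₁ Ψ₂)
    map_smul' := fun a Ψ => Subtype.ext (by simpa [zero] using key a Ψ 0) }

end NormalProduct

end NormalProduct

end

/-! ### The theorem. -/

theorem mainTheorem1 {n : ℕ} {ħ : ℝ} (hħ : 0 < ħ)
    {E : Type*} [NormedAddCommGroup E] [NormedSpace ℝ E] [FiniteDimensional ℝ E]
    {X : Type*} [TopologicalSpace X] [ChartedSpace E X] [IsManifold 𝓘(ℝ, E) ∞ X]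
    {F : Type*} [NormedAddCommGroup F] [NormedSpace ℝ F] [FiniteDimensional ℝ F]
    {Y : Type*} [TopologicalSpace Y] [ChartedSpace F Y] [IsManifold 𝓘(ℝ, F) ∞ Y]
    [MulAction Circle Y]
    (S : NormalProduct.FlatBiPolarized E X n)
    (B : NormalProduct.PrequantumBundle F Y ħ S.Ω) :
    -- the coefficients of the lifted product do not depend on the Darboux chart
    (∀ f g : Y → ℂ, ContMDiff 𝓘(ℝ, F) 𝓘(ℝ, ℂ) ∞ f → ContMDiff 𝓘(ℝ, F) 𝓘(ℝ, ℂ) ∞ g →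
      ∀ (k : ℕ) (c : NormalProduct.DarbouxChart n S.Ω S.J S.K) (y : Y), B.proj y ∈ c.U →
        (k.factorial : ℂ)⁻¹ * NormalProduct.nuLiftPow B c k f g (y, y) =
          NormalProduct.liftCoeff S B k f g y) ∧
    -- the product is a prequantum product: it maps observables and prequantum wave functions to
    -- prequantum wave functions, and is a left module structure over the star product on `X`
    (∀ H : X → ℂ, ContMDiff 𝓘(ℝ, E) 𝓘(ℝ, ℂ) ∞ H → ∀ Ψ ∈ NormalProduct.waveFunctions F Y,
      ∀ k : ℕ, NormalProduct.liftCoeff S B k (H ∘ B.proj) Ψ ∈ NormalProduct.waveFunctions F Y) ∧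
    (∀ H₁ H₂ : X → ℂ, ContMDiff 𝓘(ℝ, E) 𝓘(ℝ, ℂ) ∞ H₁ → ContMDiff 𝓘(ℝ, E) 𝓘(ℝ, ℂ) ∞ H₂ →
      ∀ h : Y → ℂ, ContMDiff 𝓘(ℝ, F) 𝓘(ℝ, ℂ) ∞ h → ∀ N : ℕ,
        ∑ ab ∈ Finset.HasAntidiagonal.antidiagonal N,
            NormalProduct.liftCoeff S B ab.1
              (NormalProduct.starCoeff S ab.2 H₁ H₂ ∘ B.proj) h =
          ∑ ab ∈ Finset.HasAntidiagonal.antidiagonal N,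
            NormalProduct.liftCoeff S B ab.1 (H₁ ∘ B.proj)
              (NormalProduct.liftCoeff S B ab.2 (H₂ ∘ B.proj) h)) ∧
    -- the product of an observable and a polarized wave function is a polarized wave function
    (∀ H : X → ℂ, ContMDiff 𝓘(ℝ, E) 𝓘(ℝ, ℂ) ∞ H → ∀ Ψ ∈ NormalProduct.polarized B S.J,
      NormalProduct.ExpConverges S B H Ψ →
        NormalProduct.normalProduct S B H Ψ ∈ NormalProduct.polarized B S.J ∧
        ∀ (c : NormalProduct.DarbouxChart n S.Ω S.J S.K) (y : Y), B.proj y ∈ c.U →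
          Filter.Tendsto (fun N => NormalProduct.expSum B c (H ∘ B.proj) Ψ N (y, y)) Filter.atTop
            (𝓝 (NormalProduct.normalProduct S B H Ψ y))) ∧
    -- hence each observable defines a linear quantum operator on polarized wave functions
    (∀ H : X → ℂ, ContMDiff 𝓘(ℝ, E) 𝓘(ℝ, ℂ) ∞ H →
      ∃ (D : Submodule ℂ (Y → ℂ)) (Q : D →ₗ[ℂ] NormalProduct.polarized B S.J),
        (∀ Ψ : Y → ℂ, Ψ ∈ D ↔
          Ψ ∈ NormalProduct.polarized B S.J ∧ NormalProduct.ExpConverges S B H Ψ) ∧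
        ∀ Ψ : D, (Q Ψ : Y → ℂ) = NormalProduct.normalProduct S B H Ψ) ∧
    -- which depends linearly on the observable
    (∀ H₁ H₂ : X → ℂ, ContMDiff 𝓘(ℝ, E) 𝓘(ℝ, ℂ) ∞ H₁ → ContMDiff 𝓘(ℝ, E) 𝓘(ℝ, ℂ) ∞ H₂ →
      ∀ (a : ℂ), ∀ Ψ ∈ NormalProduct.polarized B S.J,
        NormalProduct.ExpConverges S B H₁ Ψ → NormalProduct.ExpConverges S B H₂ Ψ →
          NormalProduct.ExpConverges S B (a • H₁ + H₂) Ψ ∧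
          NormalProduct.normalProduct S B (a • H₁ + H₂) Ψ =
            a • NormalProduct.normalProduct S B H₁ Ψ + NormalProduct.normalProduct S B H₂ Ψ) ∧
    -- and which is defined on all polarized wave functions if the observable is polynomial in
    -- the momenta
    (∀ H : X → ℂ, ContMDiff 𝓘(ℝ, E) 𝓘(ℝ, ℂ) ∞ H → NormalProduct.IsMomentumPolynomial S H →
      ∀ Ψ ∈ NormalProduct.polarized B S.J, NormalProduct.ExpConverges S B H Ψ) := by
  refine ⟨fun f g hf hg k c y hy => NormalProduct.liftCoeff_eq S B hf hg k c hy,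
    fun H hH Ψ hΨ k => NormalProduct.liftCoeff_mem_waveFunctions S B hH hΨ k,
    fun H₁ H₂ h₁ h₂ h hh N => NormalProduct.liftCoeff_assoc S B h₁ h₂ hh N,
    fun H hH Ψ hΨ h => ⟨NormalProduct.normalProduct_mem_polarized S B hħ.ne' hH hΨ h,
      fun c y hy => NormalProduct.tendsto_normalProduct S B hH hΨ.1.1 h c hy⟩,
    fun H hH => ⟨NormalProduct.operatorDomain S B hH,
      NormalProduct.quantumOperator S B hħ.ne' hH, fun _ => Iff.rfl, fun _ => rfl⟩,
    fun H₁ H₂ h₁ h₂ a Ψ hΨ hc₁ hc₂ => ?_,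
    fun H hH hp Ψ hΨ => hp.expConverges S B hH hΨ.1.1⟩
  have hlin : ∀ (c : NormalProduct.DarbouxChart n S.Ω S.J S.K) (z : Y × Y) (N : ℕ),
      B.proj z.1 ∈ c.U → B.proj z.2 ∈ c.U →
        NormalProduct.expSum B c ((a • H₁ + H₂) ∘ B.proj) Ψ N z =
          a * NormalProduct.expSum B c (H₁ ∘ B.proj) Ψ N z +
            NormalProduct.expSum B c (H₂ ∘ B.proj) Ψ N z := fun c z N hz₁ hz₂ =>
    NormalProduct.expSum_smul_add_left S.symplectic hz₁ hz₂ N a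
      (NormalProduct.contMDiff_comp_proj S B h₁) (NormalProduct.contMDiff_comp_proj S B h₂) hΨ.1.1
  have hH : ContMDiff 𝓘(ℝ, E) 𝓘(ℝ, ℂ) ∞ (a • H₁ + H₂) :=
    ((contDiff_const_smul (𝕜 := ℝ) (n := ∞) (F := ℂ) a).comp_contMDiff h₁).add h₂
  exact ⟨NormalProduct.ExpConverges.of_linear S B h₁ h₂ hΨ.1.1 hΨ.1.1 hc₁ hc₂ a hlin,
    NormalProduct.normalProduct_of_linear S B h₁ h₂ hH hΨ.1.1 hΨ.1.1 hΨ.1.1 hc₁ hc₂ a hlin⟩
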